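/- **Conventions.** Legendrian links and tangles in $J^1M$ ($M=\mathbb R$ or $[0,1]$) are described by generic front diagrams in the $xz$-plane; at a generic $x$ strands are numbered $1,2,\dots$ with descending $z$-coordinate. A *normal ruling* $\rho$ of a Legendrian link $K\subset J^1\mathbb R$ is a sequence of fixed-point free involutions (pairings) of the strands of its front over the generic values of $x$, such that (1) the two strands meeting at a cusp are paired near the cusp, and the pairing of all other strands is unchanged there; (2) strands that meet at a crossing are not paired, and at each crossing either the paths of the ruling cross (the pairing is conjugated by the transposition of the two strands), or both turn a corner (the pairing of numbered strands is unchanged), in which case the crossing is a *switch* and the vertical segments joining the two switching strands to their companions are required to be disjoint or nested. With $j(\rho)=\#\text{switches}-\#\text{right cusps}$, the ungraded ruling polynomial is $R^1_K(z)=\sum_\rho z^{j(\rho)}$. Let $\mathcal R$ be $\mathbb Z[s^{\pm1}]$ localized to include denominators $s^n-s^{-n}$ $(n\ge1)$, and $z=s-s^{-1}$. A *Legendrian $n$-tangle* is a properly embedded Legendrian in $J^1[0,1]$ whose front is $n$ horizontal lines near each end; $\alpha\cdot\beta$ is $\beta$ stacked to the left of $\alpha$. Write fronts as words, read from left to right,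 in $\mathsf l_i$, $\mathsf r_i$, $\mathsf x_i$: a left cusp, right cusp, crossing on the strands numbered $i,i+1$. The Legendrian BMW algebra $\mathrm{BMW}^{\mathfrak{Leg}}_n$ is the quotient of the free $\mathcal R$-module on Legendrian isotopy classes of Legendrian $n$-tangles by the local skein relations $\mathsf l_{i+1}\mathsf x_i-\mathsf l_i\mathsf x_{i+1}=z(\mathsf l_{i+1}-\mathsf l_i)$, $\ \mathsf l_i\mathsf r_{i+1}=\mathsf l_{i+1}\mathsf r_i=0$, $\ \mathsf l_i\mathsf r_i=z^{-1}$, with the product induced by multiplication of tangles. Let $\sigma_i,e_i\in\mathrm{BMW}^{\mathfrak{Leg}}_n$ $(1\le i<n)$ be the classes of $\mathsf x_i$ and of $\mathsf r_i\mathsf l_i$. Given a front of a connected Legendrian knot $K\subset J^1\mathbb R$ with a chosen point (on a strand, away from crossings and cusps) and a Legendrian $n$-tangle $\alpha$, the satellite $S(K,\alpha)$ is the $n$-copy of $K$ ($n$ copies shifted slightly in the $z$-direction) with $\alpha$ inserted into the $n$ parallel strands at the chosen point. A normal ruling of $S(K,\alpha)$ is *reduced* if, outside of the inserted part, it never pairs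 two parallel strands that correspond to a single strand of $K$; $\widetilde R_{S(K,\alpha)}(z)=\sum_{\rho\text{ reduced}}z^{j(\rho)}$. For $\beta\in S_n$ the *positive permutation braid* $\beta$ is the Legendrian $n$-tangle without cusps that connects endpoint $i$ on the left to endpoint $\beta(i)$ on the right, such that for $i<j$ the strands starting at $i$ and $j$ cross exactly once if $\beta(i)>\beta(j)$ and not at all otherwise; $\lambda(\beta)$ is its number of crossings. The *ungraded $n$-colored ruling polynomial* is $$R^1_{n,K}=\frac1{c_n}\sum_{\beta\in S_n}s^{\lambda(\beta)}\widetilde R_{S(K,\beta)}(z),\qquad c_n=s^{n(n-1)/2}\prod_{i=1}^n\frac{s^i-s^{-i}}{s-s^{-1}}.$$ For $\eta\in\mathrm{BMW}^{\mathfrak{Leg}}_n$ represented by a linear combination $\sum_i r_i\alpha_i$ of $n$-tangles, put $R^1_{S(K,\eta)}=\sum_i r_iR^1_{S(K,\alpha_i)}(z)$. Finally let $L_1=1$ and, for $n\ge2$, $L_n=L_{n-1}\bigl(1-z\sum_{k=2}^n\alpha_{k,n}\bigr)\gamma_n\in\mathrm{BMW}^{\mathfrak{Leg}}_n$, where $L_{n-1}$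 is extended by a horizontal strand placed at the bottom, $\gamma_n=1+\sum_{j=1}^{n-1}s^j\sigma_{n-1}\sigma_{n-2}\cdots\sigma_{n-j}$, $\ \alpha_{2,n}=e_{n-1}$, and for $2\le k<n$ $$\alpha_{k+1,n}=\sigma_{n-k}\alpha_{k,n}\sigma_{n-k}-z\,\sigma_{n-k}\alpha_{k,n}-z\,\alpha_{k,n}\sigma_{n-k}+z^2\alpha_{k,n}.$$ **Theorem.** For every $n\ge1$ and every connected Legendrian knot $K\subset J^1\mathbb R$ (for every generic front of $K$, every chosen point, every choice of fronts of the positive permutation braids, and every linear combination of tangles representing $L_n$), $$R^1_{n,K}=\frac1{c_n}\,R^1_{S(K,L_n)}.$$ -/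

import Mathlib

/-!
Legendrian links and tangles are described by generic front diagrams, i.e. fronts in the
`xz`-plane all of whose crossings and cusps have pairwise distinct `x`-coordinates.  Up to planar
isotopy such a front is the list of its crossings and cusps read from left to right.  Strands at a
generic `x` are numbered `0, 1, 2, ...` with descending `z`-coordinate.
-/

namespace LegRuling

open LaurentPolynomial

/-! ### The coefficient ring -/

/-- The denominators `s ^ n - s ^ (-n)`, `n ≥ 1`, generate this multiplicative set. -/
noncomputable def denominators : Submonoid ℤ[T;T⁻¹] :=
  Submonoid.closure {x | ∃ n : ℕ, 1 ≤ n ∧ x = T (n : ℤ) - T (-(n : ℤ))}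

/-- `ℤ[s, s⁻¹]` localized to include the denominators `s ^ n - s ^ (-n)`, `n ≥ 1`. -/
def CoeffRing : Type := Localization denominators

noncomputable instance : CommRing CoeffRing := inferInstanceAs (CommRing (Localization denominators))

noncomputable instance : Algebra ℤ[T;T⁻¹] CoeffRing :=
  inferInstanceAs (Algebra ℤ[T;T⁻¹] (Localization denominators))

instance : IsLocalization denominators CoeffRing :=
  inferInstanceAs (IsLocalization denominators (Localization denominators))

/-- The variable `s`, an invertible element of the coefficient ring. -/
noncomputable def s : CoeffRingˣ :=
  Units.map (algebraMap ℤ[T;T⁻¹] CoeffRing).toMonoidHom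
    ⟨T 1, T (-1), by rw [← T_add]; simp, by rw [← T_add]; simp⟩

theorem isUnit_diff (n : ℕ) (hn : 1 ≤ n) :
    IsUnit ((s : CoeffRing) ^ n - ((s⁻¹ : CoeffRingˣ) : CoeffRing) ^ n) := by
  have h : T (n : ℤ) - T (-(n : ℤ)) ∈ denominators :=
    Submonoid.subset_closure ⟨n, hn, rfl⟩
  have h2 := IsLocalization.map_units CoeffRing (⟨_, h⟩ : denominators)
  have e1 : (s : CoeffRing) ^ n = algebraMap ℤ[T;T⁻¹] CoeffRing (T (n : ℤ)) := by
    simp [s, ← map_pow, T_pow]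
  have e2 : ((s⁻¹ : CoeffRingˣ) : CoeffRing) ^ n
      = algebraMap ℤ[T;T⁻¹] CoeffRing (T (-(n : ℤ))) := by
    simp [s, ← map_pow, T_pow]
  rw [e1, e2, ← map_sub]
  exact h2

/-- `s ^ n - s ^ (-n)` as an invertible element of the coefficient ring, for `n ≥ 1`. -/
noncomputable def diff (n : ℕ) (hn : 1 ≤ n) : CoeffRingˣ := (isUnit_diff n hn).unit

theorem diff_val (n : ℕ) (hn : 1 ≤ n) :
    (diff n hn : CoeffRing) = (s : CoeffRing) ^ n - ((s⁻¹ : CoeffRingˣ) : CoeffRing) ^ n := rfl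

/-- `z = s - s⁻¹`. -/
noncomputable def z : CoeffRingˣ := diff 1 le_rfl

/-- `c_n = s ^ (n (n - 1) / 2) ∏_{i = 1}^n (s ^ i - s ^ (-i)) / (s - s⁻¹)`. -/
noncomputable def c (n : ℕ) : CoeffRingˣ :=
  s ^ (n * (n - 1) / 2) * ∏ i : Fin n, (diff (i + 1) (Nat.le_add_left 1 i) / z)

/-! ### Front diagrams -/

/-- The singularities of a front. -/
inductive Kind
  | crossing
  | leftCusp
  | rightCusp

/-- Number of strands entering a singularity from the left. -/
def Kind.ins : Kind → ℕ
  | .crossing => 2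
  | .leftCusp => 0
  | .rightCusp => 2

/-- Number of strands leaving a singularity to the right. -/
def Kind.outs : Kind → ℕ
  | .crossing => 2
  | .leftCusp => 2
  | .rightCusp => 0

/-- A singularity of a front together with the number `pos` of strands above it.  Its strands are
those numbered `pos` and `pos + 1`. -/
structure Event where
  kind : Kind
  pos : ℕ

/-- A front, as the list of its singularities from left to right. -/
abbrev Front := List Event

/-- Crossing of the strands numbered `p` and `p + 1`. -/
abbrev cr (p : ℕ) : Event := ⟨.crossing, p⟩

/-- Left cusp creating strands numbered `p` and `p + 1`. -/
abbrev lc (p : ℕ) : Event := ⟨.leftCusp, p⟩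

/-- Right cusp joining the strands numbered `p` and `p + 1`. -/
abbrev rc (p : ℕ) : Event := ⟨.rightCusp, p⟩

/-- `Runs w a b`: the list `w` is a front with `a` strands at its left end and `b` strands at its
right end. -/
def Runs : Front → ℕ → ℕ → Prop
  | [], a, b => a = b
  | e :: w, a, b => e.pos + e.kind.ins ≤ a ∧ Runs w (a - e.kind.ins + e.kind.outs) b

/-- Number of strands at the right end of a front that has `a` strands at its left end. -/
def widthAfter : Front → ℕ → ℕ
  | [], a => a
  | e :: w, a => widthAfter w (a - e.kind.ins + e.kind.outs)

/-- The injection `ℕ → ℕ` that omits `p` and `p + 1`: it renumbers the other strands when two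
strands numbered `p` and `p + 1` are inserted. -/
def skip (p q : ℕ) : ℕ := if q < p then q else q + 2

/-! ### Normal rulings

At a generic `x` with `m` strands, a pairing of the strands is encoded as the involution of `ℕ`
that exchanges paired strands and fixes every number `≥ m`. -/

/-- `ρ'` arises from the pairing `ρ` by inserting two new strands numbered `p` and `p + 1` that are
paired with each other. -/
def InsertPair (p : ℕ) (ρ ρ' : Equiv.Perm ℕ) : Prop :=
  ρ' p = p + 1 ∧ ∀ q, ρ' (skip p q) = skip p (ρ q)

/-- Normality at a switch between the strands `p` and `p + 1`: the vertical segments that join the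
two strands to their companions `ρ p` and `ρ (p + 1)` are disjoint or nested. -/
def NormalAt (p : ℕ) (ρ : Equiv.Perm ℕ) : Prop :=
  (ρ p < p ∧ p + 1 < ρ (p + 1)) ∨ (ρ (p + 1) < ρ p ∧ ρ p < p) ∨
    (p + 1 < ρ (p + 1) ∧ ρ (p + 1) < ρ p)

/-- The way in which the pairing of a normal ruling may change from `ρ` to `ρ'` at a singularity.
Strands that meet at a crossing are not paired; at a crossing that is not a switch the paths of the
ruling cross, and at a switch both turn a corner.  At a cusp the two strands of the cusp are
paired. -/
def Step (e : Event) (ρ ρ' : Equiv.Perm ℕ) : Prop :=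
  match e.kind with
  | .crossing => ρ e.pos ≠ e.pos + 1 ∧
      (ρ' = Equiv.swap e.pos (e.pos + 1) * ρ * Equiv.swap e.pos (e.pos + 1) ∨
        (ρ' = ρ ∧ NormalAt e.pos ρ))
  | .leftCusp => InsertPair e.pos ρ ρ'
  | .rightCusp => InsertPair e.pos ρ' ρ

/-- The list `l` consists of one pairing before, between and after the singularities of the front,
and consecutive pairings are related as in a normal ruling. -/
def IsRulingPath : Front → List (Equiv.Perm ℕ) → Prop
  | [], [_] => True
  | e :: w, ρ :: ρ' :: l => Step e ρ ρ' ∧ IsRulingPath w (ρ' :: l)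
  | _, _ => False

/-- Normal rulings of the front of a Legendrian link, as sequences of pairings.  To the left and to
the right of the front there are no strands, and the pairing is the empty one. -/
def IsNormalRuling (w : Front) (l : List (Equiv.Perm ℕ)) : Prop :=
  IsRulingPath w l ∧ l.head? = some 1 ∧ l.getLast? = some 1

open Classical in
/-- Number of switches of a ruling.  A crossing is a switch if and only if the pairing, as a pairing
of numbered strands, is the same on both sides of the crossing. -/
noncomputable def switches : Front → List (Equiv.Perm ℕ) → ℕ
  | e :: w, ρ :: ρ' :: l =>
      (if e.kind = .crossing ∧ ρ' = ρ then 1 else 0) + switches w (ρ' :: l)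
  | _, _ => 0

/-- Number of right cusps of a front. -/
def rightCusps : Front → ℕ
  | [] => 0
  | ⟨.rightCusp, _⟩ :: w => rightCusps w + 1
  | _ :: w => rightCusps w

/-- `j(ρ) = # switches - # right cusps`. -/
noncomputable def jIndex (w : Front) (l : List (Equiv.Perm ℕ)) : ℤ :=
  (switches w l : ℤ) - rightCusps w

theorem insertPair_right_unique {p : ℕ} {ρ a b : Equiv.Perm ℕ} (ha : InsertPair p ρ a)
    (hb : InsertPair p ρ b) : a = b := by
  have key : ∀ q, q ≠ p + 1 → a q = b q := by
    intro q hq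
    by_cases h1 : q = p
    · subst h1; rw [ha.1, hb.1]
    · obtain ⟨r, hr⟩ : ∃ r, skip p r = q := by
        by_cases h2 : q < p
        · exact ⟨q, by simp [skip, h2]⟩
        · refine ⟨q - 2, ?_⟩
          have : ¬ (q - 2 < p) := by omega
          simp only [skip, this, if_false]; omega
      rw [← hr, ha.2, hb.2]
  ext q
  by_cases hq : q = p + 1
  · subst hq
    by_contra hne
    have h1 : a.symm (b (p + 1)) ≠ p + 1 := by
      intro h
      apply hne
      rw [Equiv.symm_apply_eq] at h
      exact h.symm
    have h2 := key _ h1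
    rw [Equiv.apply_symm_apply] at h2
    exact h1 (b.injective h2).symm
  · exact key q hq

theorem insertPair_left_unique {p : ℕ} {ρ a b : Equiv.Perm ℕ} (ha : InsertPair p a ρ)
    (hb : InsertPair p b ρ) : a = b := by
  have inj : Function.Injective (skip p) := by
    intro x y h
    simp only [skip] at h
    split_ifs at h <;> omega
  ext q
  exact inj (by rw [← ha.2, ← hb.2])

theorem step_finite (e : Event) (ρ : Equiv.Perm ℕ) : {ρ' | Step e ρ ρ'}.Finite := by
  obtain ⟨k, p⟩ := e
  cases k with
  | crossing =>
    refine Set.Finite.subset (Set.toFinite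
      {Equiv.swap p (p + 1) * ρ * Equiv.swap p (p + 1), ρ}) ?_
    rintro ρ' ⟨-, h | ⟨h, -⟩⟩
    · exact Or.inl h
    · exact Or.inr h
  | leftCusp => exact Set.Subsingleton.finite fun _ ha _ hb => insertPair_right_unique ha hb
  | rightCusp => exact Set.Subsingleton.finite fun _ ha _ hb => insertPair_left_unique ha hb

theorem rulingPath_finite (w : Front) (ρ : Equiv.Perm ℕ) :
    {l | IsRulingPath w (ρ :: l)}.Finite := by
  induction w generalizing ρ with
  | nil =>
    refine Set.Finite.subset (Set.finite_singleton []) ?_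
    intro l hl
    cases l with
    | nil => rfl
    | cons a l => exact hl.elim
  | cons e w ih =>
    refine Set.Finite.subset ((step_finite e ρ).biUnion fun ρ' _ => (ih ρ').image (ρ' :: ·)) ?_
    intro l hl
    cases l with
    | nil => exact hl.elim
    | cons a l => exact Set.mem_biUnion hl.1 ⟨l, hl.2, rfl⟩

theorem normalRuling_finite (w : Front) : {l | IsNormalRuling w l}.Finite := by
  refine Set.Finite.subset ((rulingPath_finite w 1).image (1 :: ·)) ?_
  rintro l ⟨h1, h2, -⟩
  cases l with
  | nil => simp at h2
  | cons a l =>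
    have : a = 1 := by simpa using h2
    subst this
    exact ⟨l, h1, rfl⟩

/-- The finite set of normal rulings. -/
noncomputable def normalRulings (w : Front) : Finset (List (Equiv.Perm ℕ)) :=
  (normalRuling_finite w).toFinset

/-- The ungraded ruling polynomial `∑_ρ z ^ j(ρ)`, at `z = s - s⁻¹`. -/
noncomputable def rulingPoly (w : Front) : CoeffRing :=
  ∑ l ∈ normalRulings w, ((z ^ jIndex w l : CoeffRingˣ) : CoeffRing)

/-! ### Legendrian knots and satellites -/

/-- `(t, q)` is the strand numbered `q` after the first `t` singularities.  `Joined` relates strands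
that continue each other through a singularity. -/
inductive Joined (w : Front) : ℕ × ℕ → ℕ × ℕ → Prop
  | crossing {t p : ℕ} (q : ℕ) (h : w[t]? = some (cr p)) :
      Joined w (t, q) (t + 1, Equiv.swap p (p + 1) q)
  | leftPass {t p : ℕ} (q : ℕ) (h : w[t]? = some (lc p)) : Joined w (t, q) (t + 1, skip p q)
  | leftTip {t p : ℕ} (h : w[t]? = some (lc p)) : Joined w (t + 1, p) (t + 1, p + 1)
  | rightPass {t p : ℕ} (q : ℕ) (h : w[t]? = some (rc p)) : Joined w (t, skip p q) (t + 1, q)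
  | rightTip {t p : ℕ} (h : w[t]? = some (rc p)) : Joined w (t, p) (t, p + 1)

/-- The link with the given front has at most one component. -/
def IsConnected (w : Front) : Prop :=
  ∀ t t' q q' : ℕ, t ≤ w.length → t' ≤ w.length → q < widthAfter (w.take t) 0 →
    q' < widthAfter (w.take t') 0 → Relation.EqvGen (Joined w) (t, q) (t', q')

/-- A front of a connected Legendrian knot in `J¹ℝ` with a chosen point on it, at which satellite
patterns get inserted: `pre` and `post` are the parts of the front to the left and to the right
of the chosen point, and the chosen point is on the strand numbered `strand` of the `width` strands
between the two parts. -/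
structure Knot where
  pre : Front
  post : Front
  width : ℕ
  strand : ℕ
  pre_runs : Runs pre 0 width
  post_runs : Runs post width 0
  strand_lt : strand < width
  connected : IsConnected (pre ++ post)

/-- Crossings of the strands numbered `b + d, b + d + 2, ...` with the strands directly below them,
`n - d` crossings in total. -/
def crossingRow (n b d : ℕ) : Front := (List.range (n - d)).map fun t => cr (b + d + 2 * t)

/-- The part of the front of the `n`-copy (`n` copies shifted in the `z`-direction) near a
singularity of the given front.  A crossing becomes `n ^ 2` crossings.  A left cusp becomes `n`
left cusps above one another, followed to the right by the `n (n - 1) / 2` crossings between the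
upper branches of lower copies and the lower branches of higher copies; right cusps are the mirror
image of this. -/
def copyEvent (n : ℕ) (e : Event) : Front :=
  match e.kind with
  | .crossing => (List.range n).flatMap fun j =>
      (List.range n).map fun t => cr (n * e.pos + (n - 1 - t) + j)
  | .leftCusp => ((List.range n).map fun j => lc (n * e.pos + 2 * j)) ++
      (List.range (n - 1)).flatMap fun d => crossingRow n (n * e.pos) (d + 1)
  | .rightCusp => ((List.range (n - 1)).flatMap fun d => crossingRow n (n * e.pos) (n - 1 - d)) ++
      List.replicate n (rc (n * e.pos))

/-- The `n`-copy of a front, in which every singularity carries the index (counted from `t₀` on) of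
the singularity of the original front from which it comes. -/
def taggedCopy (n t₀ : ℕ) (w : Front) : List (Event × ℕ) :=
  (w.zipIdx t₀).flatMap fun x => (copyEvent n x.1).map fun e => (e, x.2)

/-- The `n`-copy of a front. -/
def nCopy (n : ℕ) (w : Front) : Front := w.flatMap (copyEvent n)

/-- A front moved down past `b` further strands. -/
def shift (b : ℕ) (w : Front) : Front := w.map fun e => ⟨e.kind, b + e.pos⟩

/-- A Legendrian `n`-tangle in `J¹[0,1]`, given by a front. -/
@[ext]
structure Tangle (n : ℕ) where
  front : Front
  runs : Runs front n n

/-- The front of the Legendrian satellite `S(K, α)`: the `n`-copy of `K` with `α` inserted into the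
`n` parallel strands at the chosen point of `K`. -/
def satellite {n : ℕ} (K : Knot) (α : Tangle n) : Front :=
  nCopy n K.pre ++ (shift (n * K.strand) α.front ++ nCopy n K.post)

/-! Each strand of the `n`-copy outside of the `J¹[0,1]`-part is labelled by the arc of `K`, between
a left cusp and a right cusp of `K`, of which it is a copy.  At the left cusp of `K` with index `t`
the upper arc gets the label `2 t` and the lower arc gets the label `2 t + 1`.  Since arcs are
graphs over the `x`-axis, two strands above the same `x` have equal labels if and only if they are
parallel strands that correspond to a single strand of `K`. -/

/-- Change of the labels at a singularity coming from the singularity with index `x.2` of `K`. -/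
def relabel (lab : ℕ → ℕ) (x : Event × ℕ) : ℕ → ℕ :=
  match x.1.kind with
  | .crossing => fun q => lab (Equiv.swap x.1.pos (x.1.pos + 1) q)
  | .leftCusp => fun q =>
      if q < x.1.pos then lab q
      else if q = x.1.pos then 2 * x.2
      else if q = x.1.pos + 1 then 2 * x.2 + 1
      else lab (q - 2)
  | .rightCusp => fun q => lab (skip x.1.pos q)

/-- Labels of the strands left of the `J¹[0,1]`-part, before, between and after singularities. -/
def preLabels (n : ℕ) (K : Knot) : List (ℕ → ℕ) :=
  (taggedCopy n 0 K.pre).scanl relabel (fun _ => 0)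

/-- Labels of the strands right of the `J¹[0,1]`-part, before, between and after singularities. -/
def postLabels (n : ℕ) (K : Knot) : List (ℕ → ℕ) :=
  (taggedCopy n K.pre.length K.post).scanl relabel
    ((taggedCopy n 0 K.pre).foldl relabel (fun _ => 0))

/-- No two strands with the same label are paired by `ρ`. -/
def NoParallelPair (lab : ℕ → ℕ) (ρ : Equiv.Perm ℕ) : Prop :=
  ∀ q, ρ q ≠ q → lab (ρ q) ≠ lab q

/-- A sequence of pairings for `S(K, α)` is reduced if, outside of the `J¹[0,1]`-part, parallel
strands corresponding to a single strand of `K` are not paired. -/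
def IsReduced {n : ℕ} (K : Knot) (α : Tangle n) (l : List (Equiv.Perm ℕ)) : Prop :=
  List.Forall₂ NoParallelPair (preLabels n K) (l.take ((nCopy n K.pre).length + 1)) ∧
  List.Forall₂ NoParallelPair (postLabels n K)
    (l.drop ((nCopy n K.pre).length + α.front.length))

open Classical in
/-- The reduced ruling polynomial of `S(K, α)`, at `z = s - s⁻¹`. -/
noncomputable def reducedRulingPoly {n : ℕ} (K : Knot) (α : Tangle n) : CoeffRing :=
  ∑ l ∈ (normalRulings (satellite K α)).filter (IsReduced K α),
    ((z ^ jIndex (satellite K α) l : CoeffRingˣ) : CoeffRing)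

/-! ### Positive permutation braids and the colored ruling polynomial -/

/-- Right endpoint of the strand with left endpoint `q` in a front without cusps. -/
def follow : Front → ℕ → ℕ
  | [], q => q
  | e :: w, q => follow w (Equiv.swap e.pos (e.pos + 1) q)

/-- Number of crossings between the strands with left endpoints `i` and `j` in a front without
cusps. -/
def crossingsBetween : Front → ℕ → ℕ → ℕ
  | [], _, _ => 0
  | e :: w, i, j =>
      (if (i = e.pos ∧ j = e.pos + 1) ∨ (j = e.pos ∧ i = e.pos + 1) then 1 else 0) +
        crossingsBetween w (Equiv.swap e.pos (e.pos + 1) i) (Equiv.swap e.pos (e.pos + 1) j)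

/-- `b` is a front of the positive permutation braid of `β`. -/
structure IsPermutationBraid {n : ℕ} (β : Equiv.Perm (Fin n)) (b : Tangle n) : Prop where
  no_cusps : ∀ e ∈ b.front, e.kind = .crossing
  endpoints : ∀ i : Fin n, follow b.front i = β i
  no_crossing : ∀ i j : Fin n, i < j → β i < β j → crossingsBetween b.front i j = 0
  one_crossing : ∀ i j : Fin n, i < j → β j < β i → crossingsBetween b.front i j = 1

/-- The ungraded `n`-colored ruling polynomial
`(1 / c_n) ∑_β s ^ λ(β) R̃_{S(K, β)}`, where `braid β` is the chosen front for the positive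
permutation braid of `β`; its number of crossings is `λ(β)`. -/
noncomputable def coloredRulingPoly {n : ℕ} (K : Knot) (braid : Equiv.Perm (Fin n) → Tangle n) :
    CoeffRing :=
  ((c n)⁻¹ : CoeffRingˣ) *
    ∑ β : Equiv.Perm (Fin n), (s : CoeffRing) ^ (braid β).front.length * reducedRulingPoly K (braid β)

/-! ### The Legendrian BMW algebra -/

theorem runs_append {u v : Front} {a b d : ℕ} (hu : Runs u a b) (hv : Runs v b d) :
    Runs (u ++ v) a d := by
  induction u generalizing a with
  | nil => simp only [Runs] at hu; subst hu; simpa using hv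
  | cons e u ih => exact ⟨hu.1, ih hu.2⟩

theorem runs_succ {w : Front} {a b : ℕ} (h : Runs w a b) : Runs w (a + 1) (b + 1) := by
  induction w generalizing a with
  | nil => simp only [Runs] at h ⊢; omega
  | cons e w ih =>
    refine ⟨by have := h.1; omega, ?_⟩
    have h1 := h.1
    have h2 := ih h.2
    have : a + 1 - e.kind.ins + e.kind.outs = a - e.kind.ins + e.kind.outs + 1 := by omega
    rw [this]
    exact h2

/-- Multiplication of `n`-tangles: `α * β` is `β` stacked to the left of `α`. -/
instance (n : ℕ) : Monoid (Tangle n) where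
  mul α β := ⟨β.front ++ α.front, runs_append β.runs α.runs⟩
  one := ⟨[], rfl⟩
  mul_assoc _ _ _ := Tangle.ext (List.append_assoc _ _ _).symm
  one_mul α := Tangle.ext (List.append_nil α.front)
  mul_one α := Tangle.ext (List.nil_append α.front)

/-- Local moves generating Legendrian isotopy of fronts: exchange of the `x`-coordinates of two
neighboring singularities without common strands, and the Legendrian Reidemeister moves I, II
(a strand passes a cusp) and III. -/
inductive LegMove : Front → Front → Prop
  | exchange (k k' : Kind) (p r : ℕ) :
      LegMove [⟨k, p⟩, ⟨k', p + k.outs + r⟩] [⟨k', p + k.ins + r⟩, ⟨k, p⟩]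
  | one_down (p : ℕ) : LegMove [lc (p + 1), cr p, rc (p + 1)] []
  | one_up (p : ℕ) : LegMove [lc p, cr (p + 1), rc p] []
  | two_left_down (p : ℕ) : LegMove [lc (p + 1), cr p, cr (p + 1)] [lc p]
  | two_left_up (p : ℕ) : LegMove [lc p, cr (p + 1), cr p] [lc (p + 1)]
  | two_right_down (p : ℕ) : LegMove [cr p, cr (p + 1), rc p] [rc (p + 1)]
  | two_right_up (p : ℕ) : LegMove [cr (p + 1), cr p, rc (p + 1)] [rc p]
  | three (p : ℕ) : LegMove [cr p, cr (p + 1), cr p] [cr (p + 1), cr p, cr (p + 1)]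

/-- Formal linear combinations of fronts of Legendrian `n`-tangles. -/
abbrev TangleSum (n : ℕ) : Type := MonoidAlgebra CoeffRing (Tangle n)

/-- The front `w` as a linear combination with one term. -/
noncomputable def single {n : ℕ} (w : Front) (h : Runs w n n) : TangleSum n :=
  MonoidAlgebra.of CoeffRing (Tangle n) ⟨w, h⟩

/-- The relations of the Legendrian BMW algebra: Legendrian isotopy, and the three ruling polynomial
skein relations, each applied to a part of a front with the rest of the front (to the left, `u`,
and to the right, `v`) unchanged. -/
inductive BMWRel (n : ℕ) : TangleSum n → TangleSum n → Prop
  | isotopy {u v x y : Front} (hxy : LegMove x y) (hx : Runs (u ++ x ++ v) n n)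
      (hy : Runs (u ++ y ++ v) n n) : BMWRel n (single _ hx) (single _ hy)
  | skein {u v : Front} {p : ℕ} (h₁ : Runs (u ++ [lc (p + 1), cr p] ++ v) n n)
      (h₂ : Runs (u ++ [lc p, cr (p + 1)] ++ v) n n) (h₃ : Runs (u ++ [lc (p + 1)] ++ v) n n)
      (h₄ : Runs (u ++ [lc p] ++ v) n n) :
      BMWRel n (single _ h₁ - single _ h₂) ((z : CoeffRing) • (single _ h₃ - single _ h₄))
  | zigzag_down {u v : Front} {p : ℕ} (h : Runs (u ++ [lc p, rc (p + 1)] ++ v) n n) :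
      BMWRel n (single _ h) 0
  | zigzag_up {u v : Front} {p : ℕ} (h : Runs (u ++ [lc (p + 1), rc p] ++ v) n n) :
      BMWRel n (single _ h) 0
  | unknot {u v : Front} {p : ℕ} (h : Runs (u ++ [lc p, rc p] ++ v) n n)
      (h' : Runs (u ++ v) n n) :
      BMWRel n (single _ h) (((z⁻¹ : CoeffRingˣ) : CoeffRing) • single _ h')

/-- The Legendrian BMW algebra. -/
abbrev BMW (n : ℕ) : Type := RingQuot (BMWRel n)

/-- The class in the Legendrian BMW algebra of a linear combination of tangles. -/
noncomputable def BMW.mk (n : ℕ) : TangleSum n →ₐ[CoeffRing] BMW n :=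
  RingQuot.mkAlgHom CoeffRing (BMWRel n)

/-- Placing a horizontal strand below an `n`-tangle. -/
def Tangle.extend (n : ℕ) : Tangle n →* Tangle (n + 1) where
  toFun α := ⟨α.front, runs_succ α.runs⟩
  map_one' := rfl
  map_mul' _ _ := rfl

/-- Placing a horizontal strand below linear combinations of `n`-tangles. -/
noncomputable def TangleSum.extend (n : ℕ) : TangleSum n →ₐ[CoeffRing] TangleSum (n + 1) :=
  MonoidAlgebra.lift CoeffRing (TangleSum (n + 1)) (Tangle n)
    ((MonoidAlgebra.of CoeffRing (Tangle (n + 1))).comp (Tangle.extend n))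

theorem TangleSum.extend_single {n : ℕ} (w : Front) (h : Runs w n n) :
    TangleSum.extend n (single w h) = single w (runs_succ h) := by
  exact MonoidAlgebra.lift_of _ _

theorem bmwRel_extend {n : ℕ} {a b : TangleSum n} (h : BMWRel n a b) :
    BMWRel (n + 1) (TangleSum.extend n a) (TangleSum.extend n b) := by
  cases h with
  | isotopy hxy hx hy =>
    rw [TangleSum.extend_single, TangleSum.extend_single]
    exact .isotopy hxy _ _
  | skein h₁ h₂ h₃ h₄ =>
    rw [map_sub, map_smul, map_sub]
    simp only [TangleSum.extend_single]
    exact .skein _ _ _ _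
  | zigzag_down h =>
    rw [TangleSum.extend_single, map_zero]
    exact .zigzag_down _
  | zigzag_up h =>
    rw [TangleSum.extend_single, map_zero]
    exact .zigzag_up _
  | unknot h h' =>
    rw [map_smul, TangleSum.extend_single, TangleSum.extend_single]
    exact .unknot _ _

/-- The map from the `n`-stranded to the `(n + 1)`-stranded Legendrian BMW algebra that places a
horizontal strand below tangles. -/
noncomputable def BMW.extend (n : ℕ) : BMW n →ₐ[CoeffRing] BMW (n + 1) :=
  RingQuot.liftAlgHom CoeffRing ⟨(BMW.mk (n + 1)).comp (TangleSum.extend n), fun _ _ h =>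
    RingQuot.mkAlgHom_rel CoeffRing (bmwRel_extend h)⟩

open Classical in
/-- The class of a front; used only for lists that are fronts of `n`-tangles. -/
noncomputable def BMW.ofFront (n : ℕ) (w : Front) : BMW n :=
  if h : Runs w n n then BMW.mk n (single w h) else 0

/-- The crossing `σ_i` of the `i`-th and `(i + 1)`-st strand from the top, `1 ≤ i < n`. -/
noncomputable def sigma (n i : ℕ) : BMW n := BMW.ofFront n [cr (i - 1)]

/-- The hook `e_i` on the `i`-th and `(i + 1)`-st strand from the top, `1 ≤ i < n`. -/
noncomputable def hook (n i : ℕ) : BMW n := BMW.ofFront n [rc (i - 1), lc (i - 1)]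

/-- `γ_n = 1 + ∑_{j = 1}^{n - 1} s ^ j σ_{n - 1} σ_{n - 2} ⋯ σ_{n - j}`. -/
noncomputable def gamma (n : ℕ) : BMW n :=
  1 + ∑ j ∈ Finset.Icc 1 (n - 1),
    (s : CoeffRing) ^ j • ((List.range j).map fun i => sigma n (n - 1 - i)).prod

/-- `α_{k,n}` for `2 ≤ k ≤ n`: `α_{2,n} = e_{n - 1}`, and, with `σ = σ_{n - k}`,
`α_{k + 1,n} = σ α_{k,n} σ - z σ α_{k,n} - z α_{k,n} σ + z² α_{k,n}`. -/
noncomputable def alpha (n : ℕ) : ℕ → BMW n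
  | 0 => 0
  | 1 => 0
  | 2 => hook n (n - 1)
  | k + 3 =>
      sigma n (n - (k + 2)) * alpha n (k + 2) * sigma n (n - (k + 2))
        - (z : CoeffRing) • (sigma n (n - (k + 2)) * alpha n (k + 2))
        - (z : CoeffRing) • (alpha n (k + 2) * sigma n (n - (k + 2)))
        + (z : CoeffRing) ^ 2 • alpha n (k + 2)

/-- `β_n = (1 - z ∑_{k = 2}^n α_{k,n}) γ_n`. -/
noncomputable def betaFactor (n : ℕ) : BMW n :=
  (1 - (z : CoeffRing) • ∑ k ∈ Finset.Icc 2 n, alpha n k) * gamma n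

/-- `L_1 = 1` and `L_n = L_{n - 1} β_n` for `n ≥ 2`, where `L_{n - 1}` is extended by a horizontal
strand at the bottom. -/
noncomputable def L : (n : ℕ) → BMW n
  | 0 => 1
  | 1 => 1
  | n + 2 => BMW.extend (n + 1) (L (n + 1)) * betaFactor (n + 2)

/-- `∑ r_i R_{S(K, α_i)}` for a linear combination `ξ = ∑ r_i α_i` of tangles.  This is the
satellite ruling polynomial `R_{S(K, η)}` of every element `η` of the Legendrian BMW algebra that is
represented by `ξ`. -/
noncomputable def satelliteRulingPoly {n : ℕ} (K : Knot) (ξ : TangleSum n) : CoeffRing :=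
  ξ.coeff.sum fun α r => r * rulingPoly (satellite K α)

end LegRuling

/-!
Over a generic `x` a normal ruling is a pairing of the strands, and `R(z)` counts sequences of
pairings with weight `z` for each switch and `z⁻¹` for each right cusp.  So ruling polynomials are
matrix entries of transfer operators (`rulingPoly_eq`): every singularity acts on the free module on
all pairings, and a front acts by composition.  These operators are invariant under Legendrian
isotopy and satisfy the skein relations (`transferFront_legMove`, `transferFront_skein`), hence the
Legendrian BMW algebra acts on the pairings of `N` strands, with the tangle placed on `n` consecutive
strands (`bmwAction`), and `satelliteRulingPoly K ξ` is a matrix entry of the action of the class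
of `ξ` (`satelliteRulingPoly_eq`).

Call a pairing *pure* if no two of these `n` strands are paired.  The proof compares three facts.

* `L n` kills the pairings that are not pure and acts on the pure ones as the symmetrizer
  `Γ_n = γ_2 γ_3 ⋯ γ_n` (`bmwAction_L`).  By induction it is enough to know `1 - z ∑ α_k` modulo
  pairings that are impure already on the upper `n - 1` strands, and there `z α_k` is the projection
  to the pairings in which the bottom strand is paired with the `(k - 1)`-st strand above it
  (`alphaOp_vec`): for `k = 2` this is the hook, and `α_{k + 1} = (σ - z) α_k (σ - z)`, where
  `σ - z` is inverse to `σ` on pairings in which the two strands are not paired.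
* `Γ_n` is the sum of the positive permutation braids weighted by `s ^ λ(β)`
  (`sum_permutationBraid`): pulling the strand that ends at the bottom to the bottom first writes a
  positive permutation braid on `n` strands as one on `n - 1` strands times a summand of `γ_n`.
* A normal ruling of `S(K, β)` is reduced if and only if its pairing to the left of the inserted
  tangle is pure (`isReduced_iff`).  This uses that `K` is connected: purity of the `n` parallel
  copies of a strand of `K` is carried along `K`.  At a crossing of `K`, where `n` strands of one
  family cross `n` strands of another, the normality condition prevents a switch from creating a
  pair within one family (`pureLabel_step`); at a cusp the `2 n` strands are paired among themselves,
  so that one of the two families contains a pair if and only if the other one does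
  (`pureLabel_iff_of_closed`).

Hence both sides of the theorem are the same matrix entry of `Γ_n` applied to the pure part of the
vector contributed by the front to the left of the chosen point.
-/

namespace LegRuling

/-! ### Pairings of finitely many strands -/

/-- The renumbering inverse to `skip p`. -/
def unskip (p q : ℕ) : ℕ := if q < p then q else q - 2

theorem unskip_skip (p q : ℕ) : unskip p (skip p q) = q := by
  unfold unskip skip; split_ifs <;> omega

theorem skip_unskip {p q : ℕ} (h : q ≠ p) (h' : q ≠ p + 1) : skip p (unskip p q) = q := by
  unfold unskip skip; split_ifs <;> omega

theorem skip_ne_left (p q : ℕ) : skip p q ≠ p := by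
  unfold skip; split_ifs <;> omega

theorem skip_ne_right (p q : ℕ) : skip p q ≠ p + 1 := by
  unfold skip; split_ifs <;> omega

theorem skip_lt_skip {p q r : ℕ} : skip p q < skip p r ↔ q < r := by
  unfold skip; split_ifs <;> omega

theorem skip_inj {p q r : ℕ} : skip p q = skip p r ↔ q = r := by
  unfold skip; split_ifs <;> omega

/-- Every strand after the insertion of `p` and `p + 1` is new or old. -/
theorem eq_or_exists_skip (p q : ℕ) : q = p ∨ q = p + 1 ∨ ∃ r, q = skip p r := by
  by_cases h : q = p
  · exact Or.inl h
  by_cases h' : q = p + 1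
  · exact Or.inr (Or.inl h')
  exact Or.inr (Or.inr ⟨unskip p q, (skip_unskip h h').symm⟩)

/-- The pairing that arises from `ρ` by inserting two new strands numbered `p` and `p + 1` that are
paired with each other. -/
def ins (p : ℕ) (ρ : Equiv.Perm ℕ) : Equiv.Perm ℕ where
  toFun q := if q = p then p + 1 else if q = p + 1 then p else skip p (ρ (unskip p q))
  invFun q := if q = p then p + 1 else if q = p + 1 then p else skip p (ρ.symm (unskip p q))
  left_inv q := by
    rcases eq_or_exists_skip p q with rfl | rfl | ⟨r, rfl⟩
    · simp
    · simp
    · simp [skip_ne_left, skip_ne_right, unskip_skip]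
  right_inv q := by
    rcases eq_or_exists_skip p q with rfl | rfl | ⟨r, rfl⟩
    · simp
    · simp
    · simp [skip_ne_left, skip_ne_right, unskip_skip]

@[simp] theorem ins_left (p : ℕ) (ρ : Equiv.Perm ℕ) : ins p ρ p = p + 1 := by simp [ins]

@[simp] theorem ins_right (p : ℕ) (ρ : Equiv.Perm ℕ) : ins p ρ (p + 1) = p := by simp [ins]

@[simp] theorem ins_skip (p : ℕ) (ρ : Equiv.Perm ℕ) (q : ℕ) :
    ins p ρ (skip p q) = skip p (ρ q) := by
  simp [ins, skip_ne_left, skip_ne_right, unskip_skip]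

theorem insertPair_ins (p : ℕ) (ρ : Equiv.Perm ℕ) : InsertPair p ρ (ins p ρ) :=
  ⟨ins_left p ρ, ins_skip p ρ⟩

theorem insertPair_iff {p : ℕ} {ρ ρ' : Equiv.Perm ℕ} : InsertPair p ρ ρ' ↔ ρ' = ins p ρ :=
  ⟨fun h => insertPair_right_unique h (insertPair_ins p ρ), fun h => h ▸ insertPair_ins p ρ⟩

theorem ins_injective (p : ℕ) : Function.Injective (ins p) := fun _ _ h =>
  insertPair_left_unique (insertPair_ins p _) (h ▸ insertPair_ins p _)

/-- The pairing after a crossing of the strands `p` and `p + 1` at which the paths of the ruling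
cross. -/
def conj (p : ℕ) (ρ : Equiv.Perm ℕ) : Equiv.Perm ℕ :=
  Equiv.swap p (p + 1) * ρ * Equiv.swap p (p + 1)

theorem conj_apply (p : ℕ) (ρ : Equiv.Perm ℕ) (q : ℕ) :
    conj p ρ q = Equiv.swap p (p + 1) (ρ (Equiv.swap p (p + 1) q)) := rfl

theorem conj_apply_left (p : ℕ) (ρ : Equiv.Perm ℕ) :
    conj p ρ p = Equiv.swap p (p + 1) (ρ (p + 1)) := by
  rw [conj_apply, Equiv.swap_apply_left]

theorem conj_apply_right (p : ℕ) (ρ : Equiv.Perm ℕ) :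
    conj p ρ (p + 1) = Equiv.swap p (p + 1) (ρ p) := by
  rw [conj_apply, Equiv.swap_apply_right]

theorem conj_apply_of_ne {p q : ℕ} (h : q ≠ p) (h' : q ≠ p + 1) (ρ : Equiv.Perm ℕ) :
    conj p ρ q = Equiv.swap p (p + 1) (ρ q) := by
  rw [conj_apply, Equiv.swap_apply_of_ne_of_ne h h']

@[simp] theorem conj_conj (p : ℕ) (ρ : Equiv.Perm ℕ) : conj p (conj p ρ) = ρ := by
  ext q; simp [conj_apply]

theorem swap_val (p q : ℕ) :
    Equiv.swap p (p + 1) q = if q = p then p + 1 else if q = p + 1 then p else q :=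
  Equiv.swap_apply_def _ _ _

/-- A pairing of `N` strands: a fixed-point free involution of the numbers `< N`, extended by the
identity to the numbers `≥ N`. -/
structure IsMatching (N : ℕ) (ρ : Equiv.Perm ℕ) : Prop where
  invol : ∀ q, ρ (ρ q) = q
  fixed : ∀ q, ρ q = q ↔ N ≤ q

namespace IsMatching

variable {N : ℕ} {ρ : Equiv.Perm ℕ}

theorem ne (h : IsMatching N ρ) {q : ℕ} (hq : q < N) : ρ q ≠ q := by
  rw [Ne, h.fixed]; omega

theorem lt (h : IsMatching N ρ) {q : ℕ} (hq : q < N) : ρ q < N := by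
  by_contra hc
  have := (h.fixed (ρ q)).2 (by omega)
  rw [h.invol] at this
  exact h.ne hq this.symm

theorem eq_iff (h : IsMatching N ρ) {q r : ℕ} : ρ q = r ↔ ρ r = q :=
  ⟨fun e => by rw [← e, h.invol], fun e => by rw [← e, h.invol]⟩

theorem of_eq {M : ℕ} (h : IsMatching N ρ) (e : N = M) : IsMatching M ρ := e ▸ h

theorem one : IsMatching 0 1 := ⟨fun _ => rfl, fun q => by simp⟩

theorem ins (h : IsMatching N ρ) {p : ℕ} (hp : p ≤ N) : IsMatching (N + 2) (ins p ρ) := by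
  constructor
  · intro q
    rcases eq_or_exists_skip p q with rfl | rfl | ⟨r, rfl⟩
    · simp
    · simp
    · simp [h.invol]
  · intro q
    rcases eq_or_exists_skip p q with rfl | rfl | ⟨r, rfl⟩
    · simp; omega
    · simp; omega
    · rw [ins_skip, skip_inj, h.fixed]
      unfold skip; split_ifs <;> omega

theorem conj (h : IsMatching N ρ) {p : ℕ} (hp : p + 2 ≤ N) : IsMatching N (conj p ρ) := by
  constructor
  · intro q; simp [conj_apply, h.invol]
  · intro q
    rw [conj_apply, ← Equiv.eq_symm_apply, Equiv.symm_swap, h.fixed, swap_val]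
    split_ifs <;> omega

/-- A pairing in which `p` and `p + 1` are paired arises by inserting them. -/
theorem exists_eq_ins (h : IsMatching N ρ) {p : ℕ} (hp : ρ p = p + 1) :
    ∃ ρ', IsMatching (N - 2) ρ' ∧ ρ = LegRuling.ins p ρ' := by
  have hp' : ρ (p + 1) = p := h.eq_iff.1 hp
  have key : ∀ q, skip p (unskip p (ρ (skip p q))) = ρ (skip p q) := fun q =>
    skip_unskip (fun e => skip_ne_right p q ((h.eq_iff.1 e).symm.trans hp))
      (fun e => skip_ne_left p q ((h.eq_iff.1 e).symm.trans hp'))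
  have inv : ∀ q, unskip p (ρ (skip p (unskip p (ρ (skip p q))))) = q := fun q => by
    rw [key, h.invol, unskip_skip]
  let ρ' : Equiv.Perm ℕ := ⟨fun q => unskip p (ρ (skip p q)), fun q => unskip p (ρ (skip p q)),
    inv, inv⟩
  have hpN : p < N := by
    by_contra hc
    have := (h.fixed p).2 (by omega)
    omega
  have hpN' : p + 1 < N := by rw [← hp]; exact h.lt hpN
  refine ⟨ρ', ⟨inv, fun q => ?_⟩, ?_⟩
  · change unskip p (ρ (skip p q)) = q ↔ _
    rw [← skip_inj (p := p), key, h.fixed]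
    unfold skip; split_ifs <;> omega
  · exact insertPair_iff.1 ⟨hp, fun q => (key q).symm⟩

end IsMatching

theorem normalAt_ne_conj {p : ℕ} {ρ : Equiv.Perm ℕ} (h : NormalAt p ρ) : conj p ρ ≠ ρ := by
  intro e
  have h1 : conj p ρ p = ρ p := by rw [e]
  rw [conj_apply, Equiv.swap_apply_left, swap_val] at h1
  unfold NormalAt at h
  split_ifs at h1 <;> omega

/-- Two chords either cross or do not cross, and crossing the strands exchanges the two cases. -/
theorem normalAt_conj {N p : ℕ} {ρ : Equiv.Perm ℕ} (h : IsMatching N ρ) (hp : p + 2 ≤ N)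
    (hne : ρ p ≠ p + 1) : NormalAt p (conj p ρ) ↔ ¬ NormalAt p ρ := by
  have h1 := h.ne (q := p) (by omega)
  have h2 := h.ne (q := p + 1) (by omega)
  have h3 : ρ (p + 1) ≠ p := fun e => hne (h.eq_iff.1 e)
  have h4 : ρ p ≠ ρ (p + 1) := fun e => by have := ρ.injective e; omega
  unfold NormalAt
  rw [conj_apply, conj_apply, Equiv.swap_apply_left, Equiv.swap_apply_right,
    Equiv.swap_apply_of_ne_of_ne h3 h2, Equiv.swap_apply_of_ne_of_ne h1 hne]
  omega

/-! ### Transfer operators -/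

/-- The free module on all pairings. -/
abbrev PairingSpace : Type := Equiv.Perm ℕ →₀ CoeffRing

/-- The basis vector of a pairing. -/
noncomputable abbrev vec (ρ : Equiv.Perm ℕ) : PairingSpace := Finsupp.single ρ 1

open Classical in
/-- The contribution of one singularity to the weight `z ^ j(ρ)` of a ruling. -/
noncomputable def stepWeight (e : Event) (ρ ρ' : Equiv.Perm ℕ) : CoeffRing :=
  match e.kind with
  | .crossing => if ρ' = ρ then z else 1
  | .leftCusp => 1
  | .rightCusp => (z⁻¹ : CoeffRingˣ)

/-- The transfer operator of a singularity sends a pairing to the weighted sum of the pairings that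
may follow it in a normal ruling. -/
noncomputable def transfer (e : Event) : PairingSpace →ₗ[CoeffRing] PairingSpace :=
  Finsupp.linearCombination CoeffRing fun ρ =>
    ∑ ρ' ∈ (step_finite e ρ).toFinset, stepWeight e ρ ρ' • vec ρ'

/-- The transfer operator of a front; singularities further to the left act first. -/
noncomputable def transferFront : Front → PairingSpace →ₗ[CoeffRing] PairingSpace
  | [] => LinearMap.id
  | e :: w => transferFront w ∘ₗ transfer e

theorem transfer_vec (e : Event) (ρ : Equiv.Perm ℕ) :
    transfer e (vec ρ) = ∑ ρ' ∈ (step_finite e ρ).toFinset, stepWeight e ρ ρ' • vec ρ' := by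
  simp [transfer, vec, Finsupp.linearCombination_single]

theorem transferFront_append (u v : Front) :
    transferFront (u ++ v) = transferFront v ∘ₗ transferFront u := by
  induction u with
  | nil => rfl
  | cons e u ih => simp only [List.cons_append, transferFront, ih, LinearMap.comp_assoc]

theorem transfer_lc (p : ℕ) (ρ : Equiv.Perm ℕ) : transfer (lc p) (vec ρ) = vec (ins p ρ) := by
  have : (step_finite (lc p) ρ).toFinset = {ins p ρ} := by
    ext ρ'; simp [Step, insertPair_iff]
  rw [transfer_vec, this, Finset.sum_singleton]
  simp [stepWeight]

theorem transfer_rc_ins (p : ℕ) (ρ : Equiv.Perm ℕ) :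
    transfer (rc p) (vec (ins p ρ)) = ((z⁻¹ : CoeffRingˣ) : CoeffRing) • vec ρ := by
  have : (step_finite (rc p) (ins p ρ)).toFinset = {ρ} := by
    ext ρ'
    simp only [Step, insertPair_iff, Set.Finite.mem_toFinset, Set.mem_ofPred_eq,
      Finset.mem_singleton]
    exact ⟨fun h => (ins_injective p h).symm, fun h => by rw [h]⟩
  rw [transfer_vec, this, Finset.sum_singleton]
  simp [stepWeight]

theorem transfer_rc_of_ne {p : ℕ} {ρ : Equiv.Perm ℕ} (h : ρ p ≠ p + 1) :
    transfer (rc p) (vec ρ) = 0 := by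
  have : (step_finite (rc p) ρ).toFinset = ∅ := by
    ext ρ'
    simp only [Step, InsertPair, Set.Finite.mem_toFinset, Set.mem_ofPred_eq]
    simp [h]
  rw [transfer_vec, this, Finset.sum_empty]

theorem transfer_cr_paired {p : ℕ} {ρ : Equiv.Perm ℕ} (h : ρ p = p + 1) :
    transfer (cr p) (vec ρ) = 0 := by
  have : (step_finite (cr p) ρ).toFinset = ∅ := by
    ext ρ'
    simp [Step, h]
  rw [transfer_vec, this, Finset.sum_empty]

open Classical in
theorem transfer_cr_normal {p : ℕ} {ρ : Equiv.Perm ℕ} (h : ρ p ≠ p + 1) (hn : NormalAt p ρ) :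
    transfer (cr p) (vec ρ) = vec (conj p ρ) + (z : CoeffRing) • vec ρ := by
  have : (step_finite (cr p) ρ).toFinset = {conj p ρ, ρ} := by
    ext ρ'
    simp [Step, h, hn, conj]
  rw [transfer_vec, this, Finset.sum_pair (normalAt_ne_conj hn)]
  simp [stepWeight, normalAt_ne_conj hn]

theorem transfer_cr_not_normal {N p : ℕ} {ρ : Equiv.Perm ℕ} (hρ : IsMatching N ρ)
    (hp : p + 2 ≤ N) (h : ρ p ≠ p + 1) (hn : ¬ NormalAt p ρ) :
    transfer (cr p) (vec ρ) = vec (conj p ρ) := by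
  have : (step_finite (cr p) ρ).toFinset = {conj p ρ} := by
    ext ρ'
    simp [Step, h, hn, conj]
  have hc : conj p ρ ≠ ρ := by
    have := normalAt_ne_conj ((normalAt_conj hρ hp h).2 hn)
    rw [conj_conj] at this
    exact this.symm
  rw [transfer_vec, this, Finset.sum_singleton]
  simp [stepWeight, hc]

/-- The span of the pairings of `N` strands. -/
noncomputable abbrev matchingSpace (N : ℕ) : Submodule CoeffRing PairingSpace :=
  Finsupp.supported CoeffRing CoeffRing {ρ | IsMatching N ρ}

theorem vec_mem_supported {S : Set (Equiv.Perm ℕ)} {ρ : Equiv.Perm ℕ} (h : ρ ∈ S) :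
    vec ρ ∈ Finsupp.supported CoeffRing CoeffRing S :=
  Finsupp.single_mem_supported _ _ h

/-- Two linear maps agree on the span of a set of pairings if they agree on these pairings. -/
theorem eqOn_supported {M : Type*} [AddCommGroup M] [Module CoeffRing M]
    {S : Set (Equiv.Perm ℕ)} {f g : PairingSpace →ₗ[CoeffRing] M}
    (h : ∀ ρ ∈ S, f (vec ρ) = g (vec ρ)) {x : PairingSpace}
    (hx : x ∈ Finsupp.supported CoeffRing CoeffRing S) : f x = g x := by
  rw [Finsupp.supported_eq_span_single] at hx
  induction hx using Submodule.span_induction with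
  | mem y hy => obtain ⟨ρ, hρ, rfl⟩ := hy; exact h ρ hρ
  | zero => simp
  | add a b _ _ ha hb => rw [map_add, map_add, ha, hb]
  | smul r a _ ha => rw [map_smul, map_smul, ha]

/-- A linear map sends the span of a set of pairings to a submodule if it sends these pairings
there. -/
theorem map_mem_of_supported {M : Type*} [AddCommGroup M] [Module CoeffRing M]
    {S : Set (Equiv.Perm ℕ)} {f : PairingSpace →ₗ[CoeffRing] M} {U : Submodule CoeffRing M}
    (h : ∀ ρ ∈ S, f (vec ρ) ∈ U) {x : PairingSpace}
    (hx : x ∈ Finsupp.supported CoeffRing CoeffRing S) : f x ∈ U := by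
  rw [Finsupp.supported_eq_span_single] at hx
  suffices hle : Submodule.span CoeffRing ((fun ρ => Finsupp.single ρ 1) '' S) ≤ U.comap f from
    hle hx
  refine Submodule.span_le.2 ?_
  rintro _ ⟨ρ, hρ, rfl⟩
  exact h ρ hρ

/-- If a set of pairings is closed under the steps at a singularity, so is its span. -/
theorem transfer_mem_supported {S S' : Set (Equiv.Perm ℕ)} {e : Event}
    (h : ∀ ρ ∈ S, ∀ ρ', Step e ρ ρ' → ρ' ∈ S') {x : PairingSpace}
    (hx : x ∈ Finsupp.supported CoeffRing CoeffRing S) :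
    transfer e x ∈ Finsupp.supported CoeffRing CoeffRing S' := by
  refine map_mem_of_supported (fun ρ hρ => ?_) hx
  rw [transfer_vec]
  refine Submodule.sum_mem _ fun ρ' hρ' => Submodule.smul_mem _ _ (vec_mem_supported ?_)
  exact h ρ hρ ρ' (by simpa using hρ')

theorem IsMatching.step {N : ℕ} {e : Event} {ρ ρ' : Equiv.Perm ℕ} (h : IsMatching N ρ)
    (he : e.pos + e.kind.ins ≤ N) (hs : Step e ρ ρ') :
    IsMatching (N - e.kind.ins + e.kind.outs) ρ' := by
  obtain ⟨k, p⟩ := e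
  cases k with
  | crossing =>
    simp only [Kind.ins, Kind.outs] at he ⊢
    have e2 : N - 2 + 2 = N := by omega
    rw [e2]
    rcases hs with ⟨-, rfl | ⟨rfl, -⟩⟩
    · exact h.conj he
    · exact h
  | leftCusp =>
    obtain rfl := insertPair_iff.1 hs
    simpa [Kind.ins, Kind.outs] using h.ins (by simpa [Kind.ins] using he)
  | rightCusp =>
    obtain ⟨ρ₁, h1, h2⟩ := h.exists_eq_ins hs.1
    have : ρ' = ρ₁ := ins_injective p ((insertPair_iff.1 hs).symm.trans h2)
    subst this
    simpa [Kind.ins, Kind.outs] using h1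

theorem transferFront_mem {w : Front} {a b : ℕ} (h : Runs w a b) {x : PairingSpace}
    (hx : x ∈ matchingSpace a) : transferFront w x ∈ matchingSpace b := by
  induction w generalizing a x with
  | nil => simp only [Runs] at h; subst h; exact hx
  | cons e w ih =>
    exact ih h.2 (transfer_mem_supported (fun ρ hρ ρ' hs => IsMatching.step hρ h.1 hs) hx)

/-! ### Invariance of transfer operators under Legendrian isotopy and skein relations -/

theorem transfer_rc_lc (p : ℕ) (x : PairingSpace) :
    transfer (rc p) (transfer (lc p) x) = ((z⁻¹ : CoeffRingˣ) : CoeffRing) • x := by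
  have := eqOn_supported (S := Set.univ) (f := transfer (rc p) ∘ₗ transfer (lc p))
    (g := ((z⁻¹ : CoeffRingˣ) : CoeffRing) • LinearMap.id) (x := x)
    (fun ρ _ => by simp only [LinearMap.comp_apply, transfer_lc, transfer_rc_ins]; rfl)
    (by simp)
  exact this

theorem ins_ins (p r : ℕ) (ρ : Equiv.Perm ℕ) :
    ins (p + 2 + r) (ins p ρ) = ins p (ins (p + r) ρ) := by
  symm
  rw [← insertPair_iff]
  have h1 : p + 2 + r = skip p (p + r) := by unfold skip; split_ifs <;> omega
  have h2 : p + 2 + r + 1 = skip p (p + r + 1) := by unfold skip; split_ifs <;> omega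
  refine ⟨by rw [h2, h1, ins_skip, ins_left], fun q => ?_⟩
  have key : ∀ q, skip (p + 2 + r) (skip p q) = skip p (skip (p + r) q) := fun q => by
    unfold skip; split_ifs <;> omega
  rcases eq_or_exists_skip p q with rfl | rfl | ⟨t, rfl⟩
  · have e1 : skip (q + 2 + r) q = q := by unfold skip; split_ifs <;> omega
    have e2 : skip (q + 2 + r) (q + 1) = q + 1 := by unfold skip; split_ifs <;> omega
    rw [e1, ins_left, ins_left, e2]
  · have e1 : skip (p + 2 + r) p = p := by unfold skip; split_ifs <;> omega
    have e2 : skip (p + 2 + r) (p + 1) = p + 1 := by unfold skip; split_ifs <;> omega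
    rw [e2, ins_right, ins_right, e1]
  · rw [key, ins_skip, ins_skip, ins_skip, key]

theorem skip_succ {p q : ℕ} (h : q + 1 ≠ p) : skip p q + 1 = skip p (q + 1) := by
  unfold skip; split_ifs <;> omega

theorem conj_ins {p q : ℕ} (h : q + 1 ≠ p) (ρ : Equiv.Perm ℕ) :
    conj (skip p q) (ins p ρ) = ins p (conj q ρ) := by
  rw [← insertPair_iff]
  have key : ∀ t, Equiv.swap (skip p q) (skip p q + 1) (skip p t) =
      skip p (Equiv.swap q (q + 1) t) := fun t => by
    rw [swap_val, swap_val, skip_succ h]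
    simp only [skip_inj]
    split_ifs <;> rfl
  have e1 := skip_ne_left p q
  have e2 := skip_ne_right p q
  have e3 := skip_ne_left p (q + 1)
  have e4 := skip_ne_right p (q + 1)
  have e5 := skip_succ h
  refine ⟨?_, fun t => ?_⟩
  · rw [conj_apply_of_ne (by omega) (by omega), ins_left,
      Equiv.swap_apply_of_ne_of_ne (by omega) (by omega)]
  · rw [conj_apply, key, ins_skip, key, conj_apply]

theorem normalAt_ins {p q : ℕ} (h : q + 1 ≠ p) (ρ : Equiv.Perm ℕ) :
    NormalAt (skip p q) (ins p ρ) ↔ NormalAt q ρ := by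
  unfold NormalAt
  rw [skip_succ h, ins_skip, ins_skip]
  simp only [skip_lt_skip]

theorem transfer_cr_ins {N p q : ℕ} (h : q + 1 ≠ p) {ρ : Equiv.Perm ℕ} (hρ : IsMatching N ρ)
    (hp : p ≤ N) (hq : q + 2 ≤ N) :
    transfer (cr (skip p q)) (vec (ins p ρ)) = transfer (lc p) (transfer (cr q) (vec ρ)) := by
  have e := skip_succ h
  by_cases h1 : ρ q = q + 1
  · rw [transfer_cr_paired h1, transfer_cr_paired (by rw [ins_skip, h1, e]), map_zero]
  have h2 : ins p ρ (skip p q) ≠ skip p q + 1 := by rwa [ins_skip, e, Ne, skip_inj]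
  by_cases h3 : NormalAt q ρ
  · rw [transfer_cr_normal h1 h3, transfer_cr_normal h2 ((normalAt_ins h ρ).2 h3), map_add,
      map_smul, transfer_lc, transfer_lc, conj_ins h]
  · rw [transfer_cr_not_normal hρ hq h1 h3, transfer_cr_not_normal (hρ.ins hp)
      (by unfold skip; split_ifs <;> omega) h2 (fun hn => h3 ((normalAt_ins h ρ).1 hn)),
      transfer_lc, conj_ins h]

theorem transfer_rc_eq_zero {p : ℕ} {x : PairingSpace}
    (hx : x ∈ Finsupp.supported CoeffRing CoeffRing {ρ : Equiv.Perm ℕ | ρ p ≠ p + 1}) :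
    transfer (rc p) x = 0 :=
  eqOn_supported (g := 0) (fun _ hρ => transfer_rc_of_ne hρ) hx

theorem transfer_cr_mem {S : Set (Equiv.Perm ℕ)} {p : ℕ} {ρ : Equiv.Perm ℕ} (h : ρ ∈ S)
    (h' : ρ p ≠ p + 1 → conj p ρ ∈ S) :
    transfer (cr p) (vec ρ) ∈ Finsupp.supported CoeffRing CoeffRing S := by
  refine transfer_mem_supported (S := {ρ}) ?_ (vec_mem_supported rfl)
  rintro _ rfl ρ' ⟨h1, rfl | ⟨rfl, -⟩⟩
  · exact h' h1
  · exact h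

/-- Crossings far from each other commute. -/
theorem transfer_cr_comm {N p q : ℕ} {ρ : Equiv.Perm ℕ} (hρ : IsMatching N ρ) (hpq : p + 2 ≤ q)
    (hq : q + 2 ≤ N) : transfer (cr q) (transfer (cr p) (vec ρ)) =
      transfer (cr p) (transfer (cr q) (vec ρ)) := by
  have sp : ∀ {x}, x ≠ p → x ≠ p + 1 → Equiv.swap p (p + 1) x = x :=
    fun h h' => Equiv.swap_apply_of_ne_of_ne h h'
  have sq : ∀ {x}, x ≠ q → x ≠ q + 1 → Equiv.swap q (q + 1) x = x :=
    fun h h' => Equiv.swap_apply_of_ne_of_ne h h'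
  have comm : ∀ ρ, conj q (conj p ρ) = conj p (conj q ρ) := fun ρ => by
    have : Equiv.swap q (q + 1) * Equiv.swap p (p + 1) =
        Equiv.swap p (p + 1) * Equiv.swap q (q + 1) := by
      ext x; simp only [Equiv.Perm.mul_apply, swap_val]; split_ifs <;> omega
    unfold conj
    calc _ = (Equiv.swap q (q + 1) * Equiv.swap p (p + 1)) * ρ *
          (Equiv.swap p (p + 1) * Equiv.swap q (q + 1)) := by simp only [mul_assoc]
      _ = (Equiv.swap p (p + 1) * Equiv.swap q (q + 1)) * ρ *
          (Equiv.swap q (q + 1) * Equiv.swap p (p + 1)) := by rw [this]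
      _ = _ := by simp only [mul_assoc]
  have pairp : ∀ ρ : Equiv.Perm ℕ, conj q ρ p = p + 1 ↔ ρ p = p + 1 := fun ρ => by
    rw [conj_apply_of_ne (by omega) (by omega), swap_val]; split_ifs <;> omega
  have pairq : ∀ ρ : Equiv.Perm ℕ, conj p ρ q = q + 1 ↔ ρ q = q + 1 := fun ρ => by
    rw [conj_apply_of_ne (by omega) (by omega), swap_val]; split_ifs <;> omega
  by_cases hsame : (ρ p = q ∧ ρ (p + 1) = q + 1) ∨ (ρ p = q + 1 ∧ ρ (p + 1) = q)
  · -- Both crossings are between the same two pairs, and the two operators agree.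
    have agree : ∀ ρ : Equiv.Perm ℕ, IsMatching N ρ →
        ((ρ p = q ∧ ρ (p + 1) = q + 1) ∨ (ρ p = q + 1 ∧ ρ (p + 1) = q)) →
        conj p ρ = conj q ρ ∧ transfer (cr p) (vec ρ) = transfer (cr q) (vec ρ) := by
      intro ρ hρ hs
      have hs' : (ρ p = q ∧ ρ q = p ∧ ρ (p + 1) = q + 1 ∧ ρ (q + 1) = p + 1) ∨
          (ρ p = q + 1 ∧ ρ (q + 1) = p ∧ ρ (p + 1) = q ∧ ρ q = p + 1) := by
        rcases hs with ⟨a, b⟩ | ⟨a, b⟩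
        · exact Or.inl ⟨a, hρ.eq_iff.1 a, b, hρ.eq_iff.1 b⟩
        · exact Or.inr ⟨a, hρ.eq_iff.1 a, b, hρ.eq_iff.1 b⟩
      have hc : conj p ρ = conj q ρ := by
        ext x
        by_cases hx : x = p ∨ x = p + 1 ∨ x = q ∨ x = q + 1
        · rcases hx with rfl | rfl | rfl | rfl
          · rw [conj_apply_left, conj_apply_of_ne (by omega) (by omega)]
            simp only [swap_val]; split_ifs <;> omega
          · rw [conj_apply_right, conj_apply_of_ne (by omega) (by omega)]
            simp only [swap_val]; split_ifs <;> omega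
          · rw [conj_apply_left, conj_apply_of_ne (by omega) (by omega)]
            simp only [swap_val]; split_ifs <;> omega
          · rw [conj_apply_right, conj_apply_of_ne (by omega) (by omega)]
            simp only [swap_val]; split_ifs <;> omega
        · have j1 : ρ x ≠ p ∧ ρ x ≠ p + 1 ∧ ρ x ≠ q ∧ ρ x ≠ q + 1 := by
            have k1 : ρ x = p ↔ ρ p = x := hρ.eq_iff
            have k2 : ρ x = p + 1 ↔ ρ (p + 1) = x := hρ.eq_iff
            have k3 : ρ x = q ↔ ρ q = x := hρ.eq_iff
            have k4 : ρ x = q + 1 ↔ ρ (q + 1) = x := hρ.eq_iff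
            omega
          rw [conj_apply_of_ne (by omega) (by omega), conj_apply_of_ne (by omega) (by omega),
            sp (by omega) (by omega), sq (by omega) (by omega)]
      refine ⟨hc, ?_⟩
      have n1 : ρ p ≠ p + 1 := by omega
      have n2 : ρ q ≠ q + 1 := by omega
      have hn : NormalAt p ρ ↔ NormalAt q ρ := by unfold NormalAt; omega
      by_cases h : NormalAt p ρ
      · rw [transfer_cr_normal n1 h, transfer_cr_normal n2 (hn.1 h), hc]
      · rw [transfer_cr_not_normal hρ (by omega) n1 h,
          transfer_cr_not_normal hρ hq n2 (fun h' => h (hn.2 h')), hc]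
    have hσ : (conj p ρ p = q ∧ conj p ρ (p + 1) = q + 1) ∨
        (conj p ρ p = q + 1 ∧ conj p ρ (p + 1) = q) := by
      rw [conj_apply_left, conj_apply_right,
        sp (by omega) (by omega), sp (by omega) (by omega)]
      omega
    have hmem : transfer (cr p) (vec ρ) ∈
        Finsupp.supported CoeffRing CoeffRing {ρ, conj p ρ} :=
      transfer_cr_mem (by simp) (fun _ => by simp)
    rw [← (agree ρ hρ hsame).2]
    refine eqOn_supported (fun τ hτ => ?_) hmem
    rcases hτ with rfl | rfl
    · exact (agree _ hρ hsame).2.symm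
    · exact (agree _ (hρ.conj (by omega)) hσ).2.symm
  · by_cases h1 : ρ p = p + 1
    · rw [transfer_cr_paired h1, map_zero]
      symm
      refine eqOn_supported (g := 0) (S := {ρ | ρ p = p + 1})
        (fun τ hτ => transfer_cr_paired hτ) (transfer_cr_mem h1 fun _ => (pairp ρ).2 h1)
    by_cases h2 : ρ q = q + 1
    · rw [transfer_cr_paired h2, map_zero]
      exact eqOn_supported (g := 0) (S := {ρ | ρ q = q + 1})
        (fun τ hτ => transfer_cr_paired hτ) (transfer_cr_mem h2 fun _ => (pairq ρ).2 h2)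
    have j1 : ρ p ≠ ρ (p + 1) := fun e => by have := ρ.injective e; omega
    have j2 : ρ q ≠ ρ (q + 1) := fun e => by have := ρ.injective e; omega
    have k1 : ρ p = q ↔ ρ q = p := hρ.eq_iff
    have k2 : ρ p = q + 1 ↔ ρ (q + 1) = p := hρ.eq_iff
    have k3 : ρ (p + 1) = q ↔ ρ q = p + 1 := hρ.eq_iff
    have k4 : ρ (p + 1) = q + 1 ↔ ρ (q + 1) = p + 1 := hρ.eq_iff
    have np : NormalAt p (conj q ρ) ↔ NormalAt p ρ := by
      unfold NormalAt
      rw [conj_apply_of_ne (by omega) (by omega), conj_apply_of_ne (by omega) (by omega)]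
      simp only [swap_val]
      split_ifs <;> omega
    have nq : NormalAt q (conj p ρ) ↔ NormalAt q ρ := by
      unfold NormalAt
      rw [conj_apply_of_ne (by omega) (by omega), conj_apply_of_ne (by omega) (by omega)]
      simp only [swap_val]
      split_ifs <;> omega
    have hρp := hρ.conj (p := p) (by omega)
    have hρq := hρ.conj (p := q) (by omega)
    have h1' : conj q ρ p ≠ p + 1 := fun e => h1 ((pairp ρ).1 e)
    have h2' : conj p ρ q ≠ q + 1 := fun e => h2 ((pairq ρ).1 e)
    by_cases h3 : NormalAt p ρ <;> by_cases h4 : NormalAt q ρ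
    · rw [transfer_cr_normal h1 h3, transfer_cr_normal h2 h4, map_add, map_smul, map_add, map_smul,
        transfer_cr_normal h1 h3, transfer_cr_normal h2 h4, transfer_cr_normal h1' (np.2 h3),
        transfer_cr_normal h2' (nq.2 h4), comm]
      module
    · rw [transfer_cr_normal h1 h3, transfer_cr_not_normal hρ hq h2 h4, map_add, map_smul,
        transfer_cr_not_normal hρ hq h2 h4, transfer_cr_normal h1' (np.2 h3),
        transfer_cr_not_normal hρp hq h2' (fun h => h4 (nq.1 h)), comm]
    · rw [transfer_cr_not_normal hρ (by omega) h1 h3, transfer_cr_normal h2 h4, map_add, map_smul,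
        transfer_cr_not_normal hρ (by omega) h1 h3, transfer_cr_normal h2' (nq.2 h4),
        transfer_cr_not_normal hρq (by omega) h1' (fun h => h3 (np.1 h)), comm]
    · rw [transfer_cr_not_normal hρ (by omega) h1 h3, transfer_cr_not_normal hρ hq h2 h4,
        transfer_cr_not_normal hρp hq h2' (fun h => h4 (nq.1 h)),
        transfer_cr_not_normal hρq (by omega) h1' (fun h => h3 (np.1 h)), comm]

theorem transfer_rc_ins_comm {p r : ℕ} {N : ℕ} {ρ : Equiv.Perm ℕ} (hρ : IsMatching N ρ) :
    transfer (rc (p + 2 + r)) (vec (ins p ρ)) = transfer (lc p) (transfer (rc (p + r)) (vec ρ)) := by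
  by_cases h : ρ (p + r) = p + r + 1
  · obtain ⟨τ, -, rfl⟩ := hρ.exists_eq_ins h
    rw [← ins_ins, transfer_rc_ins, transfer_rc_ins, map_smul, transfer_lc]
  · rw [transfer_rc_of_ne h, map_zero]
    apply transfer_rc_of_ne
    have h1 : p + 2 + r = skip p (p + r) := by unfold skip; split_ifs <;> omega
    have h2 : p + 2 + r + 1 = skip p (p + r + 1) := by unfold skip; split_ifs <;> omega
    rwa [h2, h1, ins_skip, Ne, skip_inj]

/-- Singularities without common strands commute. -/
theorem transfer_exchange {N : ℕ} (k k' : Kind) (p r : ℕ) (h : p + k.ins + r + k'.ins ≤ N)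
    {ρ : Equiv.Perm ℕ} (hρ : IsMatching N ρ) :
    transfer ⟨k', p + k.outs + r⟩ (transfer ⟨k, p⟩ (vec ρ)) =
      transfer ⟨k, p⟩ (transfer ⟨k', p + k.ins + r⟩ (vec ρ)) := by
  have s1 : ∀ p r, skip p (p + r) = p + 2 + r := fun p r => by unfold skip; split_ifs <;> omega
  have s2 : ∀ p r, skip (p + 2 + r) p = p := fun p r => by unfold skip; split_ifs <;> omega
  cases k with
  | crossing =>
    cases k' with
    | crossing =>
      simp only [Kind.ins, Kind.outs] at h ⊢
      exact transfer_cr_comm hρ (by omega) (by omega)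
    | leftCusp =>
      simp only [Kind.ins, Kind.outs] at h ⊢
      rw [transfer_lc, ← transfer_cr_ins (by omega) hρ (by omega) (by omega), s2]
    | rightCusp =>
      simp only [Kind.ins, Kind.outs] at h ⊢
      by_cases h1 : ρ (p + 2 + r) = p + 2 + r + 1
      · obtain ⟨τ, hτ, rfl⟩ := hρ.exists_eq_ins h1
        have := transfer_cr_ins (p := p + 2 + r) (q := p) (by omega) hτ (by omega) (by omega)
        rw [s2] at this
        rw [this, transfer_rc_ins, transfer_rc_lc, map_smul]
      · rw [transfer_rc_of_ne h1, map_zero]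
        refine transfer_rc_eq_zero (transfer_cr_mem h1 fun _ => ?_)
        rw [Set.mem_ofPred_eq, conj_apply_of_ne (by omega) (by omega), swap_val]
        split_ifs <;> omega
  | leftCusp =>
    cases k' with
    | crossing =>
      simp only [Kind.ins, Kind.outs, add_zero] at h ⊢
      rw [transfer_lc, ← transfer_cr_ins (by omega) hρ (by omega) (by omega), s1]
    | leftCusp =>
      simp only [Kind.ins, Kind.outs, add_zero] at h ⊢
      rw [transfer_lc, transfer_lc, transfer_lc, transfer_lc, ins_ins]
    | rightCusp =>
      simp only [Kind.ins, Kind.outs, add_zero] at h ⊢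
      rw [transfer_lc, transfer_rc_ins_comm hρ]
  | rightCusp =>
    by_cases h1 : ρ p = p + 1
    · obtain ⟨τ, hτ, rfl⟩ := hρ.exists_eq_ins h1
      rw [transfer_rc_ins, map_smul]
      cases k' with
      | crossing =>
        simp only [Kind.ins, Kind.outs, add_zero] at h ⊢
        rw [← s1, transfer_cr_ins (by omega) hτ (by omega) (by omega), transfer_rc_lc]
      | leftCusp =>
        simp only [Kind.ins, Kind.outs, add_zero] at h ⊢
        rw [transfer_lc, transfer_lc, ins_ins, transfer_rc_ins]
      | rightCusp =>
        simp only [Kind.ins, Kind.outs, add_zero] at h ⊢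
        rw [transfer_rc_ins_comm hτ, transfer_rc_lc]
    · rw [transfer_rc_of_ne h1, map_zero]
      symm
      cases k' with
      | crossing =>
        simp only [Kind.ins] at h ⊢
        refine transfer_rc_eq_zero (transfer_cr_mem h1 fun _ => ?_)
        rw [Set.mem_ofPred_eq, conj_apply_of_ne (by omega) (by omega), swap_val]
        split_ifs <;> omega
      | leftCusp =>
        simp only [Kind.ins, add_zero] at h ⊢
        rw [transfer_lc]
        apply transfer_rc_of_ne
        have e1 : skip (p + 2 + r) p = p := s2 p r
        have e2 : skip (p + 2 + r) (p + 1) = p + 1 := by unfold skip; split_ifs <;> omega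
        intro e
        rw [← e2] at e
        nth_rewrite 2 [← e1] at e
        rw [ins_skip, skip_inj] at e
        exact h1 e
      | rightCusp =>
        simp only [Kind.ins] at h ⊢
        by_cases h2 : ρ (p + 2 + r) = p + 2 + r + 1
        · obtain ⟨τ, -, rfl⟩ := hρ.exists_eq_ins h2
          rw [transfer_rc_ins, map_smul, transfer_rc_of_ne, smul_zero]
          intro e
          apply h1
          have e1 : skip (p + 2 + r) p = p := s2 p r
          have e2 : skip (p + 2 + r) (p + 1) = p + 1 := by unfold skip; split_ifs <;> omega
          nth_rewrite 2 [← e1]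
          rw [ins_skip, e, e2]
        · rw [transfer_rc_of_ne h2, map_zero]

theorem conj_ins_succ (p : ℕ) (ρ : Equiv.Perm ℕ) :
    conj p (ins (p + 1) ρ) = conj (p + 1) (ins p ρ) := by
  have key : ∀ v, Equiv.swap p (p + 1) (skip (p + 1) v) =
      Equiv.swap (p + 1) (p + 1 + 1) (skip p v) := fun v => by
    simp only [swap_val]; unfold skip; split_ifs <;> omega
  ext q
  by_cases h0 : q = p
  · subst h0
    rw [conj_apply_left, conj_apply_of_ne (by omega) (by omega), ins_left, ins_left]
    simp only [swap_val]; split_ifs <;> omega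
  by_cases h1 : q = p + 1
  · subst h1
    have e1 : skip (p + 1) p = p := by unfold skip; split_ifs <;> omega
    have e2 : skip p p = p + 1 + 1 := by unfold skip; split_ifs <;> omega
    have e3 : ins (p + 1) ρ p = skip (p + 1) (ρ p) := by
      nth_rewrite 2 [← e1]
      rw [ins_skip]
    have e4 : ins p ρ (p + 1 + 1) = skip p (ρ p) := by rw [← e2, ins_skip]
    rw [conj_apply_right, conj_apply_left, e3, e4, key]
  by_cases h2 : q = p + 2
  · subst h2
    rw [conj_apply_of_ne (by omega) (by omega), conj_apply_right, ins_right, ins_right]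
    simp only [swap_val]; split_ifs <;> omega
  · obtain ⟨t, ht, ht'⟩ : ∃ t, q = skip p t ∧ q = skip (p + 1) t :=
      ⟨unskip p q, (skip_unskip h0 h1).symm, by unfold skip unskip; split_ifs <;> omega⟩
    rw [conj_apply_of_ne h0 h1, conj_apply_of_ne h1 h2]
    nth_rewrite 1 [ht']
    rw [ht, ins_skip, ins_skip, key]

section
variable {N p : ℕ} {ρ : Equiv.Perm ℕ}

theorem normalAt_succ : NormalAt (p + 1) ρ ↔ (ρ (p + 1) < p + 1 ∧ p + 2 < ρ (p + 2)) ∨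
    (ρ (p + 2) < ρ (p + 1) ∧ ρ (p + 1) < p + 1) ∨
      (p + 2 < ρ (p + 2) ∧ ρ (p + 2) < ρ (p + 1)) := Iff.rfl

theorem ins_succ_apply (p : ℕ) (ρ : Equiv.Perm ℕ) : ins (p + 1) ρ p = skip (p + 1) (ρ p) := by
  have e : skip (p + 1) p = p := by unfold skip; split_ifs <;> omega
  nth_rewrite 2 [← e]
  rw [ins_skip]

theorem ins_apply_add_two (p : ℕ) (ρ : Equiv.Perm ℕ) : ins p ρ (p + 2) = skip p (ρ p) := by
  have e : skip p p = p + 2 := by unfold skip; split_ifs <;> omega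
  nth_rewrite 1 [← e]
  rw [ins_skip]

/-- A crossing of the upper strand of a left cusp with the strand above it. -/
theorem transfer_cr_lc_succ (hρ : IsMatching N ρ) (hp : p < N) :
    transfer (cr p) (vec (ins (p + 1) ρ)) =
      vec (conj p (ins (p + 1) ρ)) + (z : CoeffRing) • vec (ins (p + 1) ρ) := by
  have h1 := hρ.ne hp
  have h2 := ins_succ_apply p ρ
  have h3 := ins_left (p + 1) ρ
  unfold skip at h2
  refine transfer_cr_normal ?_ ?_
  · split_ifs at h2 <;> omega
  · unfold NormalAt
    split_ifs at h2 <;> omega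

/-- A crossing of the lower strand of a left cusp with the strand below it. -/
theorem transfer_cr_succ_lc (hρ : IsMatching N ρ) (hp : p < N) :
    transfer (cr (p + 1)) (vec (ins p ρ)) =
      vec (conj p (ins (p + 1) ρ)) + (z : CoeffRing) • vec (ins p ρ) := by
  have h1 := hρ.ne hp
  have h2 := ins_apply_add_two p ρ
  have h3 := ins_right p ρ
  unfold skip at h2
  rw [conj_ins_succ]
  refine transfer_cr_normal ?_ ?_
  · omega
  · rw [normalAt_succ]
    split_ifs at h2 <;> omega

theorem transfer_cr_conj_of_normal (hρ : IsMatching N ρ) (hp : p + 2 ≤ N) (h1 : ρ p ≠ p + 1)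
    (h2 : NormalAt p ρ) : transfer (cr p) (vec (conj p ρ)) = vec ρ := by
  have h3 : conj p ρ p ≠ p + 1 := by
    have h4 : ρ (p + 1) ≠ p := fun e => h1 (hρ.eq_iff.1 e)
    rw [conj_apply_left, swap_val]; split_ifs <;> omega
  have h5 := normalAt_conj hρ hp h1
  rw [transfer_cr_not_normal (hρ.conj hp) hp h3 (fun h => h5.1 h h2), conj_conj]

theorem two_left_down (hρ : IsMatching N ρ) (hp : p < N) :
    transfer (cr (p + 1)) (transfer (cr p) (vec (ins (p + 1) ρ))) = vec (ins p ρ) := by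
  have h1 := hρ.ne hp
  have h2 := ins_apply_add_two p ρ
  have h3 := ins_right p ρ
  unfold skip at h2
  rw [transfer_cr_lc_succ hρ hp, map_add, map_smul, transfer_cr_paired (ins_left _ _), smul_zero,
    add_zero, conj_ins_succ, transfer_cr_conj_of_normal (hρ.ins hp.le) (by omega) (by omega)]
  rw [normalAt_succ]
  split_ifs at h2 <;> omega

theorem two_left_up (hρ : IsMatching N ρ) (hp : p < N) :
    transfer (cr p) (transfer (cr (p + 1)) (vec (ins p ρ))) = vec (ins (p + 1) ρ) := by
  have h1 := hρ.ne hp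
  have h2 := ins_succ_apply p ρ
  have h3 := ins_left (p + 1) ρ
  unfold skip at h2
  rw [transfer_cr_succ_lc hρ hp, map_add, map_smul, transfer_cr_paired (ins_left _ _), smul_zero,
    add_zero, transfer_cr_conj_of_normal (hρ.ins (by omega)) (by omega)]
  · split_ifs at h2 <;> omega
  · unfold NormalAt
    split_ifs at h2 <;> omega

/-- Neighboring strands are not paired after a crossing of one of them with the other strand of a
left cusp. -/
theorem conj_ins_succ_ne (hρ : IsMatching N ρ) (hp : p < N) :
    conj p (ins (p + 1) ρ) p ≠ p + 1 ∧ conj p (ins (p + 1) ρ) (p + 1) ≠ p + 2 := by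
  have h1 := hρ.ne hp
  have h2 := ins_succ_apply p ρ
  have h3 := ins_left (p + 1) ρ
  unfold skip at h2
  rw [conj_apply_left, conj_apply_right, swap_val, swap_val]
  split_ifs at h2 <;> split_ifs <;> omega

end

/-- No two of the strands in `S` are paired. -/
def NoPairIn (S : Set ℕ) (ρ : Equiv.Perm ℕ) : Prop := ∀ q ∈ S, ρ q ∉ S

theorem swap_mem_iff {S : Set ℕ} {p : ℕ} (hS : p ∈ S ↔ p + 1 ∈ S) (q : ℕ) :
    Equiv.swap p (p + 1) q ∈ S ↔ q ∈ S := by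
  rw [swap_val]
  split_ifs with h h'
  · rw [h, hS]
  · rw [h', hS]
  · rfl

theorem noPairIn_conj {S : Set ℕ} {p : ℕ} {ρ : Equiv.Perm ℕ} (hS : p ∈ S ↔ p + 1 ∈ S) :
    NoPairIn S (conj p ρ) ↔ NoPairIn S ρ := by
  unfold NoPairIn
  simp only [conj_apply, swap_mem_iff hS]
  constructor
  · intro h q hq
    have := h (Equiv.swap p (p + 1) q) ((swap_mem_iff hS q).2 hq)
    rwa [Equiv.swap_apply_self] at this
  · intro h q hq
    exact h _ ((swap_mem_iff hS q).2 hq)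

theorem noPairIn_step {S : Set ℕ} {p : ℕ} {ρ ρ' : Equiv.Perm ℕ} (hS : p ∈ S ↔ p + 1 ∈ S)
    (h : Step (cr p) ρ ρ') : NoPairIn S ρ' ↔ NoPairIn S ρ := by
  rcases h with ⟨-, rfl | ⟨rfl, -⟩⟩
  · exact noPairIn_conj hS
  · rfl

section
variable {N p : ℕ} {ρ : Equiv.Perm ℕ}

theorem two_right_down (hρ : IsMatching N ρ) (hp : p + 3 ≤ N) :
    transfer (rc p) (transfer (cr (p + 1)) (transfer (cr p) (vec ρ))) =
      transfer (rc (p + 1)) (vec ρ) := by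
  by_cases h : ρ (p + 1) = p + 1 + 1
  · obtain ⟨τ, hτ, rfl⟩ := hρ.exists_eq_ins h
    rw [two_left_down hτ (by omega), transfer_rc_ins, transfer_rc_ins]
  rw [transfer_rc_of_ne h]
  by_cases h0 : ρ p = p + 1
  · rw [transfer_cr_paired h0, map_zero, map_zero]
  have h1 := hρ.ne (q := p) (by omega)
  have h2 := hρ.ne (q := p + 1) (by omega)
  have h3 := hρ.ne (q := p + 2) (by omega)
  have k1 : ρ p = p + 1 ↔ ρ (p + 1) = p := hρ.eq_iff
  have k2 : ρ p = p + 2 ↔ ρ (p + 2) = p := hρ.eq_iff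
  have k3 : ρ (p + 1) = p + 2 ↔ ρ (p + 2) = p + 1 := hρ.eq_iff
  by_cases h4 : ρ p = p + 2
  · have n : ¬ NormalAt p ρ := by unfold NormalAt; omega
    rw [transfer_cr_not_normal hρ (by omega) h0 n, transfer_cr_paired, map_zero]
    rw [conj_apply_right, h4, Equiv.swap_apply_of_ne_of_ne (by omega) (by omega)]
  · have hS : NoPairIn (Set.Ico p (p + 3)) ρ := by
      intro q hq hq'
      obtain rfl | rfl | rfl : q = p ∨ q = p + 1 ∨ q = p + 2 := by
        have := hq.1; have := hq.2; omega
      all_goals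
        have := hq'.1; have := hq'.2; omega
    refine transfer_rc_eq_zero (transfer_mem_supported (S := {ρ | NoPairIn (Set.Ico p (p + 3)) ρ})
      (fun τ hτ τ' h => ?_) (transfer_mem_supported (fun τ hτ τ' h => ?_)
        (vec_mem_supported (S := {ρ | NoPairIn (Set.Ico p (p + 3)) ρ}) hS)))
    · have hτ' : NoPairIn (Set.Ico p (p + 3)) τ' :=
        (noPairIn_step (by rw [Set.mem_Ico, Set.mem_Ico]; omega) h).2 hτ
      intro e
      exact hτ' p (by simp) (by rw [e]; simp)
    · exact (noPairIn_step (by rw [Set.mem_Ico, Set.mem_Ico]; omega) h).2 hτ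

theorem two_right_up (hρ : IsMatching N ρ) (hp : p + 3 ≤ N) :
    transfer (rc (p + 1)) (transfer (cr p) (transfer (cr (p + 1)) (vec ρ))) =
      transfer (rc p) (vec ρ) := by
  by_cases h : ρ p = p + 1
  · obtain ⟨τ, hτ, rfl⟩ := hρ.exists_eq_ins h
    rw [two_left_up hτ (by omega), transfer_rc_ins, transfer_rc_ins]
  rw [transfer_rc_of_ne h]
  by_cases h0 : ρ (p + 1) = p + 2
  · rw [transfer_cr_paired h0, map_zero, map_zero]
  have h1 := hρ.ne (q := p) (by omega)
  have h2 := hρ.ne (q := p + 1) (by omega)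
  have h3 := hρ.ne (q := p + 2) (by omega)
  have k1 : ρ p = p + 1 ↔ ρ (p + 1) = p := hρ.eq_iff
  have k2 : ρ p = p + 2 ↔ ρ (p + 2) = p := hρ.eq_iff
  have k3 : ρ (p + 1) = p + 2 ↔ ρ (p + 2) = p + 1 := hρ.eq_iff
  by_cases h4 : ρ p = p + 2
  · have n : ¬ NormalAt (p + 1) ρ := by rw [normalAt_succ]; omega
    rw [transfer_cr_not_normal hρ (by omega) h0 n, transfer_cr_paired, map_zero]
    rw [conj_apply_of_ne (by omega) (by omega), h4]
    exact Equiv.swap_apply_right _ _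
  · have hS : NoPairIn (Set.Ico p (p + 3)) ρ := by
      intro q hq hq'
      obtain rfl | rfl | rfl : q = p ∨ q = p + 1 ∨ q = p + 2 := by
        have := hq.1; have := hq.2; omega
      all_goals
        have := hq'.1; have := hq'.2; omega
    refine transfer_rc_eq_zero (transfer_mem_supported (S := {ρ | NoPairIn (Set.Ico p (p + 3)) ρ})
      (fun τ hτ τ' h => ?_) (transfer_mem_supported (fun τ hτ τ' h => ?_)
        (vec_mem_supported (S := {ρ | NoPairIn (Set.Ico p (p + 3)) ρ}) hS)))
    · have hτ' : NoPairIn (Set.Ico p (p + 3)) τ' :=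
        (noPairIn_step (by rw [Set.mem_Ico, Set.mem_Ico]; omega) h).2 hτ
      intro e
      exact hτ' (p + 1) (by simp) (by rw [e, Set.mem_Ico]; omega)
    · exact (noPairIn_step (by rw [Set.mem_Ico, Set.mem_Ico]; omega) h).2 hτ

theorem conj_braid (p : ℕ) (ρ : Equiv.Perm ℕ) :
    conj p (conj (p + 1) (conj p ρ)) = conj (p + 1) (conj p (conj (p + 1) ρ)) := by
  have : Equiv.swap p (p + 1) * Equiv.swap (p + 1) (p + 1 + 1) * Equiv.swap p (p + 1) =
      Equiv.swap (p + 1) (p + 1 + 1) * Equiv.swap p (p + 1) *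
        Equiv.swap (p + 1) (p + 1 + 1) := by
    ext x; simp only [Equiv.Perm.mul_apply, swap_val]; split_ifs <;> omega
  unfold conj
  calc _ = (Equiv.swap p (p + 1) * Equiv.swap (p + 1) (p + 1 + 1) * Equiv.swap p (p + 1)) * ρ *
      (Equiv.swap p (p + 1) * Equiv.swap (p + 1) (p + 1 + 1) * Equiv.swap p (p + 1)) := by
        simp only [mul_assoc]
    _ = _ := by rw [this]; simp only [mul_assoc]

/-- The chords that join neighboring strands `p` and `p + 1` to `x` and `y` do not cross. -/
def CyclicLT (p y x : ℕ) : Prop := (x < p ∧ p < y) ∨ (y < x ∧ x < p) ∨ (p < y ∧ y < x)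

/-- For a pairing without pairs among the strands `p`, `p + 1`, `p + 2`, normality is governed by
the cyclic order of the three companions, which the crossings permute. -/
theorem three_of_noPair (hρ : IsMatching N ρ) (hp : p + 3 ≤ N)
    (hS : NoPairIn (Set.Ico p (p + 3)) ρ) :
    transfer (cr p) (transfer (cr (p + 1)) (transfer (cr p) (vec ρ))) =
      transfer (cr (p + 1)) (transfer (cr p) (transfer (cr (p + 1)) (vec ρ))) := by
  -- The companions are outside of `{p, p + 1, p + 2}` and are permuted by the crossings.
  have out : ∀ ρ, IsMatching N ρ → NoPairIn (Set.Ico p (p + 3)) ρ → ∀ q, p ≤ q → q < p + 3 →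
      ρ q < p ∨ p + 3 ≤ ρ q := fun ρ _ hS q h h' => by
    have := hS q ⟨h, h'⟩
    rw [Set.mem_Ico] at this
    omega
  have step1 : ∀ ρ, IsMatching N ρ → NoPairIn (Set.Ico p (p + 3)) ρ →
      (transfer (cr p) (vec ρ) = vec (conj p ρ) +
        (haveI := Classical.propDecidable; if CyclicLT p (ρ (p + 1)) (ρ p) then
          (z : CoeffRing) • vec ρ else 0)) ∧
      conj p ρ p = ρ (p + 1) ∧ conj p ρ (p + 1) = ρ p ∧ conj p ρ (p + 2) = ρ (p + 2) ∧
      IsMatching N (conj p ρ) ∧ NoPairIn (Set.Ico p (p + 3)) (conj p ρ) := by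
    intro ρ hρ hS
    have o0 := out ρ hρ hS p (by omega) (by omega)
    have o1 := out ρ hρ hS (p + 1) (by omega) (by omega)
    have o2 := out ρ hρ hS (p + 2) (by omega) (by omega)
    have hn : NormalAt p ρ ↔ CyclicLT p (ρ (p + 1)) (ρ p) := by
      unfold NormalAt CyclicLT; omega
    refine ⟨?_, ?_, ?_, ?_, hρ.conj (by omega),
      (noPairIn_conj (by rw [Set.mem_Ico, Set.mem_Ico]; omega)).2 hS⟩
    · split_ifs with h
      · exact transfer_cr_normal (by omega) (hn.2 h)
      · rw [add_zero]
        exact transfer_cr_not_normal hρ (by omega) (by omega) (fun h' => h (hn.1 h'))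
    · rw [conj_apply_left, Equiv.swap_apply_of_ne_of_ne (by omega) (by omega)]
    · rw [conj_apply_right, Equiv.swap_apply_of_ne_of_ne (by omega) (by omega)]
    · rw [conj_apply_of_ne (by omega) (by omega),
        Equiv.swap_apply_of_ne_of_ne (by omega) (by omega)]
  have step2 : ∀ ρ, IsMatching N ρ → NoPairIn (Set.Ico p (p + 3)) ρ →
      (transfer (cr (p + 1)) (vec ρ) = vec (conj (p + 1) ρ) +
        (haveI := Classical.propDecidable; if CyclicLT p (ρ (p + 2)) (ρ (p + 1)) then
          (z : CoeffRing) • vec ρ else 0)) ∧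
      conj (p + 1) ρ p = ρ p ∧ conj (p + 1) ρ (p + 1) = ρ (p + 2) ∧
      conj (p + 1) ρ (p + 2) = ρ (p + 1) ∧
      IsMatching N (conj (p + 1) ρ) ∧ NoPairIn (Set.Ico p (p + 3)) (conj (p + 1) ρ) := by
    intro ρ hρ hS
    have o0 := out ρ hρ hS p (by omega) (by omega)
    have o1 := out ρ hρ hS (p + 1) (by omega) (by omega)
    have o2 := out ρ hρ hS (p + 2) (by omega) (by omega)
    have hn : NormalAt (p + 1) ρ ↔ CyclicLT p (ρ (p + 2)) (ρ (p + 1)) := by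
      rw [normalAt_succ]; unfold CyclicLT; omega
    refine ⟨?_, ?_, ?_, ?_, hρ.conj (by omega),
      (noPairIn_conj (by rw [Set.mem_Ico, Set.mem_Ico]; omega)).2 hS⟩
    · split_ifs with h
      · exact transfer_cr_normal (by omega) (hn.2 h)
      · rw [add_zero]
        exact transfer_cr_not_normal hρ (by omega) (by omega) (fun h' => h (hn.1 h'))
    · rw [conj_apply_of_ne (by omega) (by omega),
        Equiv.swap_apply_of_ne_of_ne (by omega) (by omega)]
    · have o2' : ρ (p + 1 + 1) < p ∨ p + 3 ≤ ρ (p + 1 + 1) := o2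
      rw [conj_apply_left, Equiv.swap_apply_of_ne_of_ne (by omega) (by omega)]
    · change conj (p + 1) ρ (p + 1 + 1) = _
      rw [conj_apply_right (p + 1),
        Equiv.swap_apply_of_ne_of_ne (by omega) (by change _ ≠ p + 2; omega)]
  obtain ⟨t1, a1, b1, c1, m1, s1⟩ := step1 ρ hρ hS
  obtain ⟨t2, a2, b2, c2, m2, s2⟩ := step2 ρ hρ hS
  obtain ⟨t12, a12, b12, c12, m12, s12⟩ := step2 _ m1 s1
  obtain ⟨t21, a21, b21, c21, m21, s21⟩ := step1 _ m2 s2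
  obtain ⟨t121, -⟩ := step1 _ m12 s12
  obtain ⟨t212, -⟩ := step2 _ m21 s21
  obtain ⟨t11, -⟩ := step1 _ m1 s1
  obtain ⟨t22, -⟩ := step2 _ m2 s2
  rw [a1, b1, conj_conj] at t11
  rw [b2, c2, conj_conj] at t22
  rw [b1, c1] at t12
  rw [a2, b2] at t21
  rw [a12, b12, a1, c1] at t121
  rw [b21, c21, a2, c2] at t212
  rw [conj_braid] at t121
  have o0 := out ρ hρ hS p (by omega) (by omega)
  have o1 := out ρ hρ hS (p + 1) (by omega) (by omega)
  have o2 := out ρ hρ hS (p + 2) (by omega) (by omega)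
  have n1 : ρ p ≠ ρ (p + 1) := fun e => by have := ρ.injective e; omega
  have n2 : ρ p ≠ ρ (p + 2) := fun e => by have := ρ.injective e; omega
  have n3 : ρ (p + 1) ≠ ρ (p + 2) := fun e => by have := ρ.injective e; omega
  have anti : ∀ {x y}, x ≠ p → y ≠ p → x ≠ y → (CyclicLT p x y ↔ ¬ CyclicLT p y x) := by
    intro x y _ _ _; unfold CyclicLT; omega
  have tr : ∀ {x y w}, CyclicLT p x y → CyclicLT p y w → CyclicLT p x w := by
    intro x y w; unfold CyclicLT; omega
  have e1 := anti (x := ρ p) (y := ρ (p + 1)) (by omega) (by omega) n1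
  have e2 := anti (x := ρ (p + 1)) (y := ρ (p + 2)) (by omega) (by omega) n3
  have tr1 := tr (x := ρ (p + 2)) (y := ρ (p + 1)) (w := ρ p)
  have tr2 := tr (x := ρ p) (y := ρ (p + 1)) (w := ρ (p + 2))
  have e3 := anti (x := ρ p) (y := ρ (p + 2)) (by omega) (by omega) n2
  rw [e1] at t11
  rw [e2] at t22
  rw [e1, e2, e3] at tr2
  generalize CyclicLT p (ρ (p + 1)) (ρ p) = A at *
  generalize CyclicLT p (ρ (p + 2)) (ρ (p + 1)) = B at *
  generalize CyclicLT p (ρ (p + 2)) (ρ p) = C at *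
  by_cases hA : A <;> by_cases hB : B <;> by_cases hC : C <;>
    simp only [hA, hB, hC, not_true_eq_false, not_false_eq_true, if_true, if_false, add_zero,
      forall_true_left] at t1 t2 t12 t21 t121 t212 t11 t22 tr1 tr2 <;>
    simp only [t1, t2, t12, t21, t121, t212, t11, t22, map_add, map_smul] <;> module

theorem transfer_three (hρ : IsMatching N ρ) (hp : p + 3 ≤ N) :
    transfer (cr p) (transfer (cr (p + 1)) (transfer (cr p) (vec ρ))) =
      transfer (cr (p + 1)) (transfer (cr p) (transfer (cr (p + 1)) (vec ρ))) := by
  by_cases h1 : ρ p = p + 1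
  · obtain ⟨τ, hτ, rfl⟩ := hρ.exists_eq_ins h1
    rw [transfer_cr_paired h1, map_zero, map_zero, two_left_up hτ (by omega),
      transfer_cr_paired (ins_left _ _)]
  by_cases h2 : ρ (p + 1) = p + 1 + 1
  · obtain ⟨τ, hτ, rfl⟩ := hρ.exists_eq_ins h2
    rw [transfer_cr_paired h2, map_zero, map_zero, two_left_down hτ (by omega),
      transfer_cr_paired (ins_left _ _)]
  have k1 : ρ p = p + 1 ↔ ρ (p + 1) = p := hρ.eq_iff
  have k2 : ρ p = p + 2 ↔ ρ (p + 2) = p := hρ.eq_iff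
  have k3 : ρ (p + 1) = p + 2 ↔ ρ (p + 2) = p + 1 := hρ.eq_iff
  by_cases h3 : ρ p = p + 2
  · have n : ¬ NormalAt p ρ := by unfold NormalAt; omega
    have n' : ¬ NormalAt (p + 1) ρ := by rw [normalAt_succ]; omega
    rw [transfer_cr_not_normal hρ (by omega) h1 n, transfer_cr_not_normal hρ (by omega) h2 n',
      transfer_cr_paired (p := p + 1), map_zero, transfer_cr_paired (p := p), map_zero]
    · rw [conj_apply_of_ne (by omega) (by omega), h3]
      exact Equiv.swap_apply_right _ _
    · rw [conj_apply_right, h3, Equiv.swap_apply_of_ne_of_ne (by omega) (by omega)]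
  · refine three_of_noPair hρ hp ?_
    have h4 := hρ.ne (q := p) (by omega)
    have h5 := hρ.ne (q := p + 1) (by omega)
    have h6 := hρ.ne (q := p + 2) (by omega)
    intro q hq hq'
    obtain rfl | rfl | rfl : q = p ∨ q = p + 1 ∨ q = p + 2 := by
      have := hq.1; have := hq.2; omega
    all_goals
      have := hq'.1; have := hq'.2; omega

end

/-- Legendrian isotopic fronts have equal transfer operators. -/
theorem transferFront_legMove {x y : Front} (h : LegMove x y) {M M' M'' : ℕ} (hx : Runs x M M')
    (hy : Runs y M M'') {v : PairingSpace} (hv : v ∈ matchingSpace M) :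
    transferFront x v = transferFront y v := by
  refine eqOn_supported (fun ρ hρ => ?_) hv
  replace hρ : IsMatching M ρ := hρ
  cases h with
  | exchange k k' p r =>
    have := hy.1
    exact transfer_exchange k k' p r (by simpa using this) hρ
  | one_down p =>
    have hp : p < M := hx.1
    simp only [transferFront, LinearMap.comp_apply, LinearMap.id_apply]
    rw [transfer_lc, transfer_cr_lc_succ hρ hp, map_add, map_smul, transfer_rc_ins,
      transfer_rc_of_ne (conj_ins_succ_ne hρ hp).2, zero_add, smul_smul, Units.mul_inv, one_smul]
  | one_up p =>
    have hp : p < M := by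
      have := hx.2.1
      simp only [Kind.ins, Kind.outs] at this
      omega
    simp only [transferFront, LinearMap.comp_apply, LinearMap.id_apply]
    rw [transfer_lc, transfer_cr_succ_lc hρ hp, map_add, map_smul, transfer_rc_ins,
      transfer_rc_of_ne (conj_ins_succ_ne hρ hp).1, zero_add, smul_smul, Units.mul_inv, one_smul]
  | two_left_down p =>
    have hp : p < M := hx.1
    simp only [transferFront, LinearMap.comp_apply, LinearMap.id_apply]
    rw [transfer_lc, transfer_lc, two_left_down hρ hp]
  | two_left_up p =>
    have hp : p < M := hy.1
    simp only [transferFront, LinearMap.comp_apply, LinearMap.id_apply]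
    rw [transfer_lc, transfer_lc, two_left_up hρ hp]
  | two_right_down p =>
    have hp : p + 1 + 2 ≤ M := hy.1
    exact two_right_down hρ (by omega)
  | two_right_up p =>
    have hp : p + 1 + 2 ≤ M := hx.1
    exact two_right_up hρ (by omega)
  | three p =>
    have hp : p + 1 + 2 ≤ M := hy.1
    exact transfer_three hρ (by omega)

theorem transferFront_skein {M p : ℕ} (hp : p < M) {v : PairingSpace} (hv : v ∈ matchingSpace M) :
    transferFront [lc (p + 1), cr p] v - transferFront [lc p, cr (p + 1)] v =
      (z : CoeffRing) • (transferFront [lc (p + 1)] v - transferFront [lc p] v) := by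
  have := eqOn_supported (S := {ρ | IsMatching M ρ})
    (f := transferFront [lc (p + 1), cr p] - transferFront [lc p, cr (p + 1)])
    (g := (z : CoeffRing) • (transferFront [lc (p + 1)] - transferFront [lc p]))
    (fun ρ hρ => ?_) hv
  · exact this
  · simp only [transferFront, LinearMap.comp_apply, LinearMap.id_apply, LinearMap.sub_apply,
      LinearMap.smul_apply]
    rw [transfer_lc, transfer_lc, transfer_cr_lc_succ hρ hp, transfer_cr_succ_lc hρ hp]
    module

theorem transferFront_zigzag_down (p : ℕ) : transferFront [lc p, rc (p + 1)] = 0 := by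
  refine LinearMap.ext fun v => ?_
  refine eqOn_supported (S := Set.univ) (fun ρ _ => ?_) (by simp)
  simp only [transferFront, LinearMap.comp_apply, LinearMap.id_apply, LinearMap.zero_apply]
  rw [transfer_lc, transfer_rc_of_ne]
  rw [ins_right]; omega

theorem transferFront_zigzag_up (p : ℕ) : transferFront [lc (p + 1), rc p] = 0 := by
  refine LinearMap.ext fun v => ?_
  refine eqOn_supported (S := Set.univ) (fun ρ _ => ?_) (by simp)
  simp only [transferFront, LinearMap.comp_apply, LinearMap.id_apply, LinearMap.zero_apply]
  rw [transfer_lc, transfer_rc_of_ne]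
  rw [ins_succ_apply]
  exact skip_ne_left _ _

/-! ### The action of the Legendrian BMW algebra on pairings -/

theorem runs_append_iff {u v : Front} {a b : ℕ} :
    Runs (u ++ v) a b ↔ ∃ m, Runs u a m ∧ Runs v m b := by
  refine ⟨fun h => ?_, fun ⟨m, h, h'⟩ => runs_append h h'⟩
  induction u generalizing a with
  | nil => exact ⟨a, rfl, h⟩
  | cons e u ih =>
    obtain ⟨m, h1, h2⟩ := ih h.2
    exact ⟨m, ⟨h.1, h1⟩, h2⟩

theorem Runs.unique {w : Front} {a b b' : ℕ} (h : Runs w a b) (h' : Runs w a b') : b = b' := by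
  induction w generalizing a with
  | nil => exact h.symm.trans h'
  | cons e w ih => exact ih h.2 h'.2

theorem shift_append (c : ℕ) (u v : Front) : shift c (u ++ v) = shift c u ++ shift c v :=
  List.map_append

theorem runs_shift {w : Front} {a b c M : ℕ} (h : Runs w a b) (hM : c + a ≤ M) :
    Runs (shift c w) M (M - a + b) := by
  induction w generalizing a M with
  | nil => simp only [Runs] at h; subst h; change M = M - a + a; omega
  | cons e w ih =>
    have h1 := h.1
    have h2 := ih (M := M - e.kind.ins + e.kind.outs) h.2 (by omega)
    refine ⟨by change c + e.pos + e.kind.ins ≤ M; omega, ?_⟩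
    have : M - e.kind.ins + e.kind.outs - (a - e.kind.ins + e.kind.outs) + b = M - a + b := by
      omega
    rw [this] at h2
    exact h2

theorem LegMove.shift {x y : Front} (h : LegMove x y) (c : ℕ) :
    LegMove (shift c x) (shift c y) := by
  cases h with
  | exchange k k' p r =>
    have := LegMove.exchange k k' (c + p) r
    simpa [LegRuling.shift, add_assoc] using this
  | one_down p => exact .one_down (c + p)
  | one_up p => exact .one_up (c + p)
  | two_left_down p => exact .two_left_down (c + p)
  | two_left_up p => exact .two_left_up (c + p)
  | two_right_down p => exact .two_right_down (c + p)
  | two_right_up p => exact .two_right_up (c + p)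
  | three p => exact .three (c + p)

theorem runs_shift_tangle {w : Front} {n c N : ℕ} (h : Runs w n n) (hN : c + n ≤ N) :
    Runs (shift c w) N N := by
  have := runs_shift h hN
  rwa [Nat.sub_add_cancel (by omega)] at this

section Action
variable {n c N : ℕ}

/-- An `n`-tangle placed below `c` of `N` strands acts on the span of the pairings of these
strands. -/
noncomputable def tangleAction (hN : c + n ≤ N) :
    Tangle n →* Module.End CoeffRing (matchingSpace N) where
  toFun α := (transferFront (shift c α.front)).restrict fun _ hx =>
    transferFront_mem (runs_shift_tangle α.runs hN) hx
  map_one' := rfl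
  map_mul' α β := by
    refine LinearMap.ext fun x => Subtype.ext ?_
    change transferFront (shift c (β.front ++ α.front)) _ = _
    rw [shift_append, transferFront_append]
    rfl

/-- The action of linear combinations of `n`-tangles. -/
noncomputable def tangleSumAction (hN : c + n ≤ N) :
    TangleSum n →ₐ[CoeffRing] Module.End CoeffRing (matchingSpace N) :=
  MonoidAlgebra.lift CoeffRing _ (Tangle n) (tangleAction hN)

theorem tangleSumAction_single (hN : c + n ≤ N) {w : Front} (h : Runs w n n)
    (x : matchingSpace N) :
    ((tangleSumAction hN (single w h) x : matchingSpace N) : PairingSpace) =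
      transferFront (shift c w) x := by
  have : tangleSumAction hN (single w h) = tangleAction hN ⟨w, h⟩ := MonoidAlgebra.lift_of _ _
  rw [this]
  rfl

theorem tangleSumAction_rel (hN : c + n ≤ N) {a b : TangleSum n} (h : BMWRel n a b) :
    tangleSumAction hN a = tangleSumAction hN b := by
  refine LinearMap.ext fun x => Subtype.ext ?_
  -- Each relation changes a part of the front between two unchanged parts `u` and `v`.
  have split : ∀ u y v : Front, transferFront (shift c (u ++ y ++ v)) x =
      transferFront (shift c v) (transferFront (shift c y) (transferFront (shift c u) x)) := by
    intro u y v
    rw [shift_append, shift_append, transferFront_append, transferFront_append]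
    rfl
  have mem : ∀ u y v : Front, Runs (u ++ y ++ v) n n →
      ∃ m m', Runs (shift c u) N m ∧ Runs (shift c y) m m' ∧
        transferFront (shift c u) x ∈ matchingSpace m := by
    intro u y v h
    have h1 := runs_shift_tangle h hN
    rw [shift_append, shift_append, runs_append_iff] at h1
    obtain ⟨m', h1, -⟩ := h1
    rw [runs_append_iff] at h1
    obtain ⟨m, h2, h3⟩ := h1
    exact ⟨m, m', h2, h3, transferFront_mem h2 x.2⟩
  cases h with
  | @isotopy u v y y' hxy hx hy =>
    rw [tangleSumAction_single, tangleSumAction_single, split, split]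
    obtain ⟨m, m', h1, h2, h3⟩ := mem u y v hx
    obtain ⟨k, k', h1', h2', h3'⟩ := mem u y' v hy
    obtain rfl := h1.unique h1'
    rw [transferFront_legMove (hxy.shift c) h2 h2' h3]
  | @skein u v p h₁ h₂ h₃ h₄ =>
    have sub : ∀ a b : TangleSum n, a - b = a + (-1 : CoeffRing) • b := fun a b => by module
    rw [sub, sub]
    simp only [map_add, map_smul, LinearMap.add_apply, LinearMap.smul_apply, Submodule.coe_add,
      Submodule.coe_smul, tangleSumAction_single, split]
    obtain ⟨m, m', h1, h2, h3⟩ := mem u _ v h₁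
    have key := congrArg (transferFront (shift c v)) (transferFront_skein h2.1 h3)
    rw [map_sub, map_smul, map_sub] at key
    simp only [neg_smul, one_smul, ← sub_eq_add_neg]
    exact key
  | @zigzag_down u v p h =>
    rw [tangleSumAction_single, split, map_zero]
    have : shift c [lc p, rc (p + 1)] = [lc (c + p), rc (c + p + 1)] := rfl
    rw [this, transferFront_zigzag_down]
    simp
  | @zigzag_up u v p h =>
    rw [tangleSumAction_single, split, map_zero]
    have : shift c [lc (p + 1), rc p] = [lc (c + p + 1), rc (c + p)] := rfl
    rw [this, transferFront_zigzag_up]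
    simp
  | @unknot u v p h h' =>
    rw [map_smul]
    simp only [LinearMap.smul_apply, Submodule.coe_smul, tangleSumAction_single, split]
    rw [shift_append, transferFront_append, LinearMap.comp_apply, ← map_smul]
    exact congrArg _ (transfer_rc_lc (c + p) _)

/-- The action of the Legendrian BMW algebra on the span of the pairings of `N` strands, in which
tangles are placed below `c` strands. -/
noncomputable def bmwAction (hN : c + n ≤ N) :
    BMW n →ₐ[CoeffRing] Module.End CoeffRing (matchingSpace N) :=
  RingQuot.liftAlgHom CoeffRing ⟨tangleSumAction hN, fun _ _ h => tangleSumAction_rel hN h⟩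

theorem bmwAction_mk (hN : c + n ≤ N) (ξ : TangleSum n) :
    bmwAction hN (BMW.mk n ξ) = tangleSumAction hN ξ :=
  RingQuot.liftAlgHom_mkAlgHom_apply _ _ _ _

theorem bmwAction_ofFront (hN : c + n ≤ N) {w : Front} (h : Runs w n n) (x : matchingSpace N) :
    ((bmwAction hN (BMW.ofFront n w) x : matchingSpace N) : PairingSpace) =
      transferFront (shift c w) x := by
  rw [BMW.ofFront, dif_pos h, bmwAction_mk, tangleSumAction_single]

theorem BMW.extend_mk (n : ℕ) (ξ : TangleSum n) :
    BMW.extend n (BMW.mk n ξ) = BMW.mk (n + 1) (TangleSum.extend n ξ) :=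
  RingQuot.liftAlgHom_mkAlgHom_apply _ _ _ _

theorem bmwAction_extend (hN : c + (n + 1) ≤ N) (y : BMW n) :
    bmwAction hN (BMW.extend n y) = bmwAction (n := n) (c := c) (by omega) y := by
  obtain ⟨ξ, rfl⟩ := RingQuot.mkAlgHom_surjective CoeffRing (BMWRel n) y
  change bmwAction hN (BMW.extend n (BMW.mk n ξ)) = bmwAction _ (BMW.mk n ξ)
  rw [BMW.extend_mk, bmwAction_mk, bmwAction_mk]
  have : (tangleSumAction hN).comp (TangleSum.extend n) =
      tangleSumAction (n := n) (c := c) (N := N) (by omega) := by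
    refine MonoidAlgebra.algHom_ext (fun α => ?_) (by ext)
    change tangleSumAction hN (TangleSum.extend n (single α.front α.runs)) =
      tangleSumAction _ (single α.front α.runs)
    rw [TangleSum.extend_single]
    refine LinearMap.ext fun x => Subtype.ext ?_
    rw [tangleSumAction_single, tangleSumAction_single]
  exact DFunLike.congr_fun this ξ

/-- The element `y` of the BMW algebra acts by the restriction of `T`. -/
def ActsBy (hN : c + n ≤ N) (y : BMW n) (T : PairingSpace →ₗ[CoeffRing] PairingSpace) : Prop :=
  ∀ x : matchingSpace N, ((bmwAction hN y x : matchingSpace N) : PairingSpace) = T x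

namespace ActsBy
variable {hN : c + n ≤ N} {y y' : BMW n} {T T' : PairingSpace →ₗ[CoeffRing] PairingSpace}

theorem one : ActsBy hN (1 : BMW n) LinearMap.id := fun x => by rw [map_one]; rfl

theorem add (h : ActsBy hN y T) (h' : ActsBy hN y' T') : ActsBy hN (y + y') (T + T') := fun x => by
  rw [map_add, LinearMap.add_apply, Submodule.coe_add, h, h']; rfl

theorem smul (r : CoeffRing) (h : ActsBy hN y T) : ActsBy hN (r • y) (r • T) := fun x => by
  rw [map_smul, LinearMap.smul_apply, Submodule.coe_smul, h]; rfl

theorem sub (h : ActsBy hN y T) (h' : ActsBy hN y' T') : ActsBy hN (y - y') (T - T') := by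
  have e : y - y' = y + (-1 : CoeffRing) • y' := by module
  have e' : T - T' = T + (-1 : CoeffRing) • T' := by module
  rw [e, e']
  exact h.add (h'.smul _)

theorem mul (h : ActsBy hN y T) (h' : ActsBy hN y' T') : ActsBy hN (y * y') (T ∘ₗ T') := fun x => by
  rw [map_mul, Module.End.mul_apply, h, h']; rfl

theorem sum {ι : Type*} (s : Finset ι) {y : ι → BMW n}
    {T : ι → PairingSpace →ₗ[CoeffRing] PairingSpace} (h : ∀ i ∈ s, ActsBy hN (y i) (T i)) :
    ActsBy hN (∑ i ∈ s, y i) (∑ i ∈ s, T i) := fun x => by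
  rw [map_sum, LinearMap.sum_apply, Submodule.coe_sum, LinearMap.sum_apply]
  exact Finset.sum_congr rfl fun i hi => h i hi x

theorem sigma {i : ℕ} (hi : 1 ≤ i) (hin : i < n) :
    ActsBy hN (sigma n i) (transfer (cr (c + (i - 1)))) := fun x => by
  rw [LegRuling.sigma, bmwAction_ofFront hN (by simp [Runs, Kind.ins, Kind.outs]; omega)]
  rfl

theorem hook {i : ℕ} (hi : 1 ≤ i) (hin : i < n) :
    ActsBy hN (hook n i) (transfer (lc (c + (i - 1))) ∘ₗ transfer (rc (c + (i - 1)))) := fun x => by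
  rw [LegRuling.hook, bmwAction_ofFront hN (by simp [Runs, Kind.ins, Kind.outs]; omega)]
  rfl

end ActsBy
end Action

/-! ### The action of `L` -/

/-- The sum of the positive permutation braids `β` weighted by `s ^ λ(β)`, as a product of coset
sums; compare `sum_permutationBraid`. -/
noncomputable def symmetrizer : (n : ℕ) → BMW n
  | 0 => 1
  | n + 1 => BMW.extend n (symmetrizer n) * gamma (n + 1)

/-- The pairings of `N` strands in which no two of the `m` strands below the first `c` are
paired. -/
def pure (c m N : ℕ) : Set (Equiv.Perm ℕ) :=
  {ρ | IsMatching N ρ ∧ NoPairIn (Set.Ico c (c + m)) ρ}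

/-- The pairings of `N` strands in which some two of the `m` strands below the first `c` are
paired. -/
def impure (c m N : ℕ) : Set (Equiv.Perm ℕ) :=
  {ρ | IsMatching N ρ ∧ ¬ NoPairIn (Set.Ico c (c + m)) ρ}

/-- The span of the pure pairings. -/
noncomputable abbrev pureSpace (c m N : ℕ) : Submodule CoeffRing PairingSpace :=
  Finsupp.supported CoeffRing CoeffRing (pure c m N)

/-- The span of the impure pairings. -/
noncomputable abbrev impureSpace (c m N : ℕ) : Submodule CoeffRing PairingSpace :=
  Finsupp.supported CoeffRing CoeffRing (impure c m N)

section
variable {c m N : ℕ}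

theorem mem_block_iff {p : ℕ} (h : c ≤ p) (h' : p + 1 < c + m) :
    p ∈ Set.Ico c (c + m) ↔ p + 1 ∈ Set.Ico c (c + m) := by
  rw [Set.mem_Ico, Set.mem_Ico]; omega

theorem transfer_cr_mem_pureSpace {p : ℕ} (hN : c + m ≤ N) (h : c ≤ p) (h' : p + 1 < c + m)
    {x : PairingSpace} (hx : x ∈ pureSpace c m N) : transfer (cr p) x ∈ pureSpace c m N :=
  transfer_mem_supported (S := pure c m N) (S' := pure c m N) (fun _ hρ _ hs =>
    ⟨(hρ.1.step (by simp only [Kind.ins]; omega) hs).of_eq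
      (by simp only [Kind.ins, Kind.outs]; omega),
      (noPairIn_step (mem_block_iff h h') hs).2 hρ.2⟩) hx

theorem transfer_cr_mem_impureSpace {p : ℕ} (hN : c + m ≤ N) (h : c ≤ p) (h' : p + 1 < c + m)
    {x : PairingSpace} (hx : x ∈ impureSpace c m N) : transfer (cr p) x ∈ impureSpace c m N :=
  transfer_mem_supported (S := impure c m N) (S' := impure c m N) (fun _ hρ _ hs =>
    ⟨(hρ.1.step (by simp only [Kind.ins]; omega) hs).of_eq
      (by simp only [Kind.ins, Kind.outs]; omega),
      fun hn => hρ.2 ((noPairIn_step (mem_block_iff h h') hs).1 hn)⟩) hx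

/-- The operator by which `alpha (m + 1) k` acts on the pairings of strands, with `c` strands above
the tangle. -/
noncomputable def alphaOp (c m : ℕ) : ℕ → PairingSpace →ₗ[CoeffRing] PairingSpace
  | 0 => 0
  | 1 => 0
  | 2 => transfer (lc (c + (m - 1))) ∘ₗ transfer (rc (c + (m - 1)))
  | k + 3 =>
      let X := transfer (cr (c + (m + 1 - (k + 2) - 1)))
      X ∘ₗ alphaOp c m (k + 2) ∘ₗ X - (z : CoeffRing) • (X ∘ₗ alphaOp c m (k + 2))
        - (z : CoeffRing) • (alphaOp c m (k + 2) ∘ₗ X) + (z : CoeffRing) ^ 2 • alphaOp c m (k + 2)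

theorem actsBy_alpha (hN : c + (m + 1) ≤ N) {k : ℕ} (hk : 2 ≤ k) (hkm : k ≤ m + 1) :
    ActsBy hN (alpha (m + 1) k) (alphaOp c m k) := by
  match k, hk with
  | 2, _ =>
    exact ActsBy.hook (by omega) (by omega)
  | k + 3, _ =>
    have ih := actsBy_alpha hN (k := k + 2) (by omega) (by omega)
    have hX : ActsBy hN (sigma (m + 1) (m + 1 - (k + 2)))
        (transfer (cr (c + (m + 1 - (k + 2) - 1)))) := ActsBy.sigma (by omega) (by omega)
    exact (((hX.mul ih).mul hX).sub ((hX.mul ih).smul _)).sub ((ih.mul hX).smul _) |>.add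
      (ih.smul _)

/-- `α_{k + 1} = (σ - z) α_k (σ - z)`; here `σ - z` is inverse to `σ` on the pairings in which the
two strands that cross are not paired. -/
theorem alphaOp_succ (c m k : ℕ) (x : PairingSpace) :
    alphaOp c m (k + 3) x = (transfer (cr (c + (m + 1 - (k + 2) - 1))) - (z : CoeffRing) • .id)
      (alphaOp c m (k + 2)
        ((transfer (cr (c + (m + 1 - (k + 2) - 1))) - (z : CoeffRing) • .id) x)) := by
  simp only [alphaOp, LinearMap.sub_apply, LinearMap.add_apply, LinearMap.comp_apply,
    LinearMap.smul_apply, LinearMap.id_apply, map_sub, map_smul]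
  module

theorem alphaOp_two_vec {ρ : Equiv.Perm ℕ} (hρ : IsMatching N ρ) (hm : 1 ≤ m) :
    (z : CoeffRing) • alphaOp c m 2 (vec ρ) = if ρ (c + m) = c + m - 1 then vec ρ else 0 := by
  have e : c + (m - 1) + 1 = c + m := by omega
  have hiff : ρ (c + (m - 1)) = c + (m - 1) + 1 ↔ ρ (c + m) = c + m - 1 := by
    rw [e, hρ.eq_iff]; constructor <;> intro h <;> omega
  simp only [alphaOp, LinearMap.comp_apply]
  split_ifs with h
  · obtain ⟨τ, -, rfl⟩ := hρ.exists_eq_ins (hiff.2 h)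
    rw [transfer_rc_ins, map_smul, transfer_lc, smul_smul, Units.mul_inv, one_smul]
  · rw [transfer_rc_of_ne (fun h' => h (hiff.1 h')), map_zero, smul_zero]

/-- The operators `α_k` preserve the span of the pairings that are impure on the first `m` strands:
the crossings take place among these strands, and the hook maps each pairing to a multiple of
itself. -/
theorem alphaOp_mem_impureSpace (hN : c + (m + 1) ≤ N) {k : ℕ} (hk : 2 ≤ k) (hkm : k ≤ m + 1)
    {x : PairingSpace} (hx : x ∈ impureSpace c m N) :
    (z : CoeffRing) • alphaOp c m k x ∈ impureSpace c m N := by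
  classical
  match k, hk with
  | 2, _ =>
    refine map_mem_of_supported (f := (z : CoeffRing) • alphaOp c m 2) (fun ρ hρ => ?_) hx
    rw [LinearMap.smul_apply, alphaOp_two_vec hρ.1 (by omega)]
    split_ifs
    · exact vec_mem_supported hρ
    · exact Submodule.zero_mem _
  | k + 3, _ =>
    have hX : ∀ {x}, x ∈ impureSpace c m N →
        (transfer (cr (c + (m + 1 - (k + 2) - 1))) - (z : CoeffRing) • .id) x ∈
          impureSpace c m N := fun {x} hx => Submodule.sub_mem _
      (transfer_cr_mem_impureSpace (by omega) (by omega) (by omega) hx) (Submodule.smul_mem _ _ hx)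
    rw [alphaOp_succ, ← map_smul]
    exact hX (alphaOp_mem_impureSpace hN (by omega) (by omega) (hX hx))

/-- Up to pairings that are impure on the first `m` strands, `z • α_k` acts as the projection to
the pairings in which the bottom strand `c + m` is paired with the strand `k - 1` above it. -/
theorem alphaOp_vec (hN : c + (m + 1) ≤ N) {k : ℕ} (hk : 2 ≤ k) (hkm : k ≤ m + 1)
    {ρ : Equiv.Perm ℕ} (hρ : ρ ∈ pure c m N) :
    (z : CoeffRing) • alphaOp c m k (vec ρ) - (if ρ (c + m) + k = c + m + 1 then vec ρ else 0) ∈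
      impureSpace c m N := by
  classical
  match k, hk with
  | 2, _ =>
    rw [alphaOp_two_vec hρ.1 (by omega)]
    have : ρ (c + m) + 2 = c + m + 1 ↔ ρ (c + m) = c + m - 1 := by omega
    simp only [this]
    split_ifs <;> simp
  | k + 3, _ =>
    obtain ⟨i, hi⟩ : ∃ i, i = c + (m + 1 - (k + 2) - 1) := ⟨_, rfl⟩
    have hi1 : i + (k + 3) = c + m + 1 := by omega
    have hpair : ∀ ρ ∈ pure c m N, ρ i ≠ i + 1 := fun ρ hρ e =>
      hρ.2 i (by rw [Set.mem_Ico]; omega) (by rw [e, Set.mem_Ico]; omega)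
    have hc : ∀ ρ ∈ pure c m N, conj i ρ ∈ pure c m N := fun ρ hρ =>
      ⟨hρ.1.conj (by omega), (noPairIn_conj (mem_block_iff (by omega) (by omega))).2 hρ.2⟩
    have hX : ∀ {x}, x ∈ impureSpace c m N →
        (transfer (cr i) - (z : CoeffRing) • .id) x ∈
          impureSpace c m N := fun {x} hx => Submodule.sub_mem _
      (transfer_cr_mem_impureSpace (by omega) (by omega) (by omega) hx) (Submodule.smul_mem _ _ hx)
    have ih : ∀ ρ ∈ pure c m N, (z : CoeffRing) • alphaOp c m (k + 2) (vec ρ) -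
        (if ρ (c + m) + (k + 2) = c + m + 1 then vec ρ else 0) ∈ impureSpace c m N := fun ρ hρ =>
      alphaOp_vec hN (by omega) (by omega) hρ
    -- The companions of the strands `i` and `i + 1` are not among the first `m` strands.
    have out : ∀ q, c ≤ q → q < c + m → ρ q < c ∨ c + m ≤ ρ q := fun q h h' => by
      have := hρ.2 q ⟨h, h'⟩
      rw [Set.mem_Ico] at this
      omega
    have o1 := out i (by omega) (by omega)
    have o2 := out (i + 1) (by omega) (by omega)
    have k1 : ρ i = c + m ↔ ρ (c + m) = i := hρ.1.eq_iff
    have k2 : ρ (i + 1) = c + m ↔ ρ (c + m) = i + 1 := hρ.1.eq_iff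
    have hne := hρ.1.ne (q := c + m) (by omega)
    rw [alphaOp_succ, ← hi, ← map_smul]
    have inv : ∀ τ ∈ pure c m N, NormalAt i τ →
        (transfer (cr i) - (z : CoeffRing) • .id) (vec τ) = vec (conj i τ) := fun τ hτ h => by
      rw [LinearMap.sub_apply, transfer_cr_normal (hpair τ hτ) h]
      exact add_sub_cancel_right _ _
    have inv' : ∀ τ ∈ pure c m N, ¬ NormalAt i τ →
        (transfer (cr i) - (z : CoeffRing) • .id) (vec τ) =
          vec (conj i τ) - (z : CoeffRing) • vec τ := fun τ hτ h => by
      rw [LinearMap.sub_apply, transfer_cr_not_normal hτ.1 (by omega) (hpair τ hτ) h]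
      rfl
    have hcv : conj i ρ (c + m) = Equiv.swap i (i + 1) (ρ (c + m)) :=
      conj_apply_of_ne (by omega) (by omega) ρ
    rw [swap_val] at hcv
    by_cases h : NormalAt i ρ
    · -- The chords of `i` and `i + 1` do not cross, so `i` is not paired with the bottom strand.
      have hnot : ρ (c + m) ≠ i := fun e => by
        unfold NormalAt at h; omega
      rw [if_neg (by omega), sub_zero, inv ρ hρ h]
      have := ih _ (hc ρ hρ)
      rw [if_neg (by split_ifs at hcv <;> omega), sub_zero] at this
      exact hX this
    · have hnot : ρ (c + m) ≠ i + 1 := fun e => by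
        unfold NormalAt at h; omega
      have i1 := ih ρ hρ
      rw [if_neg (by omega), sub_zero] at i1
      have i2 := ih _ (hc ρ hρ)
      rw [inv' ρ hρ h, map_sub (alphaOp c m (k + 2)), map_smul (alphaOp c m (k + 2)), smul_sub,
        map_sub]
      by_cases hr : ρ (c + m) = i
      · rw [if_pos (by rw [if_pos hr] at hcv; omega)] at i2
        rw [if_pos (by omega)]
        have e := inv _ (hc ρ hρ) ((normalAt_conj hρ.1 (by omega) (hpair ρ hρ)).2 h)
        rw [conj_conj] at e
        have i3 := hX i2
        rw [map_sub, e] at i3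
        have i4 := (impureSpace c m N).smul_mem (z : CoeffRing) (hX i1)
        convert (impureSpace c m N).sub_mem i3 i4 using 1
        simp only [map_smul]
        abel
      · rw [if_neg (by rw [if_neg hr] at hcv; split_ifs at hcv <;> omega), sub_zero] at i2
        rw [if_neg (by omega), sub_zero]
        have i4 := (impureSpace c m N).smul_mem (z : CoeffRing) (hX i1)
        convert (impureSpace c m N).sub_mem (hX i2) i4 using 1
        simp only [map_smul]

/-- The operator by which `1 - z ∑ α_k` acts. -/
noncomputable def projOp (c m : ℕ) : PairingSpace →ₗ[CoeffRing] PairingSpace :=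
  .id - (z : CoeffRing) • ∑ k ∈ Finset.Icc 2 (m + 1), alphaOp c m k

theorem actsBy_proj (hN : c + (m + 1) ≤ N) :
    ActsBy hN (1 - (z : CoeffRing) • ∑ k ∈ Finset.Icc 2 (m + 1), alpha (m + 1) k)
      (projOp c m) :=
  ActsBy.one.sub ((ActsBy.sum _ fun k hk => by
    rw [Finset.mem_Icc] at hk
    exact actsBy_alpha hN hk.1 hk.2).smul _)

theorem projOp_apply (c m : ℕ) (x : PairingSpace) : projOp c m x =
    x - ∑ k ∈ Finset.Icc 2 (m + 1), (z : CoeffRing) • alphaOp c m k x := by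
  simp [projOp, Finset.smul_sum]

theorem projOp_mem_impureSpace (hN : c + (m + 1) ≤ N) {x : PairingSpace}
    (hx : x ∈ impureSpace c m N) : projOp c m x ∈ impureSpace c m N := by
  rw [projOp_apply]
  refine Submodule.sub_mem _ hx (Submodule.sum_mem _ fun k hk => ?_)
  rw [Finset.mem_Icc] at hk
  exact alphaOp_mem_impureSpace hN hk.1 hk.2 hx

open Classical in
/-- Modulo the pairings that are impure on the first `m` strands, `1 - z ∑ α_k` is the projection to
the pairings that are pure on `m + 1` strands. -/
theorem projOp_vec (hN : c + (m + 1) ≤ N) {ρ : Equiv.Perm ℕ} (hρ : ρ ∈ pure c m N) :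
    projOp c m (vec ρ) - (if ρ ∈ pure c (m + 1) N then vec ρ else 0) ∈ impureSpace c m N := by
  classical
  have key : ∑ k ∈ Finset.Icc 2 (m + 1), (if ρ (c + m) + k = c + m + 1 then vec ρ else 0) =
      vec ρ - (if ρ ∈ pure c (m + 1) N then vec ρ else 0) := by
    have hne := hρ.1.ne (q := c + m) (by omega)
    split_ifs with h
    · rw [sub_self]
      refine Finset.sum_eq_zero fun k hk => if_neg fun e => ?_
      rw [Finset.mem_Icc] at hk
      exact h.2 (c + m) (by rw [Set.mem_Ico]; omega) (by rw [Set.mem_Ico]; omega)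
    · have hr : c ≤ ρ (c + m) ∧ ρ (c + m) < c + m := by
        by_contra hr
        refine h ⟨hρ.1, fun q hq hq' => ?_⟩
        rw [Set.mem_Ico] at hq hq'
        have k1 : ρ q = c + m ↔ ρ (c + m) = q := hρ.1.eq_iff
        by_cases e : q = c + m
        · subst e; omega
        · exact hρ.2 q (by rw [Set.mem_Ico]; omega) (by rw [Set.mem_Ico]; omega)
      rw [sub_zero, Finset.sum_eq_single (c + m + 1 - ρ (c + m))]
      · rw [if_pos (by omega)]
      · intro k _ hk
        exact if_neg (by omega)
      · intro hk
        rw [Finset.mem_Icc] at hk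
        omega
  have : projOp c m (vec ρ) - (if ρ ∈ pure c (m + 1) N then vec ρ else 0) =
      - ∑ k ∈ Finset.Icc 2 (m + 1), ((z : CoeffRing) • alphaOp c m k (vec ρ) -
        (if ρ (c + m) + k = c + m + 1 then vec ρ else 0)) := by
    rw [Finset.sum_sub_distrib, key, projOp_apply]
    abel
  rw [this]
  refine Submodule.neg_mem _ (Submodule.sum_mem _ fun k hk => ?_)
  rw [Finset.mem_Icc] at hk
  exact alphaOp_vec hN hk.1 hk.2 hρ

theorem pure_succ_subset : pure c (m + 1) N ⊆ pure c m N := fun ρ hρ =>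
  ⟨hρ.1, fun q hq hq' => hρ.2 q (by rw [Set.mem_Ico] at *; omega) (by rw [Set.mem_Ico] at *; omega)⟩

theorem projOp_pureSpace (hN : c + (m + 1) ≤ N) {x : PairingSpace}
    (hx : x ∈ pureSpace c (m + 1) N) : projOp c m x - x ∈ impureSpace c m N := by
  classical
  refine map_mem_of_supported (f := projOp c m - .id) (fun ρ hρ => ?_) hx
  have := projOp_vec hN (pure_succ_subset hρ)
  rwa [if_pos hρ] at this

theorem projOp_impureSpace (hN : c + (m + 1) ≤ N) {x : PairingSpace}
    (hx : x ∈ impureSpace c (m + 1) N) : projOp c m x ∈ impureSpace c m N := by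
  classical
  refine map_mem_of_supported (fun ρ hρ => ?_) hx
  by_cases h : NoPairIn (Set.Ico c (c + m)) ρ
  · have := projOp_vec hN (ρ := ρ) ⟨hρ.1, h⟩
    rwa [if_neg (fun h => hρ.2 h.2), sub_zero] at this
  · exact projOp_mem_impureSpace hN (vec_mem_supported ⟨hρ.1, h⟩)

/-- A submodule preserved by the crossings of an `n`-tangle is preserved by `γ_n`. -/
theorem bmwAction_gamma_mem (hN : c + m ≤ N) {U : Submodule CoeffRing PairingSpace}
    (hU : ∀ p, c ≤ p → p + 1 < c + m → ∀ x ∈ U, transfer (cr p) x ∈ U) {x : matchingSpace N}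
    (hx : (x : PairingSpace) ∈ U) :
    ((bmwAction hN (gamma m) x : matchingSpace N) : PairingSpace) ∈ U := by
  have prod : ∀ l : List ℕ, (∀ i ∈ l, 1 ≤ i ∧ i < m) →
      ((bmwAction hN (l.map (sigma m)).prod x : matchingSpace N) : PairingSpace) ∈ U := by
    intro l hl
    induction l with
    | nil => rw [List.map_nil, List.prod_nil, map_one]; exact hx
    | cons i l ih =>
      have h1 := hl i (by simp)
      rw [List.map_cons, List.prod_cons, map_mul, Module.End.mul_apply,
        ActsBy.sigma (hN := hN) h1.1 h1.2]
      exact hU _ (by omega) (by omega) _ (ih fun j hj => hl j (by simp [hj]))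
  rw [gamma, map_add, map_one, map_sum, LinearMap.add_apply, LinearMap.sum_apply,
    Submodule.coe_add, Submodule.coe_sum]
  refine U.add_mem hx (U.sum_mem fun j hj => ?_)
  rw [Finset.mem_Icc] at hj
  rw [map_smul, LinearMap.smul_apply, Submodule.coe_smul]
  refine U.smul_mem _ ?_
  have := prod ((List.range j).map fun i => m - 1 - i) (fun i hi => by
    rw [List.mem_map] at hi
    obtain ⟨t, ht, rfl⟩ := hi
    rw [List.mem_range] at ht
    omega)
  rwa [List.map_map] at this

/-- `L` kills the pairings in which two strands of the tangle are paired, and acts on all other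
pairings as the symmetrizer. -/
theorem bmwAction_L (hm : 1 ≤ m) (hN : c + m ≤ N) (x : matchingSpace N) :
    ((x : PairingSpace) ∈ impureSpace c m N → bmwAction hN (L m) x = 0) ∧
    ((x : PairingSpace) ∈ pureSpace c m N →
      bmwAction hN (L m) x = bmwAction hN (symmetrizer m) x) := by
  induction m, hm using Nat.le_induction generalizing x with
  | base =>
    have e : symmetrizer 1 = 1 := by
      simp [symmetrizer, gamma]
    refine ⟨fun hx => ?_, fun _ => by rw [e, L]⟩
    have : impure c 1 N = ∅ := by
      rw [Set.eq_empty_iff_forall_notMem]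
      rintro ρ ⟨h1, h2⟩
      refine h2 fun q hq hq' => h1.ne (q := q) ?_ ?_
      · rw [Set.mem_Ico] at hq; omega
      · rw [Set.mem_Ico] at hq hq'; omega
    rw [impureSpace, this, Finsupp.supported_empty, Submodule.mem_bot] at hx
    have : x = 0 := Subtype.ext hx
    rw [this, map_zero]
  | succ m hm ih =>
    obtain ⟨m, rfl⟩ : ∃ k, m = k + 1 := ⟨m - 1, by omega⟩
    rw [L, betaFactor, symmetrizer, map_mul, map_mul, map_mul, Module.End.mul_apply,
      Module.End.mul_apply, Module.End.mul_apply, bmwAction_extend, bmwAction_extend]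
    set y := bmwAction hN (gamma (m + 1 + 1)) x with hy
    have hQ : ((bmwAction hN (1 - (z : CoeffRing) • ∑ k ∈ Finset.Icc 2 (m + 1 + 1),
        alpha (m + 1 + 1) k) y : matchingSpace N) : PairingSpace) = projOp c (m + 1) y :=
      actsBy_proj hN y
    constructor
    · intro hx
      refine (ih (by omega) _).1 ?_
      rw [hQ]
      refine projOp_impureSpace hN (bmwAction_gamma_mem hN (fun p h h' x hx => ?_) hx)
      exact transfer_cr_mem_impureSpace hN h h' hx
    · intro hx
      have hy' : (y : PairingSpace) ∈ pureSpace c (m + 1 + 1) N :=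
        bmwAction_gamma_mem hN (fun p h h' x hx => transfer_cr_mem_pureSpace hN h h' hx) hx
      have hd := projOp_pureSpace hN hy'
      let d : matchingSpace N := ⟨_, Finsupp.supported_mono (fun _ h => h.1) hd⟩
      have hyd : bmwAction hN (1 - (z : CoeffRing) • ∑ k ∈ Finset.Icc 2 (m + 1 + 1),
          alpha (m + 1 + 1) k) y = y + d := Subtype.ext (by
        rw [hQ, Submodule.coe_add]
        exact (add_sub_cancel _ _).symm)
      rw [hyd, map_add, (ih (by omega) d).1 hd, add_zero]
      exact (ih (by omega) y).2 (Finsupp.supported_mono pure_succ_subset hy')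

end

/-! ### The sum of the positive permutation braids in the BMW algebra -/

section
variable {n : ℕ}

theorem runs_cr {p : ℕ} (h : p + 2 ≤ n) {w : Front} (hw : Runs w n n) : Runs (cr p :: w) n n := by
  refine ⟨h, ?_⟩
  have : n - 2 + 2 = n := by omega
  simpa [Kind.ins, Kind.outs, this] using hw

theorem runs_cr_iff {p : ℕ} {w : Front} : Runs (cr p :: w) n n ↔ p + 2 ≤ n ∧ Runs w n n := by
  refine ⟨fun h => ⟨h.1, ?_⟩, fun h => runs_cr h.1 h.2⟩
  have h1 : p + 2 ≤ n := h.1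
  have h2 := h.2
  have : n - 2 + 2 = n := by omega
  simpa [Kind.ins, Kind.outs, this] using h2

theorem runs_nil (n : ℕ) : Runs [] n n := rfl

theorem single_append {u v : Front} (hu : Runs u n n) (hv : Runs v n n) (h : Runs (u ++ v) n n) :
    single (u ++ v) h = single v hv * single u hu := by
  unfold single
  rw [← map_mul]
  rfl

theorem sigma_eq {p : ℕ} (h : p + 2 ≤ n) :
    sigma n (p + 1) = BMW.mk n (single [cr p] (runs_cr h (runs_nil n))) := by
  rw [sigma, BMW.ofFront]
  exact dif_pos (runs_cr h (runs_nil n))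

/-- The element of the BMW algebra represented by a front all of whose singularities are
crossings. -/
noncomputable def crossingProd (n : ℕ) : Front → BMW n
  | [] => 1
  | e :: w => crossingProd n w * sigma n (e.pos + 1)

theorem mk_single_eq_crossingProd {w : Front} (hc : ∀ e ∈ w, e.kind = .crossing)
    (h : Runs w n n) : BMW.mk n (single w h) = crossingProd n w := by
  induction w with
  | nil => exact map_one _
  | cons e w ih =>
    obtain ⟨k, p⟩ := e
    obtain rfl : k = .crossing := hc ⟨k, p⟩ (by simp)
    have h' := runs_cr_iff.1 h
    rw [crossingProd, ← ih (fun e he => hc e (by simp [he])) h'.2, sigma_eq h'.1, ← map_mul,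
      ← single_append (u := [cr p]) (runs_cr h'.1 (runs_nil n)) h'.2 h]
    rfl

theorem crossingProd_eq_of_legMove {x y : Front} (hxy : LegMove x y)
    (hx : ∀ e ∈ x, e.kind = .crossing) (hy : ∀ e ∈ y, e.kind = .crossing)
    (hx' : Runs x n n) (hy' : Runs y n n) : crossingProd n x = crossingProd n y := by
  have hx'' : Runs ([] ++ x ++ []) n n := by simpa using hx'
  have hy'' : Runs ([] ++ y ++ []) n n := by simpa using hy'
  have := RingQuot.mkAlgHom_rel CoeffRing (BMWRel.isotopy hxy hx'' hy'')
  change BMW.mk n _ = BMW.mk n _ at this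
  rw [mk_single_eq_crossingProd (by simpa using hx),
    mk_single_eq_crossingProd (by simpa using hy)] at this
  simpa using this

theorem sigma_comm {i j : ℕ} (hi : 1 ≤ i) (hij : i + 2 ≤ j) (hj : j < n) :
    sigma n j * sigma n i = sigma n i * sigma n j := by
  obtain ⟨p, rfl⟩ : ∃ p, i = p + 1 := ⟨i - 1, by omega⟩
  obtain ⟨r, rfl⟩ : ∃ r, j = p + 2 + r + 1 := ⟨j - p - 3, by omega⟩
  have := crossingProd_eq_of_legMove (n := n) (.exchange .crossing .crossing p r) (by simp)
    (by simp) (runs_cr (by omega) (runs_cr (by simp [Kind.outs]; omega) (runs_nil n)))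
    (runs_cr (by simp [Kind.ins]; omega) (runs_cr (by omega) (runs_nil n)))
  simpa [crossingProd, Kind.ins, Kind.outs] using this

theorem sigma_braid {i : ℕ} (hi : 1 ≤ i) (hin : i + 1 < n) :
    sigma n i * sigma n (i + 1) * sigma n i = sigma n (i + 1) * sigma n i * sigma n (i + 1) := by
  obtain ⟨p, rfl⟩ : ∃ p, i = p + 1 := ⟨i - 1, by omega⟩
  have := crossingProd_eq_of_legMove (n := n) (.three p) (by simp) (by simp)
    (runs_cr (by omega) (runs_cr (by omega) (runs_cr (by omega) (runs_nil n))))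
    (runs_cr (by omega) (runs_cr (by omega) (runs_cr (by omega) (runs_nil n))))
  simpa [crossingProd] using this

theorem extend_sigma {i : ℕ} (hi : 1 ≤ i) (hin : i < n) :
    BMW.extend n (sigma n i) = sigma (n + 1) i := by
  obtain ⟨p, rfl⟩ : ∃ p, i = p + 1 := ⟨i - 1, by omega⟩
  rw [sigma_eq (by omega), sigma_eq (by omega), BMW.extend_mk, TangleSum.extend_single]

/-- The braid `σ_n ⋯ σ_{i + 1}` that moves the strand numbered `i` to the bottom of `n + 1`
strands. -/
noncomputable def toBottom (n i : ℕ) : BMW (n + 1) :=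
  ((List.range (n - i)).map fun t => sigma (n + 1) (n - t)).prod

theorem toBottom_self (n : ℕ) : toBottom n n = 1 := by simp [toBottom]

theorem toBottom_eq {i : ℕ} (hi : i < n) :
    toBottom n i = toBottom n (i + 1) * sigma (n + 1) (i + 1) := by
  have e : n - i = n - (i + 1) + 1 := by omega
  have e' : n - (n - (i + 1)) = i + 1 := by omega
  rw [toBottom, toBottom, e, List.range_succ, List.map_append, List.prod_append]
  simp [e']

theorem toBottom_comm {j : ℕ} (hj : 1 ≤ j) {i : ℕ} (hi : j < i) (hin : i ≤ n) :
    toBottom n i * sigma (n + 1) j = sigma (n + 1) j * toBottom n i := by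
  induction hin using Nat.decreasingInduction with
  | self => simp [toBottom_self]
  | of_succ i hin ih =>
    rw [toBottom_eq (by omega), mul_assoc, sigma_comm hj (by omega) (by omega), ← mul_assoc,
      ih (by omega), mul_assoc]

theorem toBottom_shift {j i : ℕ} (hij : i < j) (hj : j < n) :
    toBottom n i * sigma (n + 1) (j + 1) = sigma (n + 1) j * toBottom n i := by
  have hin : i ≤ n := by omega
  induction hin using Nat.decreasingInduction with
  | self => omega
  | of_succ i hin ih =>
    rw [toBottom_eq (by omega)]
    by_cases h : i + 1 = j
    · subst h
      have e := sigma_braid (n := n + 1) (i := i + 1) (by omega) (by omega)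
      rw [toBottom_eq (by omega)]
      calc _ = toBottom n (i + 1 + 1) * (sigma (n + 1) (i + 1 + 1) * sigma (n + 1) (i + 1) *
            sigma (n + 1) (i + 1 + 1)) := by simp only [mul_assoc]
        _ = (toBottom n (i + 1 + 1) * sigma (n + 1) (i + 1)) * sigma (n + 1) (i + 1 + 1) *
            sigma (n + 1) (i + 1) := by rw [← e]; simp only [mul_assoc]
        _ = _ := by rw [toBottom_comm (by omega) (by omega) (by omega)]; simp only [mul_assoc]
    · rw [mul_assoc, ← sigma_comm (by omega) (by omega) (by omega), ← mul_assoc, ih (by omega),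
        mul_assoc]

/-- The numbering of the other strands when a strand with number `i` is inserted. -/
def succAboveNat (i k : ℕ) : ℕ := if k < i then k else k + 1

theorem crossingsBetween_cons (p : ℕ) (w : Front) (i j : ℕ) :
    crossingsBetween (cr p :: w) i j =
      (if (i = p ∧ j = p + 1) ∨ (j = p ∧ i = p + 1) then 1 else 0) +
        crossingsBetween w (Equiv.swap p (p + 1) i) (Equiv.swap p (p + 1) j) := rfl

theorem crossingsBetween_comm (w : Front) (i j : ℕ) :
    crossingsBetween w i j = crossingsBetween w j i := by
  induction w generalizing i j with
  | nil => rfl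
  | cons e w ih => simp only [crossingsBetween]; rw [ih, if_congr or_comm rfl rfl]

/-- In a front of crossings in which any two strands cross at most once, the strand that ends at the
bottom can be moved to the bottom before all other crossings take place. -/
theorem exists_delete_strand (w : Front) (hc : ∀ e ∈ w, e.kind = .crossing)
    (hw : Runs w (n + 1) (n + 1)) (i : ℕ) (hi : i ≤ n) (hf : follow w i = n)
    (hlt : ∀ j < i, crossingsBetween w j i = 0)
    (hgt : ∀ j ≤ n, i < j → crossingsBetween w j i ≤ 1) :
    ∃ w' : Front, (∀ e ∈ w', e.kind = .crossing) ∧ Runs w' n n ∧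
      w.length = w'.length + (n - i) ∧
      crossingProd (n + 1) w = BMW.extend n (crossingProd n w') * toBottom n i ∧
      (∀ k < n, follow w' k = follow w (succAboveNat i k)) ∧
      ∀ k l, k < n → l < n →
        crossingsBetween w' k l = crossingsBetween w (succAboveNat i k) (succAboveNat i l) := by
  induction w generalizing i with
  | nil =>
    simp only [follow] at hf
    subst hf
    refine ⟨[], by simp, rfl, by simp, ?_, fun k hk => ?_, fun _ _ _ _ => rfl⟩
    · simp [crossingProd, toBottom_self]
    · simp [follow, succAboveNat, hk]
  | cons e w ih =>
    obtain ⟨k, p⟩ := e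
    obtain rfl : k = .crossing := hc ⟨k, p⟩ (by simp)
    replace hc : ∀ e ∈ w, e.kind = .crossing := fun e he => hc e (by simp [he])
    obtain ⟨hp, hw'⟩ := runs_cr_iff.1 hw
    simp only [follow] at hf
    -- Strands other than the ones that cross at `p` keep their numbers.
    have sw : ∀ {x}, x ≠ p → x ≠ p + 1 → Equiv.swap p (p + 1) x = x :=
      fun h h' => Equiv.swap_apply_of_ne_of_ne h h'
    by_cases hip : i = p + 1
    · have := hlt p (by omega)
      simp [crossingsBetween, hip] at this
    by_cases hip' : i = p
    · subst hip'
      rw [Equiv.swap_apply_left] at hf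
      have hcross := hgt (i + 1) (by omega) (by omega)
      rw [crossingsBetween_cons, if_pos (by simp), Equiv.swap_apply_left,
        Equiv.swap_apply_right] at hcross
      obtain ⟨w', h1, h2, h3, h4, h5, h6⟩ := ih hc hw' (i + 1) (by omega) hf (fun j hj => by
          by_cases hji : j = i
          · subst hji; omega
          · have := hlt j (by omega)
            rw [crossingsBetween_cons, Equiv.swap_apply_left, sw (by omega) (by omega)] at this
            omega) (fun j hj hij => by
          have := hgt j hj (by omega)
          rw [crossingsBetween_cons, Equiv.swap_apply_left, sw (by omega) (by omega)] at this
          omega)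
      have hs : ∀ k, Equiv.swap i (i + 1) (succAboveNat i k) = succAboveNat (i + 1) k := fun k => by
        rw [swap_val]; unfold succAboveNat; split_ifs <;> omega
      refine ⟨w', h1, h2, ?_, ?_, fun k hk => ?_, fun k l hk hl => ?_⟩
      · have : n - i = n - (i + 1) + 1 := by omega
        rw [List.length_cons, h3, this, add_assoc]
      · rw [crossingProd, h4, toBottom_eq (i := i) (by omega), mul_assoc]
      · rw [h5 k hk, follow, hs]
      · rw [h6 k l hk hl, crossingsBetween_cons, hs, hs, if_neg, zero_add]
        unfold succAboveNat; split_ifs <;> omega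
    · rw [sw hip' hip] at hf
      obtain ⟨w', h1, h2, h3, h4, h5, h6⟩ := ih hc hw' i hi hf (fun j hj => by
          have := hlt (Equiv.swap p (p + 1) j) (by rw [swap_val]; split_ifs <;> omega)
          rw [crossingsBetween_cons, Equiv.swap_apply_self, sw hip' hip] at this
          omega) (fun j hj hij => by
          have := hgt (Equiv.swap p (p + 1) j) (by rw [swap_val]; split_ifs <;> omega)
            (by rw [swap_val]; split_ifs <;> omega)
          rw [crossingsBetween_cons, Equiv.swap_apply_self, sw hip' hip] at this
          omega)
      -- The position of the crossing after the deletion of the strand `i`.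
      obtain ⟨p', hp', hp2, hcomm⟩ : ∃ p', (p' = if p < i then p else p - 1) ∧ p' + 2 ≤ n ∧
          toBottom n i * sigma (n + 1) (p + 1) = sigma (n + 1) (p' + 1) * toBottom n i := by
        refine ⟨_, rfl, ?_, ?_⟩
        · split_ifs <;> omega
        · split_ifs with h
          · exact toBottom_comm (by omega) (by omega) hi
          · have : p - 1 + 1 = p := by omega
            rw [this]
            exact toBottom_shift (by omega) (by omega)
      have hs : ∀ k, Equiv.swap p (p + 1) (succAboveNat i k) =
          succAboveNat i (Equiv.swap p' (p' + 1) k) := fun k => by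
        simp only [swap_val]; unfold succAboveNat; split_ifs at hp' ⊢ <;> omega
      have hsn : ∀ k < n, Equiv.swap p' (p' + 1) k < n := fun k hk => by
        rw [swap_val]; split_ifs <;> omega
      refine ⟨cr p' :: w', ?_, runs_cr hp2 h2, ?_, ?_, fun k hk => ?_, fun k l hk hl => ?_⟩
      · intro e he
        rcases List.mem_cons.1 he with rfl | he
        · rfl
        · exact h1 e he
      · rw [List.length_cons, List.length_cons, h3, add_right_comm]
      · rw [crossingProd, crossingProd, h4, map_mul,
          extend_sigma (by omega) (by change p' + 1 < n; omega), mul_assoc, mul_assoc, hcomm]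
      · rw [follow, follow, h5 _ (hsn k hk), hs]
      · rw [crossingsBetween_cons, crossingsBetween_cons, h6 _ _ (hsn k hk) (hsn l hl), hs, hs]
        congr 1
        refine if_congr ?_ rfl rfl
        unfold succAboveNat
        split_ifs at hp' ⊢ <;> omega

theorem gamma_succ (n : ℕ) :
    gamma (n + 1) = ∑ i : Fin (n + 1), (s : CoeffRing) ^ (n - (i : ℕ)) • toBottom n i := by
  have e : Finset.range (n + 1) = insert 0 (Finset.Icc 1 n) := by
    ext j; simp only [Finset.mem_range, Finset.mem_insert, Finset.mem_Icc]; omega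
  rw [Fin.sum_univ_eq_sum_range (fun i => (s : CoeffRing) ^ (n - i) • toBottom n i),
    ← Finset.sum_range_reflect, e, Finset.sum_insert (by simp), gamma]
  congr 1
  · simp [toBottom_self]
  · refine Finset.sum_congr rfl fun j hj => ?_
    rw [Finset.mem_Icc] at hj
    have e1 : n + 1 - 1 - j = n - j := by omega
    have e2 : n - (n - j) = j := by omega
    rw [e1, toBottom, e2]
    rfl

/-- The permutation that sends `i` to the last element and is given by `β` on the other elements. -/
def permInsert (i : Fin (n + 1)) (β : Equiv.Perm (Fin n)) : Equiv.Perm (Fin (n + 1)) :=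
  (finSuccEquiv' i).trans ((Equiv.optionCongr β).trans (finSuccEquiv' (Fin.last n)).symm)

theorem permInsert_self (i : Fin (n + 1)) (β : Equiv.Perm (Fin n)) :
    permInsert i β i = Fin.last n := by
  simp [permInsert]

theorem permInsert_succAbove (i : Fin (n + 1)) (β : Equiv.Perm (Fin n)) (k : Fin n) :
    permInsert i β (i.succAbove k) = (β k).castSucc := by
  simp [permInsert]

theorem permInsert_bijective :
    Function.Bijective fun x : Fin (n + 1) × Equiv.Perm (Fin n) => permInsert x.1 x.2 := by
  rw [Fintype.bijective_iff_injective_and_card]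
  refine ⟨?_, ?_⟩
  · rintro ⟨i, β⟩ ⟨i', β'⟩ h
    replace h : permInsert i β = permInsert i' β' := h
    obtain rfl : i = i' := (permInsert i β).injective (by
      rw [permInsert_self, h, permInsert_self])
    have : β = β' := Equiv.ext fun k => Fin.castSucc_injective n (by
      rw [← permInsert_succAbove i, ← permInsert_succAbove i, h])
    rw [this]
  · rw [Fintype.card_prod, Fintype.card_perm, Fintype.card_perm, Fintype.card_fin,
      Fintype.card_fin, Nat.factorial_succ]

theorem succAbove_val (i : Fin (n + 1)) (k : Fin n) :
    (i.succAbove k : ℕ) = succAboveNat i k := by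
  unfold Fin.succAbove succAboveNat
  simp only [Fin.lt_def, Fin.val_castSucc]
  split_ifs <;> rfl

theorem exists_permutationBraid_delete {i : Fin (n + 1)} {β : Equiv.Perm (Fin n)}
    {b : Tangle (n + 1)} (hb : IsPermutationBraid (permInsert i β) b) :
    ∃ b' : Tangle n, IsPermutationBraid β b' ∧ b.front.length = b'.front.length + (n - i) ∧
      crossingProd (n + 1) b.front =
        BMW.extend n (crossingProd n b'.front) * toBottom n i := by
  have hlast : ∀ j, j ≠ i → permInsert i β j < permInsert i β i := fun j hj => by
    rw [permInsert_self]
    refine lt_of_le_of_ne (Fin.le_last _) fun e => hj ((permInsert i β).injective ?_)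
    rw [e, permInsert_self]
  obtain ⟨w', h1, h2, h3, h4, h5, h6⟩ := exists_delete_strand b.front hb.no_cusps b.runs i
    (Nat.lt_succ_iff.1 i.2) (by rw [hb.endpoints, permInsert_self]; rfl)
    (fun j hj => hb.no_crossing ⟨j, by omega⟩ i hj (hlast _ (by
      intro e; rw [← e] at hj; exact lt_irrefl _ hj)))
    (fun j hj hij => by
      rw [crossingsBetween_comm]
      exact (hb.one_crossing i ⟨j, by omega⟩ hij (hlast _ (by
        intro e; rw [← e] at hij; exact lt_irrefl _ hij))).le)
  refine ⟨⟨w', h2⟩, ⟨h1, fun k => ?_, fun k l hkl hβ => ?_, fun k l hkl hβ => ?_⟩, h3, h4⟩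
  · rw [h5 k k.2, ← succAbove_val, hb.endpoints, permInsert_succAbove]
    rfl
  · rw [h6 k l k.2 l.2, ← succAbove_val, ← succAbove_val]
    refine hb.no_crossing _ _ (Fin.succAbove_lt_succAbove_iff.2 hkl) ?_
    rw [permInsert_succAbove, permInsert_succAbove]
    exact hβ
  · rw [h6 k l k.2 l.2, ← succAbove_val, ← succAbove_val]
    refine hb.one_crossing _ _ (Fin.succAbove_lt_succAbove_iff.2 hkl) ?_
    rw [permInsert_succAbove, permInsert_succAbove]
    exact hβ

/-- The weighted sum of the positive permutation braids does not depend on the choice of their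
fronts. -/
theorem sum_permutationBraid (n : ℕ) (braid : Equiv.Perm (Fin n) → Tangle n)
    (h : ∀ β, IsPermutationBraid β (braid β)) :
    ∑ β, (s : CoeffRing) ^ (braid β).front.length • crossingProd n (braid β).front =
      symmetrizer n := by
  induction n with
  | zero =>
    rw [Fintype.sum_unique]
    generalize hw : (braid default).front = w
    cases w with
    | nil => simp [crossingProd, symmetrizer]
    | cons e w =>
      have h1 := (braid default).runs
      have h2 := (h default).no_cusps
      rw [hw] at h1 h2
      have h3 := h1.1
      rw [h2 e (by simp)] at h3
      simp [Kind.ins] at h3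
  | succ n ih =>
    choose b' hb' hlen hprod using fun x : Fin (n + 1) × Equiv.Perm (Fin n) =>
      exists_permutationBraid_delete (h (permInsert x.1 x.2))
    rw [← permInsert_bijective.sum_comp
      (fun β => (s : CoeffRing) ^ (braid β).front.length • crossingProd (n + 1) (braid β).front),
      Fintype.sum_prod_type, symmetrizer, gamma_succ, Finset.mul_sum]
    refine Finset.sum_congr rfl fun i _ => ?_
    rw [← ih (fun β => b' (i, β)) (fun β => hb' (i, β)), map_sum, Finset.sum_mul]
    refine Finset.sum_congr rfl fun β _ => ?_
    have h1 := hlen (i, β)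
    have h2 := hprod (i, β)
    simp only at h1 h2 ⊢
    rw [h1, h2, map_smul, smul_mul_smul_comm, pow_add]

end

/-! ### Ruling polynomials as matrix entries of transfer operators -/

/-- The product of the weights of the steps of a sequence of pairings. -/
noncomputable def pathWeight : Front → List (Equiv.Perm ℕ) → CoeffRing
  | e :: w, ρ :: ρ' :: l => stepWeight e ρ ρ' * pathWeight w (ρ' :: l)
  | _, _ => 1

theorem pathWeight_eq (w : Front) (l : List (Equiv.Perm ℕ)) (h : IsRulingPath w l) :
    ((z ^ jIndex w l : CoeffRingˣ) : CoeffRing) = pathWeight w l := by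
  classical
  induction w generalizing l with
  | nil =>
    match l, h with
    | [_], _ => simp [jIndex, switches, rightCusps, pathWeight]
  | cons e w ih =>
    match l, h with
    | ρ :: ρ' :: l, h =>
      rw [pathWeight, ← ih _ h.2]
      obtain ⟨k, p⟩ := e
      cases k with
      | crossing =>
        by_cases hs : ρ' = ρ
        · have : jIndex (cr p :: w) (ρ :: ρ' :: l) = 1 + jIndex w (ρ' :: l) := by
            simp [jIndex, switches, rightCusps, hs]; ring
          rw [this, zpow_add, zpow_one, Units.val_mul]
          simp [stepWeight, hs]
        · have : jIndex (cr p :: w) (ρ :: ρ' :: l) = jIndex w (ρ' :: l) := by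
            simp [jIndex, switches, rightCusps, hs]
          rw [this]
          simp [stepWeight, hs]
      | leftCusp =>
        have : jIndex (lc p :: w) (ρ :: ρ' :: l) = jIndex w (ρ' :: l) := by
          simp [jIndex, switches, rightCusps]
        rw [this]
        simp [stepWeight]
      | rightCusp =>
        have : jIndex (rc p :: w) (ρ :: ρ' :: l) = -1 + jIndex w (ρ' :: l) := by
          simp [jIndex, switches, rightCusps]; ring
        rw [this, zpow_add, zpow_neg_one, Units.val_mul]
        simp [stepWeight]

/-- The weighted sum of a function over the ruling paths that start with `ρ`. -/
noncomputable def pathSum (w : Front) (ρ : Equiv.Perm ℕ)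
    (g : List (Equiv.Perm ℕ) → CoeffRing) : CoeffRing :=
  ∑ l ∈ (rulingPath_finite w ρ).toFinset, pathWeight w (ρ :: l) * g (ρ :: l)

theorem pathSum_nil (ρ : Equiv.Perm ℕ) (g : List (Equiv.Perm ℕ) → CoeffRing) :
    pathSum [] ρ g = g [ρ] := by
  have : (rulingPath_finite [] ρ).toFinset = {[]} := by
    ext l
    cases l <;> simp [IsRulingPath]
  rw [pathSum, this, Finset.sum_singleton, pathWeight, one_mul]
  simp

theorem pathSum_cons (e : Event) (w : Front) (ρ : Equiv.Perm ℕ)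
    (g : List (Equiv.Perm ℕ) → CoeffRing) :
    pathSum (e :: w) ρ g = ∑ ρ' ∈ (step_finite e ρ).toFinset,
      stepWeight e ρ ρ' * pathSum w ρ' fun l => g (ρ :: l) := by
  simp only [pathSum, Finset.mul_sum]
  rw [Finset.sum_sigma']
  symm
  refine Finset.sum_bij' (fun x _ => x.1 :: x.2)
    (fun l _ => (⟨l.headD 1, l.tail⟩ : Σ _ : Equiv.Perm ℕ, List (Equiv.Perm ℕ))) ?_ ?_ ?_ ?_ ?_
  · rintro ⟨ρ', l⟩ h
    simpa [IsRulingPath] using h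
  · intro l h
    cases l with
    | nil => simp [IsRulingPath] at h
    | cons ρ' l => simpa [IsRulingPath] using h
  · intros; rfl
  · intro l h
    cases l with
    | nil => simp [IsRulingPath] at h
    | cons ρ' l => rfl
  · rintro ⟨ρ', l⟩ h
    simp only [pathWeight, mul_assoc]

theorem transferFront_filter_apply (u v : Front) (Q : Equiv.Perm ℕ → Prop) [DecidablePred Q]
    (ρ τ : Equiv.Perm ℕ) : transferFront v ((transferFront u (vec ρ)).filter Q) τ =
      pathSum (u ++ v) ρ fun l => haveI := Classical.propDecidable
        if Q (l.getD u.length 1) ∧ l.getLast? = some τ then 1 else 0 := by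
  classical
  induction u generalizing ρ with
  | nil =>
    have e : (transferFront [] (vec ρ)).filter Q = if Q ρ then vec ρ else 0 := by
      change (vec ρ).filter Q = _
      split_ifs with h
      · exact Finsupp.filter_single_of_pos _ h
      · exact Finsupp.filter_single_of_neg _ h
    have last : ∀ (v : Front) (ρ : Equiv.Perm ℕ), transferFront v (vec ρ) τ =
        pathSum v ρ fun l => if l.getLast? = some τ then 1 else 0 := by
      intro v
      induction v with
      | nil =>
        intro ρ
        rw [pathSum_nil]
        simp [transferFront, Finsupp.single_apply]
      | cons e v ih =>
        intro ρ
        rw [pathSum_cons, transferFront, LinearMap.comp_apply, transfer_vec, map_sum,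
          Finsupp.finsetSum_apply]
        refine Finset.sum_congr rfl fun ρ' _ => ?_
        rw [map_smul, Finsupp.smul_apply, ih, smul_eq_mul]
        rfl
    rw [e]
    split_ifs with h
    · rw [last, List.nil_append, pathSum, pathSum]
      refine Finset.sum_congr rfl fun l _ => ?_
      simp [h]
    · rw [map_zero, List.nil_append, pathSum]
      symm
      refine Finset.sum_eq_zero fun l _ => ?_
      simp [h]
  | cons e u ih =>
    rw [List.cons_append, pathSum_cons, transferFront, LinearMap.comp_apply, transfer_vec, map_sum,
      Finsupp.filter_sum, map_sum, Finsupp.finsetSum_apply]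
    refine Finset.sum_congr rfl fun ρ' _ => ?_
    rw [map_smul, Finsupp.filter_smul, map_smul, Finsupp.smul_apply, ih, smul_eq_mul]
    rfl

theorem sum_normalRulings_filter (u v : Front) (Q : Equiv.Perm ℕ → Prop) [DecidablePred Q]
    (R : List (Equiv.Perm ℕ) → Prop) [DecidablePred R]
    (h : ∀ l, IsNormalRuling (u ++ v) l → (R l ↔ Q (l.getD u.length 1))) :
    ∑ l ∈ (normalRulings (u ++ v)).filter R,
      ((z ^ jIndex (u ++ v) l : CoeffRingˣ) : CoeffRing) =
        transferFront v ((transferFront u (vec 1)).filter Q) 1 := by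
  classical
  rw [transferFront_filter_apply, pathSum]
  simp only [mul_ite, mul_one, mul_zero]
  rw [← Finset.sum_filter]
  symm
  refine Finset.sum_bij' (fun l _ => 1 :: l) (fun l _ => l.tail) ?_ ?_ ?_ ?_ ?_
  · intro l hl
    simp only [Finset.mem_filter, Set.Finite.mem_toFinset, Set.mem_ofPred_eq] at hl
    have hn : IsNormalRuling (u ++ v) (1 :: l) := ⟨hl.1, rfl, hl.2.2⟩
    rw [Finset.mem_filter]
    exact ⟨by simpa [normalRulings] using hn, (h _ hn).2 hl.2.1⟩
  · intro l hl
    rw [Finset.mem_filter] at hl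
    have hn : IsNormalRuling (u ++ v) l := by simpa [normalRulings] using hl.1
    have hQ := (h _ hn).1 hl.2
    obtain ⟨h1, h2, h3⟩ := hn
    cases l with
    | nil => simp at h2
    | cons a l =>
      obtain rfl : a = 1 := by simpa using h2
      simp only [Finset.mem_filter, Set.Finite.mem_toFinset, Set.mem_ofPred_eq, List.tail_cons]
      exact ⟨h1, hQ, h3⟩
  · intros; rfl
  · intro l hl
    rw [Finset.mem_filter] at hl
    have hn : IsNormalRuling (u ++ v) l := by simpa [normalRulings] using hl.1
    cases l with
    | nil => simp [IsNormalRuling] at hn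
    | cons a l =>
      obtain rfl : a = 1 := by simpa using hn.2.1
      rfl
  · intro l hl
    simp only [Finset.mem_filter, Set.Finite.mem_toFinset, Set.mem_ofPred_eq] at hl
    rw [pathWeight_eq _ _ hl.1]

theorem rulingPoly_eq (w : Front) : rulingPoly w = transferFront w (vec 1) 1 := by
  have := sum_normalRulings_filter [] w (fun _ => True) (fun _ => True) (fun _ _ => Iff.rfl)
  rw [Finset.filter_true, (Finsupp.filter_eq_self_iff _ _).2 fun _ _ => trivial] at this
  exact this

/-! ### Purity along crossings between two families of parallel strands -/

/-- No two strands with the label `a` are paired. -/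
def PureLabel (a : ℕ) (lab : ℕ → ℕ) (ρ : Equiv.Perm ℕ) : Prop :=
  ∀ q, ρ q ≠ q → lab q = a → lab (ρ q) ≠ a

theorem noParallelPair_iff {lab : ℕ → ℕ} {ρ : Equiv.Perm ℕ} :
    NoParallelPair lab ρ ↔ ∀ a, PureLabel a lab ρ :=
  ⟨fun h _ q hq e e' => h q hq (e'.trans e.symm), fun h q hq e => h _ q hq rfl e⟩

/-- No strand with the label `b` is paired with a strand with the label `a` below it. -/
def NoPairAbove (b a : ℕ) (lab : ℕ → ℕ) (ρ : Equiv.Perm ℕ) : Prop :=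
  ∀ q, q < ρ q → lab q = b → lab (ρ q) ≠ a

/-- Among `N` strands, those with labels `a` or `b` are exactly the ones numbered `lo, …, hi - 1`. -/
structure IsBlock (N lo hi a b : ℕ) (lab : ℕ → ℕ) : Prop where
  le : hi ≤ N
  ne : a ≠ b
  of_mem : ∀ q, lo ≤ q → q < hi → lab q = a ∨ lab q = b
  mem : ∀ q < N, lab q = a ∨ lab q = b → lo ≤ q ∧ q < hi

theorem IsBlock.symm {N lo hi a b : ℕ} {lab : ℕ → ℕ} (h : IsBlock N lo hi a b lab) :
    IsBlock N lo hi b a lab :=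
  ⟨h.le, h.ne.symm, fun q h1 h2 => (h.of_mem q h1 h2).symm, fun q h1 h2 => h.mem q h1 h2.symm⟩

theorem IsBlock.swap {N lo hi a b : ℕ} {lab : ℕ → ℕ} (h : IsBlock N lo hi a b lab) {p : ℕ}
    (h1 : lo ≤ p) (h2 : p + 1 < hi) :
    IsBlock N lo hi a b fun q => lab (Equiv.swap p (p + 1) q) := by
  have hle := h.le
  refine ⟨h.le, h.ne, fun q h3 h4 => h.of_mem _ ?_ ?_, fun q h3 h4 => ?_⟩
  · rw [swap_val]; split_ifs <;> omega
  · rw [swap_val]; split_ifs <;> omega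
  · have := h.mem _ (by rw [swap_val]; split_ifs <;> omega) h4
    rw [swap_val] at this
    split_ifs at this <;> omega

theorem Step.symm_cr {N p : ℕ} {ρ ρ' : Equiv.Perm ℕ} (hρ : IsMatching N ρ)
    (h : Step (cr p) ρ ρ') : Step (cr p) ρ' ρ := by
  obtain ⟨h1, rfl | ⟨rfl, h2⟩⟩ := h
  · refine ⟨?_, Or.inl (conj_conj p ρ).symm⟩
    change conj p ρ p ≠ p + 1
    have : ρ (p + 1) ≠ p := fun e => h1 (hρ.eq_iff.1 e)
    rw [conj_apply_left, swap_val]; split_ifs <;> omega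
  · exact ⟨h1, Or.inr ⟨rfl, h2⟩⟩

theorem IsMatching.step_cr {N p : ℕ} {ρ ρ' : Equiv.Perm ℕ} (hρ : IsMatching N ρ) (hp : p + 2 ≤ N)
    (h : Step (cr p) ρ ρ') : IsMatching N ρ' :=
  (hρ.step hp h).of_eq (by simp only [Kind.ins, Kind.outs]; omega)

theorem pureLabel_swap {p : ℕ} {a : ℕ} {lab : ℕ → ℕ} {ρ : Equiv.Perm ℕ} :
    PureLabel a (fun q => lab (Equiv.swap p (p + 1) q)) (conj p ρ) ↔ PureLabel a lab ρ := by
  have key : ∀ {lab : ℕ → ℕ} {ρ : Equiv.Perm ℕ}, PureLabel a lab ρ →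
      PureLabel a (fun q => lab (Equiv.swap p (p + 1) q)) (conj p ρ) := by
    intro lab ρ h q hq h1 h2
    simp only [conj_apply, Equiv.swap_apply_self] at h2
    refine h _ (fun e => hq ?_) h1 h2
    rw [conj_apply, e, Equiv.swap_apply_self]
  refine ⟨fun h => ?_, key⟩
  have := key h
  simpa using this

/-- Labels that do not occur at a crossing are not affected by it. -/
theorem pureLabel_step_of_ne {p : ℕ} {a : ℕ} {lab : ℕ → ℕ} {ρ ρ' : Equiv.Perm ℕ}
    (hs : Step (cr p) ρ ρ') (h : lab p ≠ a) (h' : lab (p + 1) ≠ a) :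
    PureLabel a (fun q => lab (Equiv.swap p (p + 1) q)) ρ' ↔ PureLabel a lab ρ := by
  obtain ⟨-, rfl | ⟨rfl, -⟩⟩ := hs
  · exact pureLabel_swap
  · have : ∀ q, lab (Equiv.swap p (p + 1) q) = a ↔ lab q = a := fun q => by
      rw [swap_val]
      split_ifs with e e'
      · subst e; exact iff_of_false h' h
      · subst e'; exact iff_of_false h h'
      · rfl
    unfold PureLabel
    simp only [Ne, this]

/-- Consider a crossing of a strand labelled `a` with a strand labelled `b` below it.  If no pair has
two labels `X`, and no strand labelled `b` is paired with a strand labelled `a` below it, then the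
same holds after the crossing: the chord that a switch would need in order to create such a pair
would have to end on a strand excluded by the assumptions, because all strands of the block are
labelled `a` or `b` and switching chords do not cross. -/
theorem pureLabel_step {N lo hi a b X p : ℕ} {lab : ℕ → ℕ} {ρ ρ' : Equiv.Perm ℕ}
    (hb : IsBlock N lo hi a b lab) (hρ : IsMatching N ρ) (h1 : lo ≤ p) (h2 : p + 1 < hi)
    (ha : lab p = a) (hb' : lab (p + 1) = b) (hs : Step (cr p) ρ ρ') (hX : X = a ∨ X = b)
    (hpure : PureLabel X lab ρ) (habove : NoPairAbove b a lab ρ) :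
    PureLabel X (fun q => lab (Equiv.swap p (p + 1) q)) ρ' ∧
      NoPairAbove b a (fun q => lab (Equiv.swap p (p + 1) q)) ρ' := by
  have hle := hb.le
  have hne := hb.ne
  have hnp := hρ.ne (q := p) (by omega)
  have hnp' := hρ.ne (q := p + 1) (by omega)
  have hxN := hρ.lt (q := p) (by omega)
  have hyN := hρ.lt (q := p + 1) (by omega)
  obtain ⟨hn, rfl | ⟨rfl, hnorm⟩⟩ := hs
  · refine ⟨pureLabel_swap.2 hpure, fun q hq e e' => ?_⟩
    change q < conj p ρ q at hq
    change lab (Equiv.swap p (p + 1) (conj p ρ q)) = a at e'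
    rw [conj_apply] at hq
    rw [conj_apply, Equiv.swap_apply_self] at e'
    simp only at hn
    have hn' : ρ (p + 1) ≠ p := fun e => hn (hρ.eq_iff.1 e)
    -- The two strands that cross are not paired, so the order of paired strands does not change.
    have hlt : Equiv.swap p (p + 1) q < ρ (Equiv.swap p (p + 1) q) := by
      by_cases hq1 : q = p
      · subst hq1
        rw [Equiv.swap_apply_left] at hq ⊢
        rw [swap_val] at hq
        split_ifs at hq <;> omega
      by_cases hq2 : q = p + 1
      · subst hq2
        rw [Equiv.swap_apply_right] at hq ⊢
        rw [swap_val] at hq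
        split_ifs at hq <;> omega
      rw [Equiv.swap_apply_of_ne_of_ne hq1 hq2] at hq ⊢
      rw [swap_val] at hq
      split_ifs at hq <;> omega
    exact habove _ hlt e e'
  · obtain ⟨x, hx⟩ : ∃ x, x = ρ' p := ⟨_, rfl⟩
    obtain ⟨y, hy⟩ : ∃ y, y = ρ' (p + 1) := ⟨_, rfl⟩
    have hx' : ρ' x = p := hρ.eq_iff.1 hx.symm
    have hy' : ρ' y = p + 1 := hρ.eq_iff.1 hy.symm
    simp only at hn hnorm
    have hn' : y ≠ p := fun e => hn (hρ.eq_iff.1 (hy ▸ e))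
    unfold NormalAt at hnorm
    rw [← hx] at hnp hxN hn hnorm
    rw [← hy] at hnp' hyN hnorm
    have cx := hb.of_mem x
    have cy := hb.of_mem y
    have mx := hb.mem x hxN
    have my := hb.mem y hyN
    have px := hpure p (by omega)
    have py := hpure (p + 1) (by omega)
    have ax := habove x
    have ay := habove (p + 1)
    rw [← hx, ha] at px
    rw [← hy, hb'] at py ay
    rw [hx', ha] at ax
    have right : p + 1 < y → y < hi → X = b → False := fun h h' e =>
      (cy (by omega) h').elim (ay h rfl) fun h'' => py e.symm (h''.trans e.symm)
    have left : lo ≤ x → x < p → X = a → False := fun h h' e =>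
      (cx h (by omega)).elim (fun h'' => px e.symm (h''.trans e.symm)) fun h'' => ax h' h'' rfl
    clear cx cy
    have swx : Equiv.swap p (p + 1) x = x :=
      Equiv.swap_apply_of_ne_of_ne hnp hn
    have swy : Equiv.swap p (p + 1) y = y :=
      Equiv.swap_apply_of_ne_of_ne hn' hnp'
    have resx : lab x = b → X = b → False := fun h e => by
      have m := mx (Or.inr h)
      have : ¬ x < p := fun h' => ax h' h rfl
      clear mx my px py ax ay
      exact right (by omega) (by omega) e
    have resy : lab y = a → X = a → False := fun h e => by
      have m := my (Or.inl h)
      have : ¬ p + 1 < y := fun h' => ay h' rfl h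
      clear mx my px py ax ay
      exact left (by omega) (by omega) e
    constructor
    · intro q hq e e'
      simp only at e e'
      by_cases q1 : q = p
      · subst q1
        rw [← hx, swx] at e'
        rw [Equiv.swap_apply_left, hb'] at e
        exact resx (by omega) e.symm
      by_cases q2 : q = p + 1
      · subst q2
        rw [← hy, swy] at e'
        rw [Equiv.swap_apply_right, ha] at e
        exact resy (by omega) e.symm
      rw [Equiv.swap_apply_of_ne_of_ne q1 q2] at e
      by_cases q3 : q = x
      · subst q3
        rw [hx', Equiv.swap_apply_left, hb'] at e'
        exact resx (by omega) e'.symm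
      by_cases q4 : q = y
      · subst q4
        rw [hy', Equiv.swap_apply_right, ha] at e'
        exact resy (by omega) e'.symm
      have r1 : ρ' q ≠ p := fun h => q3 (by rw [hx]; exact (hρ.eq_iff.1 h).symm)
      have r2 : ρ' q ≠ p + 1 := fun h => q4 (by rw [hy]; exact (hρ.eq_iff.1 h).symm)
      rw [Equiv.swap_apply_of_ne_of_ne r1 r2] at e'
      exact hpure q hq e e'
    · intro q hq e e'
      simp only at e e'
      by_cases q1 : q = p
      · subst q1
        rw [← hx, swx] at e'
        rw [← hx] at hq
        have m := mx (Or.inl e')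
        rcases hX with hX | hX
        · exact px hX.symm (e'.trans hX.symm)
        · clear mx my px py ax ay
          exact right (by omega) (by omega) hX
      by_cases q2 : q = p + 1
      · subst q2
        rw [Equiv.swap_apply_right, ha] at e
        exact hne e
      rw [Equiv.swap_apply_of_ne_of_ne q1 q2] at e
      by_cases q3 : q = x
      · subst q3
        rw [hx', Equiv.swap_apply_left, hb'] at e'
        exact hne e'.symm
      by_cases q4 : q = y
      · subst q4
        rw [hy'] at hq
        have m := my (Or.inr e)
        rcases hX with hX | hX
        · clear mx my px py ax ay
          exact left (by omega) (by omega) hX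
        · exact py hX.symm (e.trans hX.symm)
      have r1 : ρ' q ≠ p := fun h => q3 (by rw [hx]; exact (hρ.eq_iff.1 h).symm)
      have r2 : ρ' q ≠ p + 1 := fun h => q4 (by rw [hy]; exact (hρ.eq_iff.1 h).symm)
      rw [Equiv.swap_apply_of_ne_of_ne r1 r2] at e'
      exact habove q hq e e'

/-! ### Sequences of pairings and labels along a front -/

/-- `σ 0, σ 1, …` is a sequence of pairings before, between and after the singularities of `w` as in
a normal ruling. -/
def IsPath (w : Front) (σ : ℕ → Equiv.Perm ℕ) : Prop :=
  ∀ i e, w[i]? = some e → Step e (σ i) (σ (i + 1))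

theorem isPath_cons {e : Event} {w : Front} {σ : ℕ → Equiv.Perm ℕ} :
    IsPath (e :: w) σ ↔ Step e (σ 0) (σ 1) ∧ IsPath w fun i => σ (i + 1) := by
  constructor
  · intro h
    exact ⟨h 0 e rfl, fun i e he => h (i + 1) e (by simpa using he)⟩
  · rintro ⟨h1, h2⟩ i e' he
    cases i with
    | zero => obtain rfl : e = e' := by simpa using he
              exact h1
    | succ i => exact h2 i e' (by simpa using he)

theorem isPath_append {u v : Front} {σ : ℕ → Equiv.Perm ℕ} :
    IsPath (u ++ v) σ ↔ IsPath u σ ∧ IsPath v fun i => σ (u.length + i) := by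
  induction u generalizing σ with
  | nil => simp [IsPath]
  | cons e u ih =>
    rw [List.cons_append, isPath_cons, isPath_cons, ih, and_assoc]
    simp only [List.length_cons, add_assoc, add_comm 1, add_left_comm]

theorem IsRulingPath.isPath {w : Front} {l : List (Equiv.Perm ℕ)} (h : IsRulingPath w l) :
    l.length = w.length + 1 ∧ IsPath w fun i => l.getD i 1 := by
  induction w generalizing l with
  | nil =>
    match l, h with
    | [_], _ => exact ⟨rfl, by simp [IsPath]⟩
  | cons e w ih =>
    match l, h with
    | ρ :: ρ' :: l, h =>
      obtain ⟨h1, h2⟩ := ih h.2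
      exact ⟨by rw [List.length_cons, h1]; rfl, isPath_cons.2 ⟨h.1, h2⟩⟩

theorem IsPath.isMatching {w : Front} {σ : ℕ → Equiv.Perm ℕ} (h : IsPath w σ) {a b : ℕ}
    (hw : Runs w a b) (h0 : IsMatching a (σ 0)) : IsMatching b (σ w.length) := by
  induction w generalizing σ a with
  | nil => simp only [Runs] at hw; subst hw; exact h0
  | cons e w ih =>
    rw [isPath_cons] at h
    exact ih h.2 hw.2 (h0.step hw.1 h.1)

/-- The labels after the first `i` singularities. -/
def labelsAt (tw : List (Event × ℕ)) (lab : ℕ → ℕ) (i : ℕ) : ℕ → ℕ := (tw.take i).foldl relabel lab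

/-- All singularities of a part of a front with the same index attached. -/
def withTag (t : ℕ) (w : Front) : List (Event × ℕ) := w.map fun e => (e, t)

theorem labelsAt_zero (tw : List (Event × ℕ)) (lab : ℕ → ℕ) : labelsAt tw lab 0 = lab := rfl

theorem labelsAt_append_left {u v : List (Event × ℕ)} {lab : ℕ → ℕ} {i : ℕ} (h : i ≤ u.length) :
    labelsAt (u ++ v) lab i = labelsAt u lab i := by
  rw [labelsAt, List.take_append_of_le_length h, labelsAt]

theorem labelsAt_append_right (u v : List (Event × ℕ)) (lab : ℕ → ℕ) (i : ℕ) :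
    labelsAt (u ++ v) lab (u.length + i) = labelsAt v (u.foldl relabel lab) i := by
  rw [labelsAt, List.take_length_add_append, List.foldl_append, labelsAt]

theorem labelsAt_length (u : List (Event × ℕ)) (lab : ℕ → ℕ) :
    labelsAt u lab u.length = u.foldl relabel lab := by
  rw [labelsAt, List.take_length]

/-- Along the front `w`, strands labelled `a` cross strands labelled `b` below them, all within the
strands numbered `lo, …, hi - 1`; the labels change from `lab` to `lab'`. -/
def CrossingRun (lo hi a b : ℕ) : Front → (ℕ → ℕ) → (ℕ → ℕ) → Prop
  | [], lab, lab' => lab = lab'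
  | e :: w, lab, lab' => (e.kind = .crossing ∧ lo ≤ e.pos ∧ e.pos + 1 < hi ∧ lab e.pos = a ∧
      lab (e.pos + 1) = b) ∧
        CrossingRun lo hi a b w (fun q => lab (Equiv.swap e.pos (e.pos + 1) q)) lab'

namespace CrossingRun
variable {N lo hi a b : ℕ}

theorem append {u v : Front} {l1 l2 l3 : ℕ → ℕ} (hu : CrossingRun lo hi a b u l1 l2)
    (hv : CrossingRun lo hi a b v l2 l3) : CrossingRun lo hi a b (u ++ v) l1 l3 := by
  induction u generalizing l1 with
  | nil => simp only [CrossingRun] at hu; subst hu; exact hv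
  | cons e u ih => exact ⟨hu.1, ih hu.2⟩

theorem singleton {p : ℕ} {lab lab' : ℕ → ℕ} (h1 : lo ≤ p) (h2 : p + 1 < hi) (h3 : lab p = a)
    (h4 : lab (p + 1) = b) (h5 : ∀ q, lab (Equiv.swap p (p + 1) q) = lab' q) :
    CrossingRun lo hi a b [cr p] lab lab' := ⟨⟨rfl, h1, h2, h3, h4⟩, funext h5⟩

theorem foldl_relabel {w : Front} {lab lab' : ℕ → ℕ} (h : CrossingRun lo hi a b w lab lab')
    (t : ℕ) : (withTag t w).foldl relabel lab = lab' := by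
  induction w generalizing lab with
  | nil => exact h
  | cons e w ih =>
    obtain ⟨k, p⟩ := e
    obtain rfl : k = .crossing := h.1.1
    exact ih h.2

variable {w : Front} {lab lab' : ℕ → ℕ} {σ : ℕ → Equiv.Perm ℕ}

/-- Induction along a run of crossings. -/
theorem forward {motive : (ℕ → ℕ) → Equiv.Perm ℕ → Prop}
    (hm : ∀ lab ρ ρ' p, IsBlock N lo hi a b lab → IsMatching N ρ → lo ≤ p → p + 1 < hi →
      lab p = a → lab (p + 1) = b → Step (cr p) ρ ρ' → motive lab ρ →
        motive (fun q => lab (Equiv.swap p (p + 1) q)) ρ')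
    (h : CrossingRun lo hi a b w lab lab') (hpath : IsPath w σ) (h0 : IsMatching N (σ 0))
    (hb : IsBlock N lo hi a b lab) (t : ℕ) (h1 : motive lab (σ 0)) :
    ∀ i ≤ w.length, motive (labelsAt (withTag t w) lab i) (σ i) := by
  induction w generalizing lab σ with
  | nil =>
    intro i hi
    obtain rfl : i = 0 := by simpa using hi
    exact h1
  | cons e w ih =>
    obtain ⟨k, p⟩ := e
    obtain ⟨⟨e1, e2, e3, e4, e5⟩, h⟩ := h
    obtain rfl : k = .crossing := e1
    rw [isPath_cons] at hpath
    have hle := hb.le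
    simp only at e2 e3 e4 e5
    intro i hi
    cases i with
    | zero => exact h1
    | succ i =>
      exact ih h hpath.2 (h0.step_cr (by omega) hpath.1) (hb.swap e2 e3)
        (hm _ _ _ _ hb h0 e2 e3 e4 e5 hpath.1 h1) i (by simpa using hi)

/-- Induction along a run of crossings, from right to left. -/
theorem backward {motive : (ℕ → ℕ) → Equiv.Perm ℕ → Prop}
    (hm : ∀ lab ρ ρ' p, IsBlock N lo hi b a lab → IsMatching N ρ → lo ≤ p → p + 1 < hi →
      lab p = b → lab (p + 1) = a → Step (cr p) ρ ρ' → motive lab ρ →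
        motive (fun q => lab (Equiv.swap p (p + 1) q)) ρ')
    (h : CrossingRun lo hi a b w lab lab') (hpath : IsPath w σ) (h0 : IsMatching N (σ 0))
    (hb : IsBlock N lo hi a b lab) (t : ℕ) (h1 : motive lab' (σ w.length)) :
    ∀ i ≤ w.length, motive (labelsAt (withTag t w) lab i) (σ i) := by
  induction w generalizing lab σ with
  | nil =>
    intro i hi
    obtain rfl : i = 0 := by simpa using hi
    simp only [CrossingRun] at h
    subst h
    exact h1
  | cons e w ih =>
    obtain ⟨k, p⟩ := e
    obtain ⟨⟨e1, e2, e3, e4, e5⟩, h⟩ := h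
    obtain rfl : k = .crossing := e1
    rw [isPath_cons] at hpath
    have hle := hb.le
    simp only at e2 e3 e4 e5
    have h0' := h0.step_cr (by omega) hpath.1
    have hb' := hb.swap e2 e3
    have key := ih h hpath.2 h0' hb' h1
    intro i hi
    cases i with
    | zero =>
      have := hm _ _ _ _ hb'.symm h0' e2 e3 (by rw [Equiv.swap_apply_left, e5])
        (by rw [Equiv.swap_apply_right, e4]) (hpath.1.symm_cr h0) (key 0 (Nat.zero_le _))
      simpa [labelsAt_zero] using this
    | succ i => exact key i (by simpa using hi)

theorem pureLabel_forward {X : ℕ} (hX : X = a ∨ X = b) (h : CrossingRun lo hi a b w lab lab')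
    (hpath : IsPath w σ) (h0 : IsMatching N (σ 0)) (hb : IsBlock N lo hi a b lab) (t : ℕ)
    (h1 : PureLabel X lab (σ 0)) (h2 : NoPairAbove b a lab (σ 0)) :
    ∀ i ≤ w.length, PureLabel X (labelsAt (withTag t w) lab i) (σ i) := fun i hi =>
  (h.forward (motive := fun lab ρ => PureLabel X lab ρ ∧ NoPairAbove b a lab ρ)
    (fun _ _ _ _ hb hρ l1 l2 l3 l4 hs hm => pureLabel_step hb hρ l1 l2 l3 l4 hs hX hm.1 hm.2)
    hpath h0 hb t ⟨h1, h2⟩ i hi).1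

theorem pureLabel_backward {X : ℕ} (hX : X = a ∨ X = b) (h : CrossingRun lo hi a b w lab lab')
    (hpath : IsPath w σ) (h0 : IsMatching N (σ 0)) (hb : IsBlock N lo hi a b lab) (t : ℕ)
    (h1 : PureLabel X lab' (σ w.length)) (h2 : NoPairAbove a b lab' (σ w.length)) :
    ∀ i ≤ w.length, PureLabel X (labelsAt (withTag t w) lab i) (σ i) := fun i hi =>
  (h.backward (motive := fun lab ρ => PureLabel X lab ρ ∧ NoPairAbove a b lab ρ)
    (fun _ _ _ _ hb hρ l1 l2 l3 l4 hs hm => pureLabel_step hb hρ l1 l2 l3 l4 hs hX.symm hm.1 hm.2)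
    hpath h0 hb t ⟨h1, h2⟩ i hi).1

/-- Other labels are not affected by a run of crossings. -/
theorem pureLabel_of_ne {X : ℕ} (hXa : X ≠ a) (hXb : X ≠ b) (h : CrossingRun lo hi a b w lab lab')
    (hpath : IsPath w σ) (h0 : IsMatching N (σ 0)) (hb : IsBlock N lo hi a b lab) (t : ℕ) :
    ∀ i ≤ w.length,
      (PureLabel X (labelsAt (withTag t w) lab i) (σ i) ↔ PureLabel X lab (σ 0)) :=
  h.forward (motive := fun lab'' ρ => PureLabel X lab'' ρ ↔ PureLabel X lab (σ 0))
    (fun _ _ _ _ _ _ _ _ l3 l4 hs hm => (pureLabel_step_of_ne hs (l3 ▸ hXa.symm)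
      (l4 ▸ hXb.symm)).trans hm) hpath h0 hb t Iff.rfl

/-- Whether the strands of the block are paired among themselves does not change along a run. -/
theorem closed_iff (h : CrossingRun lo hi a b w lab lab')
    (hpath : IsPath w σ) (h0 : IsMatching N (σ 0)) (hb : IsBlock N lo hi a b lab) :
    (∀ q ∈ Set.Ico lo hi, σ w.length q ∈ Set.Ico lo hi) ↔
      ∀ q ∈ Set.Ico lo hi, σ 0 q ∈ Set.Ico lo hi := by
  refine h.forward (motive := fun _ ρ => (∀ q ∈ Set.Ico lo hi, ρ q ∈ Set.Ico lo hi) ↔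
      ∀ q ∈ Set.Ico lo hi, σ 0 q ∈ Set.Ico lo hi) ?_ hpath h0 hb 0 Iff.rfl w.length le_rfl
  intro lab ρ ρ' p _ _ l1 l2 _ _ hs hm
  refine Iff.trans ?_ hm
  have hmem : p ∈ Set.Ico lo hi ↔ p + 1 ∈ Set.Ico lo hi := by
    rw [Set.mem_Ico, Set.mem_Ico]; omega
  obtain ⟨-, rfl | ⟨rfl, -⟩⟩ := hs
  · change (∀ q ∈ _, conj p ρ q ∈ _) ↔ _
    simp only [conj_apply, swap_mem_iff hmem]
    constructor
    · intro h q hq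
      have := h _ ((swap_mem_iff hmem q).2 hq)
      rwa [Equiv.swap_apply_self] at this
    · intro h q hq
      exact h _ ((swap_mem_iff hmem q).2 hq)
  · rfl

end CrossingRun

/-- If the strands of a block are paired among themselves and equally many of them carry the labels
`a` and `b`, then no two strands labelled `a` are paired if and only if no two strands labelled
`b` are. -/
theorem pureLabel_iff_of_closed {N lo n a b : ℕ} {lab : ℕ → ℕ} {ρ : Equiv.Perm ℕ}
    (hb : IsBlock N lo (lo + 2 * n) a b lab) (hρ : IsMatching N ρ)
    (hclosed : ∀ q ∈ Set.Ico lo (lo + 2 * n), ρ q ∈ Set.Ico lo (lo + 2 * n))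
    (ha : ∀ q, lo ≤ q → q < lo + n → lab q = a)
    (hb' : ∀ q, lo + n ≤ q → q < lo + 2 * n → lab q = b) :
    PureLabel a lab ρ ↔ PureLabel b lab ρ := by
  have hle := hb.le
  have hne := hb.ne
  have hmem : ∀ q, ρ q ≠ q → q < N := fun q h => by
    by_contra hc
    exact h ((hρ.fixed q).2 (by omega))
  have aux : ∀ q, lo ≤ q → q < lo + 2 * n → lo ≤ ρ q ∧ ρ q < lo + 2 * n := fun q h h' =>
    Set.mem_Ico.1 (hclosed q (Set.mem_Ico.2 ⟨h, h'⟩))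
  constructor
  · intro h q hq e e'
    have m1 := hb.mem q (hmem q hq) (Or.inr e)
    have q1 : lo + n ≤ q := by
      by_contra hc
      exact hne ((ha q m1.1 (by omega)).symm.trans e)
    have maps : ∀ r ∈ Finset.Ico lo (lo + n), ρ r ∈ Finset.Ico (lo + n) (lo + 2 * n) := by
      intro r hr
      rw [Finset.mem_Ico] at hr ⊢
      have := aux r hr.1 (by omega)
      refine ⟨?_, this.2⟩
      by_contra hc
      exact h r (hρ.ne (by omega)) (ha r hr.1 hr.2) (ha _ this.1 (by omega))
    have surj := Finset.surjOn_of_injOn_of_card_le ρ maps ρ.injective.injOn (by simp; omega)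
    obtain ⟨r, hr, hrq⟩ := surj (by simpa using ⟨q1, m1.2⟩ : q ∈ _)
    have hr' : lo ≤ r ∧ r < lo + n := by simpa using hr
    have : ρ q = r := hρ.eq_iff.1 hrq
    rw [this, ha r hr'.1 hr'.2] at e'
    exact hne e'
  · intro h q hq e e'
    have m1 := hb.mem q (hmem q hq) (Or.inl e)
    have q1 : q < lo + n := by
      by_contra hc
      exact hne (e.symm.trans (hb' q (by omega) m1.2))
    have maps : ∀ r ∈ Finset.Ico (lo + n) (lo + 2 * n), ρ r ∈ Finset.Ico lo (lo + n) := by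
      intro r hr
      rw [Finset.mem_Ico] at hr ⊢
      have := aux r (by omega) hr.2
      refine ⟨this.1, ?_⟩
      by_contra hc
      exact h r (hρ.ne (by omega)) (hb' r hr.1 hr.2) (hb' _ (by omega) this.2)
    have surj := Finset.surjOn_of_injOn_of_card_le ρ maps ρ.injective.injOn (by simp; omega)
    obtain ⟨r, hr, hrq⟩ := surj (by simpa using ⟨m1.1, q1⟩ : q ∈ _)
    have hr' : lo + n ≤ r ∧ r < lo + 2 * n := by simpa using hr
    have : ρ q = r := hρ.eq_iff.1 hrq
    rw [this, hb' r hr'.1 hr'.2] at e'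
    exact hne e'.symm

/-! ### The crossings in the copy of a singularity -/

namespace CrossingRun
variable {lo hi a b : ℕ}

theorem flatMap_range {f : ℕ → Front} {lab : ℕ → ℕ → ℕ} (k : ℕ)
    (h : ∀ j < k, CrossingRun lo hi a b (f j) (lab j) (lab (j + 1))) :
    CrossingRun lo hi a b ((List.range k).flatMap f) (lab 0) (lab k) := by
  induction k with
  | zero => simp [CrossingRun]
  | succ k ih =>
    rw [List.range_succ, List.flatMap_append]
    refine append (ih fun j hj => h j (by omega)) ?_
    simpa using h k (by omega)

theorem map_range {f : ℕ → Event} {lab : ℕ → ℕ → ℕ} (k : ℕ)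
    (h : ∀ j < k, CrossingRun lo hi a b [f j] (lab j) (lab (j + 1))) :
    CrossingRun lo hi a b ((List.range k).map f) (lab 0) (lab k) := by
  have := flatMap_range (f := fun j => [f j]) k h
  rwa [← List.map_eq_flatMap] at this

end CrossingRun

open Classical in
/-- On the strands `lo, …, hi - 1`, the labels that are `b` on `S` and `a` outside of `S`. -/
noncomputable def blockLabels (lo hi a b : ℕ) (base : ℕ → ℕ) (S : ℕ → Prop) (q : ℕ) : ℕ :=
  if lo ≤ q ∧ q < hi then if S q then b else a else base q

theorem blockLabels_pos {lo hi a b : ℕ} {base : ℕ → ℕ} {S : ℕ → Prop} {q : ℕ} (h1 : lo ≤ q)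
    (h2 : q < hi) (h : S q) : blockLabels lo hi a b base S q = b := by
  rw [blockLabels, if_pos ⟨h1, h2⟩, if_pos h]

theorem blockLabels_neg {lo hi a b : ℕ} {base : ℕ → ℕ} {S : ℕ → Prop} {q : ℕ} (h1 : lo ≤ q)
    (h2 : q < hi) (h : ¬ S q) : blockLabels lo hi a b base S q = a := by
  rw [blockLabels, if_pos ⟨h1, h2⟩, if_neg h]

theorem blockLabels_out {lo hi a b : ℕ} {base : ℕ → ℕ} {S : ℕ → Prop} {q : ℕ}
    (h : q < lo ∨ hi ≤ q) : blockLabels lo hi a b base S q = base q := by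
  rw [blockLabels, if_neg (by omega)]

theorem blockLabels_congr {lo hi a b : ℕ} {base : ℕ → ℕ} {S S' : ℕ → Prop}
    (h : ∀ q, lo ≤ q → q < hi → (S q ↔ S' q)) :
    blockLabels lo hi a b base S = blockLabels lo hi a b base S' := by
  funext q
  simp only [blockLabels]
  split_ifs with h1 h2 h3 h3
  · rfl
  · exact absurd ((h q h1.1 h1.2).1 h2) h3
  · exact absurd ((h q h1.1 h1.2).2 h3) h2
  · rfl
  · rfl

theorem CrossingRun.blockLabels {lo hi a b p : ℕ} {base : ℕ → ℕ} {S S' : ℕ → Prop} (h1 : lo ≤ p)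
    (h2 : p + 1 < hi) (hp : ¬ S p) (hp' : S (p + 1)) (hq : S' p) (hq' : ¬ S' (p + 1))
    (h : ∀ q, lo ≤ q → q < hi → q ≠ p → q ≠ p + 1 → (S q ↔ S' q)) :
    CrossingRun lo hi a b [cr p] (blockLabels lo hi a b base S)
      (LegRuling.blockLabels lo hi a b base S') := by
  refine singleton h1 h2 (blockLabels_neg h1 (by omega) hp) (blockLabels_pos (by omega) h2 hp') ?_
  intro q
  by_cases e1 : q = p
  · subst e1
    rw [Equiv.swap_apply_left, blockLabels_pos (by omega) h2 hp', blockLabels_pos h1 (by omega) hq]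
  by_cases e2 : q = p + 1
  · subst e2
    rw [Equiv.swap_apply_right, blockLabels_neg h1 (by omega) hp, blockLabels_neg (by omega) h2 hq']
  rw [Equiv.swap_apply_of_ne_of_ne e1 e2]
  by_cases e3 : lo ≤ q ∧ q < hi
  · by_cases e4 : S q
    · rw [blockLabels_pos e3.1 e3.2 e4, blockLabels_pos e3.1 e3.2 ((h q e3.1 e3.2 e1 e2).1 e4)]
    · rw [blockLabels_neg e3.1 e3.2 e4,
        blockLabels_neg e3.1 e3.2 fun e => e4 ((h q e3.1 e3.2 e1 e2).2 e)]
  · rw [blockLabels_out (by omega), blockLabels_out (by omega)]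

/-- In the `n`-copy of a crossing, `n` strands labelled `a` cross `n` strands labelled `b`. -/
theorem crossingRun_copy_crossing (n p a b : ℕ) (base : ℕ → ℕ) :
    CrossingRun (n * p) (n * p + 2 * n) a b (copyEvent n (cr p))
      (blockLabels (n * p) (n * p + 2 * n) a b base fun q => n * p + n ≤ q)
      (blockLabels (n * p) (n * p + 2 * n) a b base fun q => q < n * p + n) := by
  change CrossingRun _ _ a b ((List.range n).flatMap fun j =>
      (List.range n).map fun t => cr (n * p + (n - 1 - t) + j)) _ _
  generalize n * p = lo
  -- In row `j` a strand labelled `b` moves up past all strands labelled `a`.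
  have row : ∀ j < n, CrossingRun lo (lo + 2 * n) a b
      ((List.range n).map fun t => cr (lo + (n - 1 - t) + j))
      (blockLabels lo (lo + 2 * n) a b base fun q => q < lo + j ∨ lo + j + n ≤ q)
      (blockLabels lo (lo + 2 * n) a b base fun q => q < lo + (j + 1) ∨ lo + (j + 1) + n ≤ q) := by
    intro j hj
    have := CrossingRun.map_range (lo := lo) (hi := lo + 2 * n) (a := a) (b := b)
      (f := fun t => cr (lo + (n - 1 - t) + j))
      (lab := fun t => blockLabels lo (lo + 2 * n) a b base fun q =>
        q < lo + j ∨ q + t = lo + j + n ∨ lo + j + n < q) n (fun t ht =>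
          CrossingRun.blockLabels (by omega) (by omega) (by omega) (by omega) (by omega) (by omega)
            (by omega))
    convert this using 1
    · exact blockLabels_congr fun q _ _ => by omega
    · exact blockLabels_congr fun q _ _ => by omega
  have := CrossingRun.flatMap_range (lab := fun j => blockLabels lo (lo + 2 * n) a b base fun q =>
    q < lo + j ∨ lo + j + n ≤ q) n row
  convert this using 1
  · exact blockLabels_congr fun q _ _ => by omega
  · exact blockLabels_congr fun q _ _ => by omega

/-- The crossings in the `n`-copy of a left cusp sort strands that are labelled alternately. -/
theorem crossingRun_left (n lo a b : ℕ) (hn : 1 ≤ n) (base : ℕ → ℕ) :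
    CrossingRun lo (lo + 2 * n) a b
      ((List.range (n - 1)).flatMap fun d => crossingRow n lo (d + 1))
      (blockLabels lo (lo + 2 * n) a b base fun q => (q + lo) % 2 = 0)
      (blockLabels lo (lo + 2 * n) a b base fun q => q < lo + n) := by
  have row : ∀ d < n - 1, CrossingRun lo (lo + 2 * n) a b (crossingRow n lo (d + 1))
      (blockLabels lo (lo + 2 * n) a b base fun q =>
        q < lo + d ∨ q + d < lo + 2 * n ∧ (q + d + lo) % 2 = 0)
      (blockLabels lo (lo + 2 * n) a b base fun q =>
        q < lo + (d + 1) ∨ q + (d + 1) < lo + 2 * n ∧ (q + (d + 1) + lo) % 2 = 0) := by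
    intro d hd
    unfold crossingRow
    have := CrossingRun.map_range (lo := lo) (hi := lo + 2 * n) (a := a) (b := b)
      (f := fun t => cr (lo + (d + 1) + 2 * t))
      (lab := fun t => blockLabels lo (lo + 2 * n) a b base fun q =>
        q < lo + (d + 1) ∨ q + (d + 1) < lo + 2 * n ∧
          (q < lo + (d + 1) + 2 * t ∧ (q + (d + 1) + lo) % 2 = 0 ∨
            lo + (d + 1) + 2 * t ≤ q ∧ (q + (d + 1) + lo) % 2 = 1)) (n - (d + 1)) (fun t ht =>
          CrossingRun.blockLabels (by omega) (by omega) (by omega) (by omega) (by omega) (by omega)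
            (by omega))
    convert this using 1
    · exact blockLabels_congr fun q _ _ => by omega
    · exact blockLabels_congr fun q _ _ => by omega
  have := CrossingRun.flatMap_range (lab := fun d => blockLabels lo (lo + 2 * n) a b base fun q =>
        q < lo + d ∨ q + d < lo + 2 * n ∧ (q + d + lo) % 2 = 0) (n - 1) row
  convert this using 1
  · exact blockLabels_congr fun q _ _ => by omega
  · exact blockLabels_congr fun q _ _ => by omega

/-- The crossings in the `n`-copy of a right cusp mix sorted strands. -/
theorem crossingRun_right (n lo a b : ℕ) (hn : 1 ≤ n) (base : ℕ → ℕ) :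
    CrossingRun lo (lo + 2 * n) a b
      ((List.range (n - 1)).flatMap fun d => crossingRow n lo (n - 1 - d))
      (blockLabels lo (lo + 2 * n) a b base fun q => lo + n ≤ q)
      (blockLabels lo (lo + 2 * n) a b base fun q => (q + lo) % 2 = 1) := by
  have row : ∀ k < n - 1, CrossingRun lo (lo + 2 * n) a b (crossingRow n lo (n - 1 - k))
      (blockLabels lo (lo + 2 * n) a b base fun q =>
        ¬ (q < lo + (n - 1 - k) ∨ q + (n - 1 - k) < lo + 2 * n ∧ (q + (n - 1 - k) + lo) % 2 = 0))
      (blockLabels lo (lo + 2 * n) a b base fun q => ¬ (q < lo + (n - 1 - (k + 1)) ∨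
        q + (n - 1 - (k + 1)) < lo + 2 * n ∧ (q + (n - 1 - (k + 1)) + lo) % 2 = 0)) := by
    intro k hk
    obtain ⟨d, hd⟩ : ∃ d, n - 1 - k = d + 1 := ⟨n - 1 - k - 1, by omega⟩
    have hd' : n - 1 - (k + 1) = d := by omega
    rw [hd', hd]
    unfold crossingRow
    have := CrossingRun.map_range (lo := lo) (hi := lo + 2 * n) (a := a) (b := b)
      (f := fun t => cr (lo + (d + 1) + 2 * t))
      (lab := fun t => blockLabels lo (lo + 2 * n) a b base fun q =>
        ¬ (q < lo + (d + 1) ∨ q + (d + 1) < lo + 2 * n ∧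
          (q < lo + (d + 1) + 2 * t ∧ (q + (d + 1) + lo) % 2 = 1 ∨
            lo + (d + 1) + 2 * t ≤ q ∧ (q + (d + 1) + lo) % 2 = 0))) (n - (d + 1)) (fun t ht =>
          CrossingRun.blockLabels (by omega) (by omega) (by omega) (by omega) (by omega) (by omega)
            (by omega))
    convert this using 1
    · exact blockLabels_congr fun q _ _ => by omega
    · exact blockLabels_congr fun q _ _ => by omega
  have := CrossingRun.flatMap_range (lab := fun k => blockLabels lo (lo + 2 * n) a b base fun q =>
        ¬ (q < lo + (n - 1 - k) ∨ q + (n - 1 - k) < lo + 2 * n ∧ (q + (n - 1 - k) + lo) % 2 = 0))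
        (n - 1) row
  convert this using 1
  · exact blockLabels_congr fun q _ _ => by omega
  · exact blockLabels_congr fun q _ _ => by omega

/-- A block whose upper half is labelled `a` and whose lower half is labelled `b`. -/
structure IsSortedBlock (N lo n a b : ℕ) (lab : ℕ → ℕ) : Prop
    extends IsBlock N lo (lo + 2 * n) a b lab where
  upper : ∀ q, lo ≤ q → q < lo + n → lab q = a
  lower : ∀ q, lo + n ≤ q → q < lo + 2 * n → lab q = b

theorem IsSortedBlock.noPairAbove {N lo n a b : ℕ} {lab : ℕ → ℕ} {ρ : Equiv.Perm ℕ}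
    (h : IsSortedBlock N lo n a b lab) (hρ : IsMatching N ρ) : NoPairAbove b a lab ρ := by
  intro q hq e e'
  have hqN : q < N := by
    by_contra hc
    have := (hρ.fixed q).2 (by omega)
    omega
  have h1 := h.mem q hqN (Or.inr e)
  have h2 := h.mem _ (hρ.lt hqN) (Or.inl e')
  have h3 : lo + n ≤ q := by
    by_contra hc
    exact h.ne ((h.upper q h1.1 (by omega)).symm.trans e)
  exact h.ne (e'.symm.trans (h.lower _ (by omega) h2.2))

theorem IsSortedBlock.pureLabel_iff_of_closed {N lo n a b : ℕ} {lab : ℕ → ℕ} {ρ : Equiv.Perm ℕ}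
    (h : IsSortedBlock N lo n a b lab) (hρ : IsMatching N ρ)
    (hclosed : ∀ q ∈ Set.Ico lo (lo + 2 * n), ρ q ∈ Set.Ico lo (lo + 2 * n)) :
    PureLabel a lab ρ ↔ PureLabel b lab ρ :=
  LegRuling.pureLabel_iff_of_closed h.toIsBlock hρ hclosed h.upper h.lower

namespace CrossingRun
variable {N lo n a b X : ℕ} {w : Front} {lab lab' : ℕ → ℕ} {σ : ℕ → Equiv.Perm ℕ}

theorem labelsAt_length (h : CrossingRun lo (lo + 2 * n) a b w lab lab') (t : ℕ) :
    labelsAt (withTag t w) lab w.length = lab' := by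
  rw [← h.foldl_relabel t, labelsAt, List.take_of_length_le (by simp [withTag])]

/-- At the start of a run that begins with sorted strands, no strand labelled `b` is above a strand
labelled `a`, so purity propagates to the right. -/
theorem pureLabel_of_start (h : CrossingRun lo (lo + 2 * n) a b w lab lab') (hpath : IsPath w σ)
    (h0 : IsMatching N (σ 0)) (hb : IsSortedBlock N lo n a b lab) (t : ℕ)
    (h1 : PureLabel X lab (σ 0)) :
    ∀ i ≤ w.length, PureLabel X (labelsAt (withTag t w) lab i) (σ i) := by
  by_cases hX : X = a ∨ X = b
  · exact h.pureLabel_forward hX hpath h0 hb.toIsBlock t h1 (hb.noPairAbove h0)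
  · push Not at hX
    exact fun i hi => (h.pureLabel_of_ne hX.1 hX.2 hpath h0 hb.toIsBlock t i hi).2 h1

theorem isMatching (h : CrossingRun lo (lo + 2 * n) a b w lab lab') (hpath : IsPath w σ)
    (h0 : IsMatching N (σ 0)) (hb : IsBlock N lo (lo + 2 * n) a b lab) :
    IsMatching N (σ w.length) :=
  h.forward (motive := fun _ ρ => IsMatching N ρ)
    (fun _ _ _ _ hb hρ _ l2 _ _ hs _ => hρ.step_cr (by have := hb.le; omega) hs) hpath h0 hb 0 h0 _
    le_rfl

/-- Purity propagates to the left from the end of a run that sorts the strands. -/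
theorem pureLabel_of_end (h : CrossingRun lo (lo + 2 * n) a b w lab lab') (hpath : IsPath w σ)
    (h0 : IsMatching N (σ 0)) (hb' : IsBlock N lo (lo + 2 * n) a b lab)
    (hb : IsSortedBlock N lo n b a lab') (t : ℕ)
    (h1 : PureLabel X lab' (σ w.length)) :
    ∀ i ≤ w.length, PureLabel X (labelsAt (withTag t w) lab i) (σ i) := by
  by_cases hX : X = a ∨ X = b
  · exact h.pureLabel_backward hX hpath h0 hb' t h1 (hb.noPairAbove (h.isMatching hpath h0 hb'))
  · push Not at hX
    have := h.pureLabel_of_ne hX.1 hX.2 hpath h0 hb' t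
    have h2 := this _ le_rfl
    rw [h.labelsAt_length] at h2
    exact fun i hi => (this i hi).2 (h2.1 h1)

end CrossingRun

/-! ### The cusps in the copy of a cusp -/

/-- Inserting or removing a pair of strands with different labels does not affect purity. -/
theorem pureLabel_ins {p X : ℕ} {lab : ℕ → ℕ} {ρ : Equiv.Perm ℕ} (h : lab p ≠ lab (p + 1)) :
    PureLabel X lab (ins p ρ) ↔ PureLabel X (fun q => lab (skip p q)) ρ := by
  constructor
  · intro hp q hq e e'
    refine hp (skip p q) ?_ e ?_
    · rw [ins_skip]; exact fun h => hq (skip_inj.1 h)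
    · rw [ins_skip]; exact e'
  · intro hp q hq e e'
    rcases eq_or_exists_skip p q with rfl | rfl | ⟨q, rfl⟩
    · rw [ins_left] at e'; exact h (e.trans e'.symm)
    · rw [ins_right] at e'; exact h (e'.trans e.symm)
    · rw [ins_skip] at e' hq
      exact hp q (fun h => hq (by rw [h])) e e'

theorem labelsAt_succ {tw : List (Event × ℕ)} {lab : ℕ → ℕ} {i : ℕ} {x : Event × ℕ}
    (h : tw[i]? = some x) : labelsAt tw lab (i + 1) = relabel (labelsAt tw lab i) x := by
  rw [labelsAt, List.take_add_one, h, List.foldl_append]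
  rfl

theorem relabel_left_skip (p t : ℕ) (lab : ℕ → ℕ) (q : ℕ) :
    relabel lab (lc p, t) (skip p q) = lab q := by
  simp only [relabel, skip]
  split_ifs <;> first | rfl | omega

/-- The labels after the first `k` of the left cusps in the copy of a left cusp. -/
theorem labelsAt_leftCusps (lo t n : ℕ) (lab : ℕ → ℕ) (k : ℕ) (hk : k ≤ n) :
    labelsAt (withTag t ((List.range n).map fun j => lc (lo + 2 * j))) lab k =
      blockLabels lo (lo + 2 * k) (2 * t + 1) (2 * t)
        (fun q => if q < lo then lab q else lab (q - 2 * k)) fun q => (q + lo) % 2 = 0 := by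
  induction k with
  | zero =>
    funext q
    rw [labelsAt_zero, blockLabels_out (by omega)]
    simp
  | succ k ih =>
    rw [labelsAt_succ (x := (lc (lo + 2 * k), t)) (by
      simp [withTag, List.getElem?_range (show k < n by omega)]), ih (by omega)]
    funext q
    simp only [relabel]
    split_ifs with h1 h2 h3
    · by_cases h : lo ≤ q
      · by_cases h' : (q + lo) % 2 = 0
        · rw [blockLabels_pos h h1 h', blockLabels_pos h (by omega) h']
        · rw [blockLabels_neg h h1 h', blockLabels_neg h (by omega) h']
      · rw [blockLabels_out (by omega), blockLabels_out (by omega), if_pos (by omega),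
          if_pos (by omega)]
    · rw [blockLabels_pos (by omega) (by omega) (by omega)]
    · rw [blockLabels_neg (by omega) (by omega) (by omega)]
    · rw [blockLabels_out (by omega), blockLabels_out (by omega), if_neg (by omega),
          if_neg (by omega)]
      congr 1
      omega

/-- Along the left cusps in the copy of a left cusp, the new strands are paired among themselves, and
no two strands with equal labels become paired. -/
theorem leftCusps_path {lo t n N : ℕ} {lab : ℕ → ℕ} {σ : ℕ → Equiv.Perm ℕ} (hlo : lo ≤ N)
    (hpath : IsPath ((List.range n).map fun j => lc (lo + 2 * j)) σ) (h0 : IsMatching N (σ 0))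
    (k : ℕ) (hk : k ≤ n) :
    IsMatching (N + 2 * k) (σ k) ∧
      (∀ q ∈ Set.Ico lo (lo + 2 * k), σ k q ∈ Set.Ico lo (lo + 2 * k)) ∧
      ∀ X, (PureLabel X (labelsAt (withTag t ((List.range n).map fun j => lc (lo + 2 * j))) lab k)
        (σ k) ↔ PureLabel X lab (σ 0)) := by
  induction k with
  | zero => exact ⟨h0, by simp, fun X => Iff.rfl⟩
  | succ k ih =>
    obtain ⟨i1, i2, i3⟩ := ih (by omega)
    have hs := hpath k (lc (lo + 2 * k)) (by
      simp [List.getElem?_range (show k < n by omega)])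
    have he : σ (k + 1) = ins (lo + 2 * k) (σ k) := insertPair_iff.1 hs
    have hl := labelsAt_leftCusps lo t n lab (k + 1) hk
    refine ⟨(i1.step (by simp [Kind.ins]; omega) hs).of_eq (by simp [Kind.ins, Kind.outs]; omega),
      ?_, fun X => ?_⟩
    · intro q hq
      rw [Set.mem_Ico] at hq ⊢
      rw [he]
      by_cases h : q < lo + 2 * k
      · have := i2 q (Set.mem_Ico.2 ⟨hq.1, h⟩)
        rw [Set.mem_Ico] at this
        have e : q = skip (lo + 2 * k) q := by simp [skip, h]
        rw [e, ins_skip, skip, if_pos this.2]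
        omega
      · obtain rfl | rfl : q = lo + 2 * k ∨ q = lo + 2 * k + 1 := by omega
        · rw [ins_left]; omega
        · rw [ins_right]; omega
    · rw [← i3 X, he, pureLabel_ins]
      · rw [labelsAt_succ (x := (lc (lo + 2 * k), t)) (by
      simp [withTag, List.getElem?_range (show k < n by omega)])]
        simp only [relabel_left_skip]
      · rw [hl, blockLabels_pos (by omega) (by omega) (by omega),
          blockLabels_neg (by omega) (by omega) (by omega)]
        omega

theorem foldl_rightCusps (lo t n : ℕ) (lab : ℕ → ℕ) :
    (withTag t (List.replicate n (rc lo))).foldl relabel lab =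
      fun q => lab (if q < lo then q else q + 2 * n) := by
  induction n generalizing lab with
  | zero => simp [withTag]
  | succ n ih =>
    change (withTag t (List.replicate n (rc lo))).foldl relabel (relabel lab (rc lo, t)) = _
    rw [ih]
    funext q
    simp only [relabel, skip]
    split_ifs <;> first | rfl | omega

/-- Before the right cusps in the copy of a right cusp, the strands that end there are paired among
themselves, and the right cusps do not affect whether strands with equal labels are paired. -/
theorem rightCusps_path {lo t n : ℕ} {lab : ℕ → ℕ} {σ : ℕ → Equiv.Perm ℕ}
    (hpath : IsPath (List.replicate n (rc lo)) σ)
    (hlab : ∀ j < n, lab (lo + 2 * j) ≠ lab (lo + 2 * j + 1)) :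
    (∀ q ∈ Set.Ico lo (lo + 2 * n), σ 0 q ∈ Set.Ico lo (lo + 2 * n)) ∧
      ∀ X, ∀ i ≤ n, (PureLabel X (labelsAt (withTag t (List.replicate n (rc lo))) lab i) (σ i) ↔
        PureLabel X lab (σ 0)) := by
  induction n generalizing lab σ with
  | zero => exact ⟨by simp, fun X i hi => by obtain rfl : i = 0 := by omega
                                             rfl⟩
  | succ n ih =>
    rw [List.replicate_succ, isPath_cons] at hpath
    have he : σ 0 = ins lo (σ 1) := insertPair_iff.1 hpath.1
    obtain ⟨i1, i2⟩ := ih (lab := relabel lab (rc lo, t)) hpath.2 (by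
      intro j hj
      have := hlab (j + 1) (by omega)
      simp only [relabel, skip]
      rwa [if_neg (by omega), if_neg (by omega)])
    refine ⟨?_, fun X i hi => ?_⟩
    · intro q hq
      rw [he]
      rw [Set.mem_Ico] at hq
      rcases eq_or_exists_skip lo q with rfl | rfl | ⟨q, rfl⟩
      · rw [ins_left, Set.mem_Ico]; omega
      · rw [ins_right, Set.mem_Ico]; omega
      · have hq' : lo ≤ q ∧ q < lo + 2 * n := by
          simp only [skip] at hq
          split_ifs at hq <;> omega
        have := i1 q (Set.mem_Ico.2 hq')
        rw [Set.mem_Ico, zero_add] at this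
        rw [ins_skip, skip, if_neg (by omega), Set.mem_Ico]
        omega
    · cases i with
      | zero => rfl
      | succ i =>
        have := i2 X i (by omega)
        refine this.trans ?_
        rw [he, pureLabel_ins (by simpa using hlab 0 (by omega))]
        rfl

/-! ### Purity along the copy of a singularity -/

/-- The labels of the strands of the `n`-copy, for given labels `ℓ` of the strands of the knot. -/
def copyLabels (n : ℕ) (ℓ : ℕ → ℕ) (q : ℕ) : ℕ := ℓ (q / n)

/-- Different strands among the first `W` have different labels, and these labels belong to left
cusps with index less than `t`. -/
structure GoodLabels (W t : ℕ) (ℓ : ℕ → ℕ) : Prop where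
  lt : ∀ q < W, ℓ q < 2 * t
  inj : ∀ q < W, ∀ r < W, ℓ q = ℓ r → q = r

theorem GoodLabels.relabel {W t : ℕ} {ℓ : ℕ → ℕ} (h : GoodLabels W t ℓ) {e : Event}
    (he : e.pos + e.kind.ins ≤ W) :
    GoodLabels (W - e.kind.ins + e.kind.outs) (t + 1) (relabel ℓ (e, t)) := by
  obtain ⟨k, p⟩ := e
  cases k with
  | crossing =>
    simp only [Kind.ins, Kind.outs] at he ⊢
    have key : ∀ q < W - 2 + 2, Equiv.swap p (p + 1) q < W := fun q hq => by
      rw [swap_val]; split_ifs <;> omega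
    refine ⟨fun q hq => ?_, fun q hq r hr e => ?_⟩
    · exact (h.lt _ (key q hq)).trans (by omega)
    · exact (Equiv.swap p (p + 1)).injective (h.inj _ (key q hq) _ (key r hr) e)
  | leftCusp =>
    simp only [Kind.ins, Kind.outs] at he ⊢
    have key : ∀ q, q < W - 0 + 2 → q = p ∨ q = p + 1 ∨ ∃ q' < W, q = skip p q' := fun q hq => by
      rcases eq_or_exists_skip p q with h | h | ⟨q', h⟩
      · exact Or.inl h
      · exact Or.inr (Or.inl h)
      · refine Or.inr (Or.inr ⟨q', ?_, h⟩)
        simp only [skip] at h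
        split_ifs at h <;> omega
    have l1 : LegRuling.relabel ℓ (lc p, t) p = 2 * t := by simp [LegRuling.relabel]
    have l2 : LegRuling.relabel ℓ (lc p, t) (p + 1) = 2 * t + 1 := by simp [LegRuling.relabel]
    refine ⟨fun q hq => ?_, fun q hq r hr e => ?_⟩
    · rcases key q hq with rfl | rfl | ⟨q, hq', rfl⟩
      · rw [l1]; omega
      · rw [l2]; omega
      · rw [relabel_left_skip]; have := h.lt q hq'; omega
    · rcases key q hq with rfl | rfl | ⟨q, hq', rfl⟩ <;>
        rcases key r hr with rfl | rfl | ⟨r, hr', rfl⟩ <;>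
        simp only [l1, l2, relabel_left_skip] at e
      · rfl
      · omega
      · have := h.lt r hr'; omega
      · omega
      · rfl
      · have := h.lt r hr'; omega
      · have := h.lt q hq'; omega
      · have := h.lt q hq'; omega
      · rw [h.inj q hq' r hr' e]
  | rightCusp =>
    simp only [Kind.ins, Kind.outs] at he ⊢
    have key : ∀ q < W - 2 + 0, skip p q < W := fun q hq => by
      rw [skip]; split_ifs <;> omega
    refine ⟨fun q hq => ?_, fun q hq r hr e => ?_⟩
    · exact (h.lt _ (key q hq)).trans (by omega)
    · exact skip_inj.1 (h.inj _ (key q hq) _ (key r hr) e)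

theorem copyLabels_of_mem {n k q : ℕ} {ℓ : ℕ → ℕ} (h1 : n * k ≤ q) (h2 : q < n * k + n) :
    copyLabels n ℓ q = ℓ k := by
  rw [copyLabels, Nat.div_eq_of_lt_le (by rwa [mul_comm]) (by rwa [mul_comm, Nat.mul_succ])]

theorem mem_of_div_eq {n k q : ℕ} (hn : 1 ≤ n) (h : q / n = k) : n * k ≤ q ∧ q < n * k + n := by
  subst h
  exact ⟨Nat.mul_div_le q n, by rw [← Nat.mul_succ]; exact Nat.lt_mul_div_succ q hn⟩

theorem GoodLabels.isSortedBlock {W t n p : ℕ} {ℓ : ℕ → ℕ} (h : GoodLabels W t ℓ) (hn : 1 ≤ n)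
    (hp : p + 2 ≤ W) :
    IsSortedBlock (n * W) (n * p) n (ℓ p) (ℓ (p + 1)) (copyLabels n ℓ) := by
  have e1 : n * (p + 1) = n * p + n := by ring
  have e2 : n * (p + 2) = n * p + 2 * n := by ring
  have u : ∀ q, n * p ≤ q → q < n * p + n → copyLabels n ℓ q = ℓ p := fun q =>
    copyLabels_of_mem
  have l : ∀ q, n * p + n ≤ q → q < n * p + 2 * n → copyLabels n ℓ q = ℓ (p + 1) := fun q h1 h2 =>
    copyLabels_of_mem (by omega) (by omega)
  refine ⟨⟨?_, fun e => ?_, fun q h1 h2 => ?_, fun q h1 h2 => ?_⟩, u, l⟩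
  · rw [← e2]; exact Nat.mul_le_mul_left n hp
  · have := h.inj p (by omega) (p + 1) (by omega) e
    omega
  · by_cases h3 : q < n * p + n
    · exact Or.inl (u q h1 h3)
    · exact Or.inr (l q (by omega) h2)
  · have hq : q / n < W := Nat.div_lt_of_lt_mul h1
    rcases h2 with h2 | h2
    · have := mem_of_div_eq hn (h.inj _ hq p (by omega) h2)
      omega
    · have := mem_of_div_eq hn (h.inj _ hq (p + 1) (by omega) h2)
      omega

theorem IsBlock.of_blockLabels {N lo hi a b : ℕ} {base : ℕ → ℕ} {S S' : ℕ → Prop}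
    (h : IsBlock N lo hi a b (blockLabels lo hi a b base S)) :
    IsBlock N lo hi a b (blockLabels lo hi a b base S') := by
  refine ⟨h.le, h.ne, fun q h1 h2 => ?_, fun q h1 h2 => ?_⟩
  · by_cases h3 : S' q
    · exact Or.inr (blockLabels_pos h1 h2 h3)
    · exact Or.inl (blockLabels_neg h1 h2 h3)
  · by_contra hc
    rw [blockLabels_out (by omega)] at h2
    exact hc (h.mem q h1 (by rwa [blockLabels_out (by omega)]))

theorem withTag_append (t : ℕ) (u v : Front) : withTag t (u ++ v) = withTag t u ++ withTag t v :=
  List.map_append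

theorem length_withTag (t : ℕ) (u : Front) : (withTag t u).length = u.length := List.length_map _

theorem labelsAt_withTag_append_left {t : ℕ} {u v : Front} {lab : ℕ → ℕ} {i : ℕ}
    (h : i ≤ u.length) : labelsAt (withTag t (u ++ v)) lab i = labelsAt (withTag t u) lab i := by
  rw [withTag_append, labelsAt_append_left (by rwa [length_withTag])]

theorem labelsAt_withTag_append_right (t : ℕ) (u v : Front) (lab : ℕ → ℕ) (i : ℕ) :
    labelsAt (withTag t (u ++ v)) lab (u.length + i) =
      labelsAt (withTag t v) ((withTag t u).foldl relabel lab) i := by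
  rw [withTag_append, ← length_withTag t u, labelsAt_append_right]

/-- Purity of parallel strands is carried from the left to the right end of the `n`-copy of the
singularity `e` and, at a cusp, from one branch to the other. -/
def PurityStep (n t : ℕ) (e : Event) (ℓ : ℕ → ℕ) (ρ ρ' : Equiv.Perm ℕ) : Prop :=
  match e.kind with
  | .crossing => ∀ X,
      PureLabel X (copyLabels n ℓ) ρ ↔ PureLabel X (copyLabels n (relabel ℓ (e, t))) ρ'
  | .leftCusp => (∀ X, X ≠ 2 * t → X ≠ 2 * t + 1 →
      (PureLabel X (copyLabels n ℓ) ρ ↔ PureLabel X (copyLabels n (relabel ℓ (e, t))) ρ')) ∧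
      (PureLabel (2 * t) (copyLabels n (relabel ℓ (e, t))) ρ' ↔
        PureLabel (2 * t + 1) (copyLabels n (relabel ℓ (e, t))) ρ')
  | .rightCusp => (∀ X, X ≠ ℓ e.pos → X ≠ ℓ (e.pos + 1) →
      (PureLabel X (copyLabels n ℓ) ρ ↔ PureLabel X (copyLabels n (relabel ℓ (e, t))) ρ')) ∧
      (PureLabel (ℓ e.pos) (copyLabels n ℓ) ρ ↔ PureLabel (ℓ (e.pos + 1)) (copyLabels n ℓ) ρ)

/-- Properties of a normal ruling `σ` of the `n`-copy of the singularity `e`: the labels at the right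
end are the copies of the labels in `K`, purity is carried through the singularity, and purity at both
ends implies purity everywhere in between. -/
structure CopyFacts (n t : ℕ) (e : Event) (ℓ : ℕ → ℕ) (σ : ℕ → Equiv.Perm ℕ) : Prop where
  labels : (withTag t (copyEvent n e)).foldl relabel (copyLabels n ℓ) =
    copyLabels n (relabel ℓ (e, t))
  purity : PurityStep n t e ℓ (σ 0) (σ (copyEvent n e).length)
  inner : ∀ X, PureLabel X (copyLabels n ℓ) (σ 0) →
    PureLabel X (copyLabels n (relabel ℓ (e, t))) (σ (copyEvent n e).length) →
      ∀ i ≤ (copyEvent n e).length,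
        PureLabel X (labelsAt (withTag t (copyEvent n e)) (copyLabels n ℓ) i) (σ i)

theorem copyFacts_crossing {n W t p : ℕ} {ℓ : ℕ → ℕ} {σ : ℕ → Equiv.Perm ℕ} (hn : 1 ≤ n)
    (hp : p + 2 ≤ W) (h : GoodLabels W t ℓ) (hpath : IsPath (copyEvent n (cr p)) σ)
    (h0 : IsMatching (n * W) (σ 0)) : CopyFacts n t (cr p) ℓ σ := by
  have sb := h.isSortedBlock hn hp
  have sb' := (h.relabel (e := cr p) (by simpa [Kind.ins] using hp)).isSortedBlock (p := p) hn
    (by simp only [Kind.ins, Kind.outs]; omega)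
  have l1 : relabel ℓ (cr p, t) p = ℓ (p + 1) := by simp [relabel]
  have l2 : relabel ℓ (cr p, t) (p + 1) = ℓ p := by simp [relabel]
  have l3 : W - (cr p).kind.ins + (cr p).kind.outs = W := by simp only [Kind.ins, Kind.outs]; omega
  rw [l1, l2, l3] at sb'
  have run := crossingRun_copy_crossing n p (ℓ p) (ℓ (p + 1)) (copyLabels n ℓ)
  have b1 : blockLabels (n * p) (n * p + 2 * n) (ℓ p) (ℓ (p + 1)) (copyLabels n ℓ)
      (fun q => n * p + n ≤ q) = copyLabels n ℓ := by
    funext q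
    by_cases hq : n * p ≤ q ∧ q < n * p + 2 * n
    · by_cases hq' : n * p + n ≤ q
      · rw [blockLabels_pos hq.1 hq.2 hq', sb.lower q hq' hq.2]
      · rw [blockLabels_neg hq.1 hq.2 hq', sb.upper q hq.1 (by omega)]
    · rw [blockLabels_out (by omega)]
  have b2 : blockLabels (n * p) (n * p + 2 * n) (ℓ p) (ℓ (p + 1)) (copyLabels n ℓ)
      (fun q => q < n * p + n) = copyLabels n (relabel ℓ (cr p, t)) := by
    funext q
    by_cases hq : n * p ≤ q ∧ q < n * p + 2 * n
    · by_cases hq' : q < n * p + n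
      · rw [blockLabels_pos hq.1 hq.2 hq', sb'.upper q hq.1 hq']
      · rw [blockLabels_neg hq.1 hq.2 hq', sb'.lower q (by omega) hq.2]
    · rw [blockLabels_out (by omega)]
      change ℓ (q / n) = ℓ (Equiv.swap p (p + 1) (q / n))
      have e1 : q / n ≠ p := fun e => hq (by have := mem_of_div_eq hn e; omega)
      have e2 : q / n ≠ p + 1 := fun e => hq (by
        have := mem_of_div_eq hn e
        rw [Nat.mul_succ] at this
        omega)
      rw [Equiv.swap_apply_of_ne_of_ne e1 e2]
  rw [b1, b2] at run
  have fwd : ∀ X, PureLabel X (copyLabels n ℓ) (σ 0) → ∀ i ≤ (copyEvent n (cr p)).length,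
      PureLabel X (labelsAt (withTag t (copyEvent n (cr p))) (copyLabels n ℓ) i) (σ i) :=
    fun X => run.pureLabel_of_start hpath h0 sb t
  refine ⟨run.foldl_relabel t, fun X => ⟨fun hX => ?_, fun hX => ?_⟩, fun X hX _ => fwd X hX⟩
  · have := fwd X hX _ le_rfl
    rwa [run.labelsAt_length] at this
  · exact run.pureLabel_of_end hpath h0 sb.toIsBlock sb' t hX 0 (Nat.zero_le _)

/-- The left cusps pair the `2 n` new strands among themselves, and the subsequent crossings sort the
strands, so that purity propagates from the right end into the crossings. -/
theorem copyFacts_leftCusp {n W t p : ℕ} {ℓ : ℕ → ℕ} {σ : ℕ → Equiv.Perm ℕ} (hn : 1 ≤ n)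
    (hp : p ≤ W) (h : GoodLabels W t ℓ) (hpath : IsPath (copyEvent n (lc p)) σ)
    (h0 : IsMatching (n * W) (σ 0)) : CopyFacts n t (lc p) ℓ σ := by
  have hlo : n * p ≤ n * W := Nat.mul_le_mul_left n hp
  have sb' := (h.relabel (e := lc p) (by simpa [Kind.ins] using hp)).isSortedBlock (p := p) hn
    (by simp only [Kind.ins, Kind.outs]; omega)
  have l1 : relabel ℓ (lc p, t) p = 2 * t := by simp [relabel]
  have l2 : relabel ℓ (lc p, t) (p + 1) = 2 * t + 1 := by simp [relabel]
  have l3 : n * (W - (lc p).kind.ins + (lc p).kind.outs) = n * W + 2 * n := by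
    simp only [Kind.ins, Kind.outs]; rw [Nat.sub_zero]; ring
  rw [l1, l2, l3] at sb'
  have cusps := leftCusps_path (t := t) (lab := copyLabels n ℓ) hlo (isPath_append.1 hpath).1 h0
  obtain ⟨m1, m2, -⟩ := cusps n le_rfl
  have hstack := labelsAt_leftCusps (n * p) t n (copyLabels n ℓ) n le_rfl
  have run := crossingRun_left n (n * p) (2 * t + 1) (2 * t) hn
    (fun q => if q < n * p then copyLabels n ℓ q else copyLabels n ℓ (q - 2 * n))
  have hsplit : copyEvent n (lc p) = ((List.range n).map fun j => lc (n * p + 2 * j)) ++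
      (List.range (n - 1)).flatMap fun d => crossingRow n (n * p) (d + 1) := rfl
  rw [hsplit, isPath_append] at hpath
  obtain ⟨-, hpath⟩ := hpath
  have hlen : ((List.range n).map fun j => lc (n * p + 2 * j)).length = n := by simp
  generalize hU : ((List.range n).map fun j => lc (n * p + 2 * j)) = U at *
  generalize ((List.range (n - 1)).flatMap fun d => crossingRow n (n * p) (d + 1)) = V at *
  have hfold : (withTag t U).foldl relabel (copyLabels n ℓ) = labelsAt (withTag t U)
      (copyLabels n ℓ) n := by
    rw [labelsAt, List.take_of_length_le (by rw [length_withTag, hlen])]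
  have b2 : blockLabels (n * p) (n * p + 2 * n) (2 * t + 1) (2 * t)
      (fun q => if q < n * p then copyLabels n ℓ q else copyLabels n ℓ (q - 2 * n))
      (fun q => q < n * p + n) = copyLabels n (relabel ℓ (lc p, t)) := by
    funext q
    by_cases hq : n * p ≤ q ∧ q < n * p + 2 * n
    · by_cases hq' : q < n * p + n
      · rw [blockLabels_pos hq.1 hq.2 hq', sb'.upper q hq.1 hq']
      · rw [blockLabels_neg hq.1 hq.2 hq', sb'.lower q (by omega) hq.2]
    · rw [blockLabels_out (by omega)]
      change _ = relabel ℓ (lc p, t) (q / n)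
      by_cases hq' : q < n * p
      · have : q / n < p := Nat.div_lt_of_lt_mul hq'
        simp [relabel, copyLabels, hq', this]
      · have h3 : p + 2 ≤ q / n := (Nat.le_div_iff_mul_le hn).2 (by
          have : (p + 2) * n = n * p + 2 * n := by ring
          omega)
        have h4 : (q - 2 * n) / n = q / n - 2 := by
          rw [mul_comm]; exact Nat.sub_mul_div q n 2
        rw [if_neg hq', copyLabels, h4]
        simp only [relabel]
        rw [if_neg (by omega), if_neg (by omega), if_neg (by omega)]
  rw [b2] at run
  have sbl : IsBlock (n * W + 2 * n) (n * p) (n * p + 2 * n) (2 * t + 1) (2 * t)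
      (labelsAt (withTag t U) (copyLabels n ℓ) n) := by
    have := sb'.toIsBlock.symm
    rw [← b2] at this
    rw [hstack]
    exact this.of_blockLabels
  rw [← hstack] at run
  have hnn : IsMatching (n * W + 2 * n) (σ (U.length + 0)) := by rw [hlen]; exact m1
  have final : labelsAt (withTag t V) (labelsAt (withTag t U) (copyLabels n ℓ) n) V.length =
      copyLabels n (relabel ℓ (lc p, t)) := run.labelsAt_length t
  have other : ∀ X, X ≠ 2 * t → X ≠ 2 * t + 1 → ∀ i ≤ V.length,
      (PureLabel X (labelsAt (withTag t V) (labelsAt (withTag t U) (copyLabels n ℓ) n) i)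
        (σ (U.length + i)) ↔ PureLabel X (copyLabels n ℓ) (σ 0)) := fun X h1 h2 i hi => by
    refine (run.pureLabel_of_ne h2 h1 hpath hnn sbl t i hi).trans ?_
    have := (cusps n le_rfl).2.2 X
    rw [← hlen] at this ⊢
    exact this
  refine ⟨?_, ⟨fun X h1 h2 => ?_, ?_⟩, fun X _ hX i hi => ?_⟩
  · rw [hsplit, withTag_append, List.foldl_append, hfold, run.foldl_relabel]
  · have := other X h1 h2 _ le_rfl
    rw [final] at this
    rw [hsplit, List.length_append]
    exact this.symm
  · rw [hsplit, List.length_append]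
    refine sb'.pureLabel_iff_of_closed (run.isMatching hpath hnn sbl) ?_
    refine (run.closed_iff hpath hnn sbl).2 ?_
    rw [add_zero, hlen]
    exact m2
  · rw [hsplit] at hi hX ⊢
    rw [List.length_append] at hi hX
    by_cases hiU : i ≤ U.length
    · rw [labelsAt_withTag_append_left hiU]
      refine ((cusps i (hlen ▸ hiU)).2.2 X).2 ?_
      assumption
    · obtain ⟨j, rfl⟩ : ∃ j, i = U.length + j := ⟨i - U.length, by omega⟩
      rw [labelsAt_withTag_append_right, hfold]
      exact run.pureLabel_of_end hpath hnn sbl sb' t hX j (by omega)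

/-- The right cusps force the `2 n` strands that end there to be paired among themselves.  The
preceding crossings start with sorted strands, so that purity propagates from the left end. -/
theorem copyFacts_rightCusp {n W t p : ℕ} {ℓ : ℕ → ℕ} {σ : ℕ → Equiv.Perm ℕ} (hn : 1 ≤ n)
    (hp : p + 2 ≤ W) (h : GoodLabels W t ℓ) (hpath : IsPath (copyEvent n (rc p)) σ)
    (h0 : IsMatching (n * W) (σ 0)) : CopyFacts n t (rc p) ℓ σ := by
  have sb := h.isSortedBlock hn hp
  have run := crossingRun_right n (n * p) (ℓ p) (ℓ (p + 1)) hn (copyLabels n ℓ)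
  have b1 : blockLabels (n * p) (n * p + 2 * n) (ℓ p) (ℓ (p + 1)) (copyLabels n ℓ)
      (fun q => n * p + n ≤ q) = copyLabels n ℓ := by
    funext q
    by_cases hq : n * p ≤ q ∧ q < n * p + 2 * n
    · by_cases hq' : n * p + n ≤ q
      · rw [blockLabels_pos hq.1 hq.2 hq', sb.lower q hq' hq.2]
      · rw [blockLabels_neg hq.1 hq.2 hq', sb.upper q hq.1 (by omega)]
    · rw [blockLabels_out (by omega)]
  rw [b1] at run
  have hsplit : copyEvent n (rc p) =
      ((List.range (n - 1)).flatMap fun d => crossingRow n (n * p) (n - 1 - d)) ++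
        List.replicate n (rc (n * p)) := rfl
  rw [hsplit, isPath_append] at hpath
  obtain ⟨hpath, hcusp⟩ := hpath
  generalize ((List.range (n - 1)).flatMap fun d => crossingRow n (n * p) (n - 1 - d)) = U at *
  have cusps := rightCusps_path (t := t) hcusp (lab := blockLabels (n * p) (n * p + 2 * n) (ℓ p)
    (ℓ (p + 1)) (copyLabels n ℓ) fun q => (q + n * p) % 2 = 1) (fun j hj => by
      rw [blockLabels_neg (by omega) (by omega) (by omega),
        blockLabels_pos (by omega) (by omega) (by omega)]
      exact sb.ne)
  have fwd : ∀ X, PureLabel X (copyLabels n ℓ) (σ 0) → ∀ i ≤ U.length,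
      PureLabel X (labelsAt (withTag t U) (copyLabels n ℓ) i) (σ i) :=
    fun X => run.pureLabel_of_start hpath h0 sb t
  have fold : (withTag t (List.replicate n (rc (n * p)))).foldl relabel
      (blockLabels (n * p) (n * p + 2 * n) (ℓ p)
        (ℓ (p + 1)) (copyLabels n ℓ) fun q => (q + n * p) % 2 = 1) =
      copyLabels n (relabel ℓ (rc p, t)) := by
    rw [foldl_rightCusps]
    funext q
    change _ = ℓ (skip p (q / n))
    by_cases hq : q < n * p
    · rw [if_pos hq, blockLabels_out (Or.inl hq), copyLabels, skip,
        if_pos (Nat.div_lt_of_lt_mul hq)]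
    · have : ¬ q / n < p := by
        have := (Nat.le_div_iff_mul_le hn).2 (show p * n ≤ q by rw [mul_comm]; omega)
        omega
      rw [if_neg hq, blockLabels_out (by omega), copyLabels, skip, if_neg this,
        Nat.add_mul_div_right q 2 hn]
  have final : labelsAt (withTag t (List.replicate n (rc (n * p))))
      (blockLabels (n * p) (n * p + 2 * n) (ℓ p)
        (ℓ (p + 1)) (copyLabels n ℓ) fun q => (q + n * p) % 2 = 1) n =
      copyLabels n (relabel ℓ (rc p, t)) := by
    rw [← fold, labelsAt, List.take_of_length_le (by simp [withTag])]
  refine ⟨?_, ⟨fun X h1 h2 => ?_, ?_⟩, fun X hX _ i hi => ?_⟩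
  · rw [hsplit, withTag_append, List.foldl_append, run.foldl_relabel, fold]
  · have e1 := run.pureLabel_of_ne h1 h2 hpath h0 sb.toIsBlock t _ le_rfl
    have e2 := cusps.2 X n le_rfl
    rw [run.labelsAt_length] at e1
    rw [final] at e2
    rw [hsplit, List.length_append, List.length_replicate]
    exact e1.symm.trans e2.symm
  · exact sb.pureLabel_iff_of_closed h0 ((run.closed_iff hpath h0 sb.toIsBlock).1 cusps.1)
  · rw [hsplit] at hi ⊢
    by_cases hiU : i ≤ U.length
    · rw [labelsAt_withTag_append_left hiU]
      exact fwd X hX i hiU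
    · obtain ⟨j, rfl⟩ : ∃ j, i = U.length + j := ⟨i - U.length, by omega⟩
      rw [List.length_append, List.length_replicate] at hi
      rw [labelsAt_withTag_append_right, run.foldl_relabel]
      refine (cusps.2 X j (by omega)).2 ?_
      have := fwd X hX _ le_rfl
      rwa [run.labelsAt_length] at this

theorem copyFacts {n W t : ℕ} {e : Event} {ℓ : ℕ → ℕ} {σ : ℕ → Equiv.Perm ℕ} (hn : 1 ≤ n)
    (he : e.pos + e.kind.ins ≤ W) (h : GoodLabels W t ℓ) (hpath : IsPath (copyEvent n e) σ)
    (h0 : IsMatching (n * W) (σ 0)) : CopyFacts n t e ℓ σ := by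
  obtain ⟨k, p⟩ := e
  cases k with
  | crossing => exact copyFacts_crossing hn he h hpath h0
  | leftCusp => exact copyFacts_leftCusp hn he h hpath h0
  | rightCusp => exact copyFacts_rightCusp hn he h hpath h0

/-! ### Purity along the `n`-copy of a front -/

theorem CrossingRun.runs {N lo hi a b : ℕ} {w : Front} {lab lab' : ℕ → ℕ}
    (h : CrossingRun lo hi a b w lab lab') (hN : hi ≤ N) : Runs w N N := by
  induction w generalizing lab with
  | nil => rfl
  | cons e w ih =>
    obtain ⟨k, p⟩ := e
    obtain ⟨⟨h1, h2, h3, -, -⟩, h⟩ := h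
    obtain rfl : k = .crossing := h1
    simp only at h3
    exact runs_cr_iff.2 ⟨by omega, ih h⟩

theorem runs_leftCusps {lo N : ℕ} (hlo : lo ≤ N) (n : ℕ) :
    Runs ((List.range n).map fun j => lc (lo + 2 * j)) N (N + 2 * n) := by
  induction n with
  | zero => rfl
  | succ n ih =>
    rw [List.range_succ, List.map_append]
    refine runs_append ih ⟨?_, ?_⟩
    · simp only [Kind.ins]; omega
    · change N + 2 * n - 0 + 2 = N + 2 * (n + 1)
      omega

theorem runs_rightCusps {lo N : ℕ} (n : ℕ) (hlo : lo + 2 * n ≤ N) :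
    Runs (List.replicate n (rc lo)) N (N - 2 * n) := by
  induction n generalizing N with
  | zero => rfl
  | succ n ih =>
    refine ⟨?_, ?_⟩
    · simp only [Kind.ins]; omega
    · have := ih (N := N - 2) (by omega)
      have e : N - 2 * (n + 1) = N - 2 - 2 * n := by omega
      rw [e]
      exact this

theorem runs_copyEvent {n W : ℕ} {e : Event} (hn : 1 ≤ n) (he : e.pos + e.kind.ins ≤ W) :
    Runs (copyEvent n e) (n * W) (n * (W - e.kind.ins + e.kind.outs)) := by
  obtain ⟨k, p⟩ := e
  have hmul : n * p + n * k.ins ≤ n * W := by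
    rw [← mul_add]; exact Nat.mul_le_mul_left n he
  cases k with
  | crossing =>
    simp only [Kind.ins, Kind.outs] at he hmul ⊢
    have e1 : W - 2 + 2 = W := by omega
    rw [e1]
    exact (crossingRun_copy_crossing n p 0 1 fun _ => 0).runs (by omega)
  | leftCusp =>
    simp only [Kind.ins, Kind.outs] at he hmul ⊢
    have e1 : n * (W - 0 + 2) = n * W + 2 * n := by rw [Nat.sub_zero]; ring
    rw [e1]
    exact runs_append (runs_leftCusps (by omega) n)
      ((crossingRun_left n (n * p) 0 1 hn fun _ => 0).runs (by omega))
  | rightCusp =>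
    simp only [Kind.ins, Kind.outs] at he hmul ⊢
    have e1 : n * (W - 2 + 0) = n * W - 2 * n := by rw [add_zero, Nat.mul_sub, mul_comm n 2]
    have e2 : n * p + n * 2 ≤ n * W := hmul
    rw [e1]
    exact runs_append ((crossingRun_right n (n * p) 0 1 hn fun _ => 0).runs (by omega))
      (runs_rightCusps (lo := n * p) n (by omega))

theorem runs_nCopy {n a b : ℕ} (hn : 1 ≤ n) {w : Front} (h : Runs w a b) :
    Runs (nCopy n w) (n * a) (n * b) := by
  induction w generalizing a with
  | nil => simp only [Runs] at h; subst h; rfl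
  | cons e w ih => exact runs_append (runs_copyEvent hn h.1) (ih h.2)

theorem Runs.widthAfter_eq {w : Front} {a b : ℕ} (h : Runs w a b) : widthAfter w a = b := by
  induction w generalizing a with
  | nil => exact h
  | cons e w ih => exact ih h.2

theorem widthAfter_append (u v : Front) (a : ℕ) :
    widthAfter (u ++ v) a = widthAfter v (widthAfter u a) := by
  induction u generalizing a with
  | nil => rfl
  | cons e u ih => exact ih _

theorem Runs.getElem? {w : Front} {a b i : ℕ} {e : Event} (h : Runs w a b) (he : w[i]? = some e) :
    e.pos + e.kind.ins ≤ widthAfter (w.take i) a ∧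
      widthAfter (w.take (i + 1)) a = widthAfter (w.take i) a - e.kind.ins + e.kind.outs := by
  induction w generalizing a i with
  | nil => simp at he
  | cons e' w ih =>
    cases i with
    | zero =>
      obtain rfl : e' = e := by simpa using he
      exact ⟨h.1, rfl⟩
    | succ i => exact ih h.2 (by simpa using he)

theorem GoodLabels.labelsAt {w : Front} {a b t i : ℕ} {ℓ : ℕ → ℕ} (h : Runs w a b)
    (hℓ : GoodLabels a t ℓ) (hi : i ≤ w.length) :
    GoodLabels (widthAfter (w.take i) a) (t + i) (labelsAt (w.zipIdx t) ℓ i) := by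
  induction w generalizing a t i ℓ with
  | nil =>
    obtain rfl : i = 0 := by simpa using hi
    exact hℓ
  | cons e w ih =>
    cases i with
    | zero => exact hℓ
    | succ i =>
      have := ih h.2 (hℓ.relabel h.1) (by simpa using hi)
      rw [add_assoc, add_comm 1 i] at this
      exact this

/-- Number of singularities in the `n`-copy of the first `i` singularities. -/
def copyPos (n : ℕ) (w : Front) (i : ℕ) : ℕ := (nCopy n (w.take i)).length

theorem copyPos_cons_succ (n : ℕ) (e : Event) (w : Front) (i : ℕ) :
    copyPos n (e :: w) (i + 1) = (copyEvent n e).length + copyPos n w i := by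
  rw [copyPos, List.take_succ_cons, nCopy, List.flatMap_cons, List.length_append]
  rfl

theorem copyPos_length (n : ℕ) (w : Front) : copyPos n w w.length = (nCopy n w).length := by
  rw [copyPos, List.take_length]

theorem taggedCopy_cons (n t : ℕ) (e : Event) (w : Front) :
    taggedCopy n t (e :: w) = withTag t (copyEvent n e) ++ taggedCopy n (t + 1) w := rfl

theorem length_taggedCopy (n t : ℕ) (w : Front) :
    (taggedCopy n t w).length = (nCopy n w).length := by
  induction w generalizing t with
  | nil => rfl
  | cons e w ih =>
    have : nCopy n (e :: w) = copyEvent n e ++ nCopy n w := rfl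
    rw [taggedCopy_cons, List.length_append, ih, length_withTag, this, List.length_append]

/-- The properties `CopyFacts` for the singularities of a front with `a` strands at its left end, where
`t` is the index of its first singularity. -/
structure CopyFrontFacts (n t a : ℕ) (w : Front) (ℓ : ℕ → ℕ) (σ : ℕ → Equiv.Perm ℕ) : Prop where
  labels : (taggedCopy n t w).foldl relabel (copyLabels n ℓ) =
    copyLabels n ((w.zipIdx t).foldl relabel ℓ)
  isMatching : ∀ i ≤ w.length, IsMatching (n * widthAfter (w.take i) a) (σ (copyPos n w i))
  purity : ∀ i e, w[i]? = some e → PurityStep n (t + i) e (labelsAt (w.zipIdx t) ℓ i)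
    (σ (copyPos n w i)) (σ (copyPos n w (i + 1)))
  inner : (∀ i ≤ w.length,
    NoParallelPair (copyLabels n (labelsAt (w.zipIdx t) ℓ i)) (σ (copyPos n w i))) →
      ∀ i ≤ (nCopy n w).length,
        NoParallelPair (labelsAt (taggedCopy n t w) (copyLabels n ℓ) i) (σ i)

theorem copyFrontFacts {n t a b : ℕ} {w : Front} {ℓ : ℕ → ℕ} {σ : ℕ → Equiv.Perm ℕ} (hn : 1 ≤ n)
    (hw : Runs w a b) (hℓ : GoodLabels a t ℓ) (hpath : IsPath (nCopy n w) σ)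
    (h0 : IsMatching (n * a) (σ 0)) : CopyFrontFacts n t a w ℓ σ := by
  induction w generalizing t a ℓ σ with
  | nil =>
    refine ⟨rfl, fun i hi => ?_, fun i e h => by simp at h, fun h i hi => ?_⟩
    · obtain rfl : i = 0 := by simpa using hi
      exact h0
    · obtain rfl : i = 0 := by simpa [nCopy] using hi
      exact h 0 le_rfl
  | cons e w ih =>
    have hsplit : nCopy n (e :: w) = copyEvent n e ++ nCopy n w := rfl
    rw [hsplit, isPath_append] at hpath
    have facts := copyFacts hn hw.1 hℓ hpath.1 h0
    have h1 := hpath.1.isMatching (runs_copyEvent hn hw.1) h0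
    have rest := ih hw.2 (hℓ.relabel hw.1) hpath.2 h1
    refine ⟨?_, fun i hi => ?_, fun i e' h => ?_, fun h => ?_⟩
    · rw [taggedCopy_cons, List.foldl_append, facts.labels, rest.labels]
      rfl
    · cases i with
      | zero => exact h0
      | succ i =>
        rw [copyPos_cons_succ]
        exact rest.isMatching i (by simpa using hi)
    · cases i with
      | zero =>
        obtain rfl : e = e' := by simpa using h
        rw [copyPos_cons_succ]
        exact facts.purity
      | succ i =>
        rw [copyPos_cons_succ, copyPos_cons_succ]
        have := rest.purity i e' (by simpa using h)
        rw [add_assoc, add_comm 1 i] at this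
        exact this
    · have key := rest.inner fun i hi => by
        have := h (i + 1) (by simpa using hi)
        rwa [copyPos_cons_succ] at this
      intro i hi
      rw [taggedCopy_cons]
      by_cases hi' : i ≤ (copyEvent n e).length
      · rw [labelsAt_append_left (by rwa [length_withTag])]
        rw [noParallelPair_iff]
        refine fun X => facts.inner X (noParallelPair_iff.1 (h 0 (Nat.zero_le _)) X) ?_ i hi'
        have := h 1 (by simp)
        rw [copyPos_cons_succ] at this
        exact noParallelPair_iff.1 this X
      · obtain ⟨j, rfl⟩ : ∃ j, i = (copyEvent n e).length + j :=
          ⟨i - (copyEvent n e).length, by omega⟩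
        rw [hsplit, List.length_append] at hi
        have := key j (by omega)
        rw [← facts.labels] at this
        have e1 := labelsAt_append_right (withTag t (copyEvent n e)) (taggedCopy n (t + 1) w)
          (copyLabels n ℓ) j
        rw [length_withTag] at e1
        rw [e1]
        exact this

/-! ### Purity along a connected knot -/

/-- The labels of the strands of a front without left end. -/
def frontLabels (w : Front) (t : ℕ) : ℕ → ℕ := labelsAt (w.zipIdx 0) (fun _ => 0) t

theorem frontLabels_succ {w : Front} {t : ℕ} {e : Event} (h : w[t]? = some e) :
    frontLabels w (t + 1) = relabel (frontLabels w t) (e, t) := by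
  rw [frontLabels, labelsAt_succ (x := (e, t)) (by simp [List.getElem?_zipIdx, h])]
  rfl

theorem frontLabels_append_left {u v : Front} {t : ℕ} (h : t ≤ u.length) :
    frontLabels (u ++ v) t = labelsAt (u.zipIdx 0) (fun _ => 0) t := by
  rw [frontLabels, List.zipIdx_append, labelsAt_append_left (by simpa using h)]

theorem frontLabels_append_right (u v : Front) (t : ℕ) :
    frontLabels (u ++ v) (u.length + t) =
      labelsAt (v.zipIdx u.length) ((u.zipIdx 0).foldl relabel fun _ => 0) t := by
  have := labelsAt_append_right (u.zipIdx 0) (v.zipIdx (0 + u.length)) (fun _ => 0) t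
  rw [List.length_zipIdx, zero_add] at this
  rw [frontLabels, List.zipIdx_append, zero_add, this]

theorem goodLabels_frontLabels {w : Front} {b : ℕ} (h : Runs w 0 b) {t : ℕ} (ht : t ≤ w.length) :
    GoodLabels (widthAfter (w.take t) 0) t (frontLabels w t) := by
  have h0 : GoodLabels 0 0 fun _ => 0 := ⟨fun q hq => by omega, fun q hq => by omega⟩
  have := h0.labelsAt h ht
  rwa [zero_add] at this

/-- If the front is connected, then the parallel copies of one strand are not paired among
themselves if and only if the same holds for any other strand.  Here `ρ t` and `ρ' t` are the
pairings of the `n`-copy to the right and to the left of a tangle that is possibly inserted after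
the first `t` singularities. -/
theorem pureLabel_iff_of_isConnected {n b : ℕ} {w : Front} (hw : Runs w 0 b)
    (hconn : IsConnected w) {ρ ρ' : ℕ → Equiv.Perm ℕ}
    (hstep : ∀ t e, w[t]? = some e → PurityStep n t e (frontLabels w t) (ρ t) (ρ' (t + 1)))
    (hsame : ∀ t X, PureLabel X (copyLabels n (frontLabels w t)) (ρ' t) ↔
      PureLabel X (copyLabels n (frontLabels w t)) (ρ t))
    {t t' q q' : ℕ} (ht : t ≤ w.length) (ht' : t' ≤ w.length) (hq : q < widthAfter (w.take t) 0)
    (hq' : q' < widthAfter (w.take t') 0) :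
    PureLabel (frontLabels w t q) (copyLabels n (frontLabels w t)) (ρ t) ↔
      PureLabel (frontLabels w t' q') (copyLabels n (frontLabels w t')) (ρ t') := by
  set P : ℕ × ℕ → Prop := fun x => x.2 < widthAfter (w.take x.1) 0 →
    PureLabel (frontLabels w x.1 x.2) (copyLabels n (frontLabels w x.1)) (ρ x.1) with hP
  have hlen : ∀ {t e}, w[t]? = some e → t < w.length := fun h =>
    (List.getElem?_eq_some_iff.1 h).1
  have joined : ∀ x y, Joined w x y → (P x ↔ P y) := by
    intro x y h
    cases h with
    | @crossing t p q h =>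
      have h1 := hw.getElem? h
      have h2 := hstep t _ h
      simp only [Kind.ins, Kind.outs] at h1
      have h3 : Equiv.swap p (p + 1) q < widthAfter (w.take (t + 1)) 0 ↔
          q < widthAfter (w.take t) 0 := by
        rw [swap_val]; split_ifs <;> omega
      simp only [hP, h3, ← hsame (t + 1)]
      rw [frontLabels_succ h] at *
      have h4 : relabel (frontLabels w t) (cr p, t) (Equiv.swap p (p + 1) q) = frontLabels w t q := by
        simp [relabel]
      rw [h4, h2 (frontLabels w t q)]
    | @leftPass t p q h =>
      have h1 := hw.getElem? h
      have h2 := (hstep t _ h).1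
      simp only [Kind.ins, Kind.outs] at h1
      have h3 : skip p q < widthAfter (w.take (t + 1)) 0 ↔ q < widthAfter (w.take t) 0 := by
        rw [skip]; split_ifs <;> omega
      simp only [hP, h3, ← hsame (t + 1)]
      rw [frontLabels_succ h] at *
      rw [relabel_left_skip]
      refine forall_congr' fun hq => ?_
      have := (goodLabels_frontLabels hw (hlen h).le).lt q hq
      exact h2 _ (by omega) (by omega)
    | @leftTip t p h =>
      have h1 := hw.getElem? h
      have h2 := (hstep t _ h).2
      simp only [Kind.ins, Kind.outs] at h1
      simp only [hP, ← hsame (t + 1)]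
      rw [frontLabels_succ h] at *
      have l1 : relabel (frontLabels w t) (lc p, t) p = 2 * t := by simp [relabel]
      have l2 : relabel (frontLabels w t) (lc p, t) (p + 1) = 2 * t + 1 := by simp [relabel]
      rw [l1, l2]
      exact ⟨fun h _ => h2.1 (h (by omega)), fun h _ => h2.2 (h (by omega))⟩
    | @rightPass t p q h =>
      have h1 := hw.getElem? h
      have h2 := (hstep t _ h).1
      simp only [Kind.ins, Kind.outs] at h1
      have h3 : q < widthAfter (w.take (t + 1)) 0 ↔ skip p q < widthAfter (w.take t) 0 := by
        rw [skip]; split_ifs <;> omega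
      simp only [hP, h3, ← hsame (t + 1)]
      rw [frontLabels_succ h] at *
      refine forall_congr' fun hq => ?_
      have inj := (goodLabels_frontLabels hw (hlen h).le).inj _ hq
      exact h2 _ (fun e => skip_ne_left p q (inj _ (by omega) e))
        (fun e => skip_ne_right p q (inj _ (by omega) e))
    | @rightTip t p h =>
      have h1 := hw.getElem? h
      have h2 := (hstep t _ h).2
      simp only [Kind.ins, Kind.outs] at h1
      simp only [hP]
      exact ⟨fun h _ => h2.1 (h (by omega)), fun h _ => h2.2 (h (by omega))⟩
  have equiv : ∀ x y, Relation.EqvGen (Joined w) x y → (P x ↔ P y) := by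
    intro x y h
    induction h with
    | rel x y h => exact joined x y h
    | refl => rfl
    | symm x y _ ih => exact ih.symm
    | trans x y z _ _ ih1 ih2 => exact ih1.trans ih2
  have := equiv _ _ (hconn t t' q q' ht ht' hq hq')
  exact ⟨fun h => this.1 (fun _ => h) hq', fun h => this.2 (fun _ => h) hq⟩

/-! ### Reduced normal rulings -/

theorem forall₂_scanl_iff {tw : List (Event × ℕ)} {lab : ℕ → ℕ} {l : List (Equiv.Perm ℕ)}
    (hl : l.length = tw.length + 1) :
    List.Forall₂ NoParallelPair (tw.scanl relabel lab) l ↔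
      ∀ i ≤ tw.length, NoParallelPair (labelsAt tw lab i) (l.getD i 1) := by
  induction tw generalizing lab l with
  | nil =>
    obtain ⟨ρ, rfl⟩ := List.length_eq_one_iff.1 hl
    simp [labelsAt]
  | cons x tw ih =>
    cases l with
    | nil => simp at hl
    | cons ρ l =>
      rw [List.scanl_cons, List.forall₂_cons, ih (by simpa using hl)]
      constructor
      · rintro ⟨h1, h2⟩ i hi
        cases i with
        | zero => exact h1
        | succ i => exact h2 i (by simpa using hi)
      · intro h
        exact ⟨h 0 (Nat.zero_le _), fun i hi => h (i + 1) (by simpa using hi)⟩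

/-- Crossings between strands with the same label do not change whether strands with equal labels
are paired. -/
theorem pureLabel_iff_of_parallel {w : Front} {lab : ℕ → ℕ} {X : ℕ} {σ : ℕ → Equiv.Perm ℕ}
    (hw : ∀ e ∈ w, e.kind = .crossing ∧ lab e.pos = lab (e.pos + 1)) (hpath : IsPath w σ) :
    PureLabel X lab (σ w.length) ↔ PureLabel X lab (σ 0) := by
  induction w generalizing σ with
  | nil => rfl
  | cons e w ih =>
    rw [isPath_cons] at hpath
    refine (ih (fun e he => hw e (by simp [he])) hpath.2).trans ?_
    obtain ⟨k, p⟩ := e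
    obtain ⟨rfl, hl⟩ : k = .crossing ∧ lab p = lab (p + 1) := hw ⟨k, p⟩ (by simp)
    have hlab : (fun q => lab (Equiv.swap p (p + 1) q)) = lab := by
      funext q
      rw [swap_val]
      split_ifs with h h'
      · rw [h, hl]
      · rw [h', hl]
      · rfl
    obtain ⟨-, h | ⟨h, -⟩⟩ := hpath.1
    · change PureLabel X lab (σ 1) ↔ _
      rw [h]
      conv_lhs => rw [← hlab]
      exact pureLabel_swap
    · change PureLabel X lab (σ 1) ↔ _
      rw [h]

theorem pos_lt_of_runs_cr {w : Front} {n : ℕ} (hc : ∀ e ∈ w, e.kind = .crossing)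
    (h : Runs w n n) : ∀ e ∈ w, e.pos + 2 ≤ n := by
  induction w with
  | nil => simp
  | cons e w ih =>
    obtain ⟨k, p⟩ := e
    obtain rfl : k = .crossing := hc ⟨k, p⟩ (by simp)
    rw [runs_cr_iff] at h
    intro e he
    rcases List.mem_cons.1 he with rfl | he
    · exact h.1
    · exact ih (fun e he => hc e (by simp [he])) h.2 e he

theorem noPairIn_iff_pureLabel {n W t k : ℕ} {ℓ : ℕ → ℕ} {ρ : Equiv.Perm ℕ} (hn : 1 ≤ n)
    (hk : k < W) (hℓ : GoodLabels W t ℓ) (hρ : IsMatching (n * W) ρ) :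
    NoPairIn (Set.Ico (n * k) (n * k + n)) ρ ↔ PureLabel (ℓ k) (copyLabels n ℓ) ρ := by
  have hle : n * k + n ≤ n * W := by rw [← Nat.mul_succ]; exact Nat.mul_le_mul_left n hk
  have key : ∀ q < n * W, copyLabels n ℓ q = ℓ k ↔ q ∈ Set.Ico (n * k) (n * k + n) := by
    intro q hq
    rw [Set.mem_Ico]
    refine ⟨fun h => ?_, fun h => copyLabels_of_mem h.1 h.2⟩
    exact mem_of_div_eq hn (hℓ.inj _ (Nat.div_lt_of_lt_mul hq) k hk h)
  constructor
  · intro h q hq e e'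
    have hqN : q < n * W := by
      by_contra hc
      exact hq ((hρ.fixed q).2 (by omega))
    exact h q ((key q hqN).1 e) ((key _ (hρ.lt hqN)).1 e')
  · intro h q hq hq'
    have hqN : q < n * W := by rw [Set.mem_Ico] at hq; omega
    exact h q (hρ.ne hqN) ((key q hqN).2 hq) ((key _ (hρ.lt hqN)).2 hq')

theorem noParallelPair_of_pureLabel {n W : ℕ} {ℓ : ℕ → ℕ} {ρ : Equiv.Perm ℕ}
    (hρ : IsMatching (n * W) ρ) (h : ∀ k < W, PureLabel (ℓ k) (copyLabels n ℓ) ρ) :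
    NoParallelPair (copyLabels n ℓ) ρ := by
  intro q hq
  have hqN : q < n * W := by
    by_contra hc
    exact hq ((hρ.fixed q).2 (by omega))
  exact h (q / n) (Nat.div_lt_of_lt_mul hqN) q hq rfl

theorem length_shift (b : ℕ) (w : Front) : (shift b w).length = w.length := List.length_map _

/-- A normal ruling of the satellite by a tangle without cusps is reduced if and only if it pairs no
two of the `n` parallel strands to the left of the tangle. -/
theorem isReduced_iff {n : ℕ} (hn : 1 ≤ n) (K : Knot) (α : Tangle n)
    (hα : ∀ e ∈ α.front, e.kind = .crossing) {l : List (Equiv.Perm ℕ)}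
    (hl : IsNormalRuling (satellite K α) l) :
    IsReduced K α l ↔ NoPairIn (Set.Ico (n * K.strand) (n * K.strand + n))
      (l.getD (nCopy n K.pre).length 1) := by
  obtain ⟨hlen, hpath⟩ := hl.1.isPath
  have hl0 : l.getD 0 1 = 1 := by
    have := hl.2.1
    cases l with
    | nil => rfl
    | cons ρ l => simpa using this
  set σ : ℕ → Equiv.Perm ℕ := fun i => l.getD i 1 with hσ
  rw [satellite, isPath_append, isPath_append] at hpath
  rw [satellite, List.length_append, List.length_append, length_shift] at hlen
  obtain ⟨path1, path2, path3⟩ := hpath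
  rw [length_shift] at path3
  have h0 : IsMatching (n * 0) (σ 0) := by rw [hσ]; simp only [hl0]; exact IsMatching.one
  have hK := K.strand_lt
  have hle : n * K.strand + n ≤ n * K.width := by
    rw [← Nat.mul_succ]; exact Nat.mul_le_mul_left n hK
  have good0 : GoodLabels 0 0 fun _ => 0 := ⟨fun q hq => by omega, fun q hq => by omega⟩
  have facts1 := copyFrontFacts hn K.pre_runs good0 path1 h0
  have m1 := path1.isMatching (runs_nCopy hn K.pre_runs) h0
  have m2 := path2.isMatching (runs_shift_tangle α.runs hle) m1
  rw [length_shift] at m2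
  have hw : Runs (K.pre ++ K.post) 0 0 := runs_append K.pre_runs K.post_runs
  have hlab : frontLabels (K.pre ++ K.post) K.pre.length =
      (K.pre.zipIdx 0).foldl relabel fun _ => 0 := by
    have := frontLabels_append_right K.pre K.post 0
    rwa [add_zero] at this
  have htake : widthAfter ((K.pre ++ K.post).take K.pre.length) 0 = K.width := by
    rw [List.take_left, K.pre_runs.widthAfter_eq]
  have good1 := goodLabels_frontLabels hw (t := K.pre.length) (by simp)
  rw [htake] at good1
  have facts2 := copyFrontFacts hn K.post_runs good1 path3 m2
  rw [noPairIn_iff_pureLabel hn hK good1 m1]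
  have hpre : copyLabels n (fun _ => 0) = fun _ => 0 := rfl
  have e1 := facts1.labels
  rw [hpre, ← hlab] at e1
  have reduced : IsReduced K α l ↔
      (∀ i ≤ (nCopy n K.pre).length,
        NoParallelPair (labelsAt (taggedCopy n 0 K.pre) (fun _ => 0) i) (σ i)) ∧
      ∀ i ≤ (nCopy n K.post).length, NoParallelPair (labelsAt (taggedCopy n K.pre.length K.post)
        (copyLabels n (frontLabels (K.pre ++ K.post) K.pre.length)) i)
          (σ ((nCopy n K.pre).length + (α.front.length + i))) := by
    rw [IsReduced, preLabels, postLabels, e1, forall₂_scanl_iff, forall₂_scanl_iff,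
      length_taggedCopy, length_taggedCopy]
    · refine and_congr (forall₂_congr fun i hi => ?_) (forall₂_congr fun i hi => ?_)
      · rw [hσ, List.getD_eq_getElem?_getD, List.getElem?_take_of_lt (by omega),
          ← List.getD_eq_getElem?_getD]
      · rw [hσ, List.getD_eq_getElem?_getD, List.getElem?_drop, ← List.getD_eq_getElem?_getD,
          add_assoc]
    · rw [List.length_drop, length_taggedCopy]; omega
    · rw [List.length_take, length_taggedCopy]; omega
  rw [reduced]
  constructor
  · rintro ⟨h, -⟩
    have := h _ le_rfl
    rw [← length_taggedCopy n 0, labelsAt_length, e1, length_taggedCopy] at this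
    exact noParallelPair_iff.1 this _
  intro hpure
  -- The pairings to the right and to the left of the tangle, if it is inserted after `t`
  -- singularities.
  set ρ : ℕ → Equiv.Perm ℕ := fun t => if t < K.pre.length then σ (copyPos n K.pre t)
    else σ ((nCopy n K.pre).length + (α.front.length + copyPos n K.post (t - K.pre.length))) with hρ
  set ρ' : ℕ → Equiv.Perm ℕ := fun t => if t ≤ K.pre.length then σ (copyPos n K.pre t)
    else σ ((nCopy n K.pre).length + (α.front.length + copyPos n K.post (t - K.pre.length))) with hρ'
  have hρpost : ∀ i, ρ (K.pre.length + i) =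
      σ ((nCopy n K.pre).length + (α.front.length + copyPos n K.post i)) := fun i => by
    simp only [hρ]
    rw [if_neg (by omega), Nat.add_sub_cancel_left]
  have hstep : ∀ t e, (K.pre ++ K.post)[t]? = some e →
      PurityStep n t e (frontLabels (K.pre ++ K.post) t) (ρ t) (ρ' (t + 1)) := by
    intro t e he
    by_cases ht : t < K.pre.length
    · rw [List.getElem?_append_left ht] at he
      have := facts1.purity t e he
      rw [zero_add] at this
      rw [frontLabels_append_left ht.le]
      simp only [hρ, hρ']
      rw [if_pos ht, if_pos (by omega)]
      exact this
    · obtain ⟨i, rfl⟩ : ∃ i, t = K.pre.length + i := ⟨t - K.pre.length, by omega⟩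
      rw [List.getElem?_append_right (by omega), Nat.add_sub_cancel_left] at he
      have := facts2.purity i e he
      rw [hlab, ← frontLabels_append_right] at this
      have e2 : K.pre.length + i + 1 - K.pre.length = i + 1 := by omega
      rw [hρpost]
      simp only [hρ']
      rw [if_neg (by omega), e2]
      exact this
  have hsame : ∀ t X, PureLabel X (copyLabels n (frontLabels (K.pre ++ K.post) t)) (ρ' t) ↔
      PureLabel X (copyLabels n (frontLabels (K.pre ++ K.post) t)) (ρ t) := by
    intro t X
    rcases lt_trichotomy t K.pre.length with ht | rfl | ht
    · simp only [hρ, hρ']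
      rw [if_pos ht.le, if_pos ht]
    · have hpar : ∀ e ∈ shift (n * K.strand) α.front, e.kind = .crossing ∧
          copyLabels n (frontLabels (K.pre ++ K.post) K.pre.length) e.pos =
            copyLabels n (frontLabels (K.pre ++ K.post) K.pre.length) (e.pos + 1) := by
        intro e he
        obtain ⟨e, he', rfl⟩ := List.mem_map.1 he
        have := pos_lt_of_runs_cr hα α.runs e he'
        refine ⟨hα e he', ?_⟩
        rw [copyLabels_of_mem (k := K.strand) (by simp) (by simp only; omega),
          copyLabels_of_mem (k := K.strand) (by simp only; omega) (by simp only; omega)]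
      have := pureLabel_iff_of_parallel (X := X) hpar path2
      rw [length_shift] at this
      have e2 := hρpost 0
      rw [add_zero] at e2
      rw [e2]
      simp only [hρ']
      rw [if_pos le_rfl, copyPos_length]
      exact this.symm
    · simp only [hρ, hρ']
      rw [if_neg (by omega), if_neg (by omega)]
  have match_ρ : ∀ t ≤ (K.pre ++ K.post).length,
      IsMatching (n * widthAfter ((K.pre ++ K.post).take t) 0) (ρ t) := by
    intro t ht
    by_cases ht' : t < K.pre.length
    · rw [List.take_append_of_le_length ht'.le]
      simp only [hρ]
      rw [if_pos ht']
      exact facts1.isMatching t ht'.le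
    · obtain ⟨i, rfl⟩ : ∃ i, t = K.pre.length + i := ⟨t - K.pre.length, by omega⟩
      rw [List.take_length_add_append, widthAfter_append, K.pre_runs.widthAfter_eq, hρpost]
      exact facts2.isMatching i (by rw [List.length_append] at ht; omega)
  have hpure' : PureLabel (frontLabels (K.pre ++ K.post) K.pre.length K.strand)
      (copyLabels n (frontLabels (K.pre ++ K.post) K.pre.length)) (ρ K.pre.length) := by
    rw [← hsame]
    simp only [hρ']
    rw [if_pos le_rfl, copyPos_length]
    exact hpure
  have all : ∀ t ≤ (K.pre ++ K.post).length,
      NoParallelPair (copyLabels n (frontLabels (K.pre ++ K.post) t)) (ρ t) := fun t ht =>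
    noParallelPair_of_pureLabel (match_ρ t ht) fun k hk =>
      (pureLabel_iff_of_isConnected hw K.connected hstep hsame ht (by simp) hk
        (by rw [htake]; exact hK)).2 hpure'
  refine ⟨facts1.inner fun t ht => ?_, facts2.inner fun t ht => ?_⟩
  · have := all t (by rw [List.length_append]; omega)
    rw [noParallelPair_iff] at this ⊢
    intro X
    have := (hsame t X).2 (this X)
    rw [frontLabels_append_left ht] at this
    simp only [hρ'] at this
    rwa [if_pos ht] at this
  · have := all (K.pre.length + t) (by rw [List.length_append]; omega)
    rwa [hρpost, frontLabels_append_right, ← hlab] at this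

/-! ### Satellite ruling polynomials and the action of the BMW algebra -/

theorem Knot.le_width (n : ℕ) (K : Knot) : n * K.strand + n ≤ n * K.width := by
  rw [← Nat.mul_succ]
  exact Nat.mul_le_mul_left n K.strand_lt

/-- The contribution of the `n`-copy of the part of `K` to the left of the chosen point. -/
noncomputable def Knot.preVector {n : ℕ} (hn : 1 ≤ n) (K : Knot) : matchingSpace (n * K.width) :=
  ⟨transferFront (nCopy n K.pre) (vec 1),
    transferFront_mem (runs_nCopy hn K.pre_runs) (vec_mem_supported IsMatching.one)⟩

/-- The contribution of the `n`-copy of the part of `K` to the right of the chosen point. -/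
noncomputable def Knot.postFunctional (n : ℕ) (K : Knot) :
    matchingSpace (n * K.width) →ₗ[CoeffRing] CoeffRing :=
  Finsupp.lapply 1 ∘ₗ transferFront (nCopy n K.post) ∘ₗ (matchingSpace (n * K.width)).subtype

open Classical in
/-- The part of a vector that is supported on the pairings with the property `Q`. -/
noncomputable def matchingFilter {N : ℕ} (Q : Equiv.Perm ℕ → Prop) (x : matchingSpace N) :
    matchingSpace N :=
  ⟨(x : PairingSpace).filter Q, (Finsupp.mem_supported' _ _).2 fun ρ hρ => by
    rw [Finsupp.filter_apply, (Finsupp.mem_supported' _ _).1 x.2 ρ hρ, ite_self]⟩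

theorem matchingFilter_mem {N : ℕ} (Q : Equiv.Perm ℕ → Prop) (x : matchingSpace N) :
    (matchingFilter Q x : PairingSpace) ∈
      Finsupp.supported CoeffRing CoeffRing {ρ | IsMatching N ρ ∧ Q ρ} := by
  classical
  refine (Finsupp.mem_supported' _ _).2 fun ρ hρ => ?_
  rw [matchingFilter, Finsupp.filter_apply]
  split_ifs with h
  · exact (Finsupp.mem_supported' _ _).1 x.2 ρ fun h' => hρ ⟨h', h⟩
  · rfl

theorem matchingFilter_add {N : ℕ} (Q : Equiv.Perm ℕ → Prop) (x : matchingSpace N) :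
    matchingFilter Q x + matchingFilter (fun ρ => ¬ Q ρ) x = x := by
  classical
  refine Subtype.ext (Finsupp.ext fun ρ => ?_)
  rw [Submodule.coe_add, Finsupp.add_apply, matchingFilter, matchingFilter, Finsupp.filter_apply,
    Finsupp.filter_apply]
  split_ifs <;> simp

theorem postFunctional_tangleAction {n : ℕ} (K : Knot) (α : Tangle n)
    (x : matchingSpace (n * K.width)) :
    K.postFunctional n (tangleAction (K.le_width n) α x) =
      transferFront (shift (n * K.strand) α.front ++ nCopy n K.post) x 1 := by
  rw [transferFront_append]
  rfl

theorem satelliteRulingPoly_eq {n : ℕ} (hn : 1 ≤ n) (K : Knot) (ξ : TangleSum n) :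
    satelliteRulingPoly K ξ =
      K.postFunctional n (bmwAction (K.le_width n) (BMW.mk n ξ) (K.preVector hn)) := by
  rw [bmwAction_mk, tangleSumAction, MonoidAlgebra.lift_apply, Finsupp.sum, LinearMap.sum_apply,
    map_sum, satelliteRulingPoly, Finsupp.sum]
  refine Finset.sum_congr rfl fun α _ => ?_
  rw [LinearMap.smul_apply, map_smul, smul_eq_mul, postFunctional_tangleAction, rulingPoly_eq,
    satellite, transferFront_append]
  rfl

theorem reducedRulingPoly_eq {n : ℕ} (hn : 1 ≤ n) (K : Knot) (α : Tangle n)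
    (hα : ∀ e ∈ α.front, e.kind = .crossing) :
    reducedRulingPoly K α = K.postFunctional n (bmwAction (K.le_width n)
      (crossingProd n α.front) (matchingFilter
        (NoPairIn (Set.Ico (n * K.strand) (n * K.strand + n))) (K.preVector hn))) := by
  classical
  rw [← mk_single_eq_crossingProd hα α.runs, bmwAction_mk]
  have : tangleSumAction (K.le_width n) (single α.front α.runs) = tangleAction (K.le_width n) α :=
    MonoidAlgebra.lift_of _ _
  rw [this, postFunctional_tangleAction]
  exact sum_normalRulings_filter _ _ _ _ fun l hl => isReduced_iff hn K α hα hl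

theorem sum_reducedRulingPoly {n : ℕ} (hn : 1 ≤ n) (K : Knot)
    (braid : Equiv.Perm (Fin n) → Tangle n) (hbraid : ∀ β, IsPermutationBraid β (braid β)) :
    ∑ β, (s : CoeffRing) ^ (braid β).front.length * reducedRulingPoly K (braid β) =
      K.postFunctional n (bmwAction (K.le_width n) (symmetrizer n) (matchingFilter
        (NoPairIn (Set.Ico (n * K.strand) (n * K.strand + n))) (K.preVector hn))) := by
  rw [← sum_permutationBraid n braid hbraid, map_sum, LinearMap.sum_apply, map_sum]
  refine Finset.sum_congr rfl fun β _ => ?_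
  rw [map_smul, LinearMap.smul_apply, map_smul, smul_eq_mul,
    reducedRulingPoly_eq hn K _ (hbraid β).no_cusps]

/-- The BMW element `L n` annihilates the pairings in which parallel strands are paired, and acts on
the others as the symmetrizer. -/
theorem bmwAction_L_eq {n : ℕ} (hn : 1 ≤ n) {c N : ℕ} (hN : c + n ≤ N) (x : matchingSpace N) :
    bmwAction hN (L n) x =
      bmwAction hN (symmetrizer n) (matchingFilter (NoPairIn (Set.Ico c (c + n))) x) := by
  conv_lhs => rw [← matchingFilter_add (NoPairIn (Set.Ico c (c + n))) x]
  rw [map_add, (bmwAction_L hn hN _).2 (matchingFilter_mem _ x),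
    (bmwAction_L hn hN _).1 (matchingFilter_mem _ x), add_zero]

end LegRuling

theorem theorem2p7 (n : ℕ) (hn : 1 ≤ n) (K : LegRuling.Knot)
    (braid : Equiv.Perm (Fin n) → LegRuling.Tangle n)
    (hbraid : ∀ β, LegRuling.IsPermutationBraid β (braid β))
    (ξ : LegRuling.TangleSum n) (hξ : LegRuling.BMW.mk n ξ = LegRuling.L n) :
    LegRuling.coloredRulingPoly K braid =
      ((LegRuling.c n)⁻¹ : LegRuling.CoeffRingˣ) * LegRuling.satelliteRulingPoly K ξ := by
  rw [LegRuling.coloredRulingPoly, LegRuling.sum_reducedRulingPoly hn K braid hbraid,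
    LegRuling.satelliteRulingPoly_eq hn, hξ, LegRuling.bmwAction_L_eq hn]
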